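/- **Conventions.** Manifolds are smooth, finite-dimensional, without boundary, Hausdorff and second countable. Let $\mathcal G\rightrightarrows M$ be a Lie groupoid with structure maps $s,t,u,m,i$ ($s$ a submersion), and let $\mathcal G^{(2)}=\{(g,g')\in\mathcal G\times\mathcal G : s(g)=t(g')\}$, with inclusion $j:\mathcal G^{(2)}\hookrightarrow\mathcal G\times\mathcal G$. Its tangent prolongation $T\mathcal G\rightrightarrows TM$ is the Lie groupoid whose structure maps are the tangent maps of those of $\mathcal G$; it is iterated to $TT\mathcal G\rightrightarrows TTM$. Let $F:N\to N'$ be a smooth map. Smooth $(p,1)$-tensors $\mathcal T,\mathcal T'$ on $N,N'$ are *$F$-related* if $dF(\mathcal T(v_1,\dots,v_p))=\mathcal T'(dF(v_1),\dots,dF(v_p))$ for all $v_1,\dots,v_p\in T_xN$ and all $x\in N$. Linear connections $\nabla^N,\nabla^{N'}$ in $TN,TN'$ are *$F$-related* if, whenever $X_1,Y_1$ and $X_2,Y_2$ are two pairs of $F$-related vector fields ($X_k\in\mathfrak X(N)$, $Y_k\in\mathfrak X(N')$), the fields $\nabla^N_{X_1}X_2$ and $\nabla^{N'}_{Y_1}Y_2$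 are $F$-related. A $(p,1)$-tensor $\mathcal T$ on $\mathcal G$ is *multiplicative* if there is a $(p,1)$-tensor on $M$ to which $\mathcal T$ is both $s$-related and $t$-related, and the $(p,1)$-tensor $\mathcal T^{(2)}$ on $\mathcal G^{(2)}$ that is $j$-related to the product tensor $\mathcal T\times\mathcal T$ on $\mathcal G\times\mathcal G$ is $m$-related to $\mathcal T$. (Here $\mathcal T\times\mathcal T$ is the tensor related to $\mathcal T$ by both projections; vector fields are the case $p=0$.) *Multiplicative connections* in $T\mathcal G$ are defined in the same way, with linear connections in $TM$, $T\mathcal G^{(2)}$ and $T(\mathcal G\times\mathcal G)$ in place of tensors. For a linear connection $\nabla$ in $T\mathcal G$ let $T^\nabla(X,Y)=\nabla_XY-\nabla_YX-[X,Y]$ be its torsion and $\nabla^{\mathrm{sym}}=\nabla-\tfrac12T^\nabla$ its symmetric part. Let $H^\nabla\subseteq TT\mathcal G$ be its horizontal distribution, consisting of the vectors $d\sigma(w)$ with $\sigma\in\mathfrak X(\mathcal G)$, viewed as a map $\mathcal G\to T\mathcal G$, and $w\in T\mathcal G$ such that $\nabla_w\sigma=0$. Let $\theta^\nabla$ be the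 vertical projection, i.e. the $(1,1)$-tensor on $T\mathcal G$ that projects $TT\mathcal G$ onto the vertical bundle of $\pi:T\mathcal G\to\mathcal G$ with kernel $H^\nabla$. Let $Z^\nabla\in\mathfrak X(T\mathcal G)$ be the geodesic spray, i.e. $Z^\nabla(v)$ is the horizontal vector at $v\in T\mathcal G$ with $d\pi(Z^\nabla(v))=v$. **Proposition.** Let $\nabla$ be a smooth linear connection in the tangent bundle $T\mathcal G$ of a Lie groupoid $\mathcal G\rightrightarrows M$. The following conditions are equivalent: 1. $\nabla$ is a multiplicative connection; 2. the symmetric part $\nabla^{\mathrm{sym}}$ and the torsion $T^\nabla$ are multiplicative; 3. $H^\nabla$ is a Lie subgroupoid of $TT\mathcal G\rightrightarrows TTM$, i.e. there are submanifold structures on $H^\nabla$ and on a subset $N\subseteq TTM$, and a Lie groupoid structure on $H^\nabla\rightrightarrows N$, for which the inclusions form a morphism of groupoids; 4. the vertical projection $\theta^\nabla$ is a multiplicative $(1,1)$-tensor on $T\mathcal G\rightrightarrows TM$; 5. the torsion $T^\nabla$ is multiplicative, and the geodesic spray $Z^\nabla$ is a multiplicative vector field on $T\mathcal G\rightrightarrows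 TM$. -/

import Mathlib

open Manifold
open scoped ContDiff

noncomputable section

namespace MultConn

/-! ### Composable arrows -/

/-- The source and target maps of a Lie groupoid: a smooth submersion `src` and a smooth map `tgt`
from a manifold `G` (the arrows) to a manifold `M` (the objects). -/
structure SourceTarget (EM EG M G : Type*) [NormedAddCommGroup EM] [NormedSpace ℝ EM]
    [NormedAddCommGroup EG] [NormedSpace ℝ EG] [TopologicalSpace M] [ChartedSpace EM M]
    [TopologicalSpace G] [ChartedSpace EG G] where
  src : G → M
  tgt : G → M
  isSubmersion_src : IsSubmersion 𝓘(ℝ, EG) 𝓘(ℝ, EM) ∞ src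
  contMDiff_tgt : ContMDiff 𝓘(ℝ, EG) 𝓘(ℝ, EM) ∞ tgt

/-- The model space of the fibres of a submersion from a manifold modelled on `EG` to a manifold
modelled on `EM`. -/
abbrev FibreModel (EM EG : Type*) [NormedAddCommGroup EM] [NormedSpace ℝ EM]
    [NormedAddCommGroup EG] [NormedSpace ℝ EG] : Type :=
  EuclideanSpace ℝ (Fin (Module.finrank ℝ EG - Module.finrank ℝ EM))

/-- The model space of the manifold of composable arrows, of dimension `2 dim G - dim M`. -/
abbrev PairModel (EM EG : Type*) [NormedAddCommGroup EM] [NormedSpace ℝ EM]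
    [NormedAddCommGroup EG] [NormedSpace ℝ EG] : Type _ :=
  EG × FibreModel EM EG

namespace SourceTarget

variable {EM EG M G : Type*} [NormedAddCommGroup EM] [NormedSpace ℝ EM]
  [NormedAddCommGroup EG] [NormedSpace ℝ EG] [TopologicalSpace M] [ChartedSpace EM M]
  [TopologicalSpace G] [ChartedSpace EG G]

/-- The composable arrows `G⁽²⁾ = {(g, h) ∈ G × G | s(g) = t(h)}`. -/
@[ext]
structure Composable (P : SourceTarget EM EG M G) where
  fst : G
  snd : G
  src_fst : P.src fst = P.tgt snd

variable (P : SourceTarget EM EG M G)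

/-- The inclusion of the composable arrows into `G × G`. -/
def incl (c : P.Composable) : G × G := (c.fst, c.snd)

/-- `G⁽²⁾` carries the subspace topology of `G × G`. -/
instance : TopologicalSpace P.Composable := TopologicalSpace.induced P.incl inferInstance

theorem continuous_incl : Continuous P.incl := continuous_induced_dom

section chart

variable [FiniteDimensional ℝ EM] [FiniteDimensional ℝ EG]

theorem isSubmersionAt_fibreModel (g : G) :
    IsSubmersionAtOfComplement (FibreModel EM EG) 𝓘(ℝ, EG) 𝓘(ℝ, EM) ∞ P.src g := by
  have h := (P.isSubmersion_src.isSubmersionAt g).isSubmersionAtOfComplement_complement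
  let e := h.equiv
  have : FiniteDimensional ℝ (EM × (P.isSubmersion_src.isSubmersionAt g).complement) :=
    e.toLinearEquiv.finiteDimensional
  have : FiniteDimensional ℝ (P.isSubmersion_src.isSubmersionAt g).complement :=
    FiniteDimensional.of_surjective
      (LinearMap.snd ℝ EM (P.isSubmersion_src.isSubmersionAt g).complement) Prod.snd_surjective
  have hd := e.toLinearEquiv.finrank_eq
  rw [Module.finrank_prod] at hd
  refine h.trans_F (ContinuousLinearEquiv.ofFinrankEq ?_)
  rw [finrank_euclideanSpace_fin, hd, Nat.add_sub_cancel_left]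

/-- A chart of `G` at `c.fst`, adapted to `src`. -/
def φ (c : P.Composable) : OpenPartialHomeomorph G EG :=
  (P.isSubmersionAt_fibreModel c.fst).domChart

/-- A chart of `M` at `src c.fst`, adapted to `src`. -/
def ψ (c : P.Composable) : OpenPartialHomeomorph M EM :=
  (P.isSubmersionAt_fibreModel c.fst).codChart

/-- The splitting of `EG` in which `src` becomes the projection to `EM`. -/
def split (c : P.Composable) : EG ≃L[ℝ] EM × FibreModel EM EG :=
  (P.isSubmersionAt_fibreModel c.fst).equiv

theorem φ_mem (c : P.Composable) : P.φ c ∈ IsManifold.maximalAtlas 𝓘(ℝ, EG) ∞ G :=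
  (P.isSubmersionAt_fibreModel c.fst).domChart_mem_maximalAtlas

theorem ψ_mem (c : P.Composable) : P.ψ c ∈ IsManifold.maximalAtlas 𝓘(ℝ, EM) ∞ M :=
  (P.isSubmersionAt_fibreModel c.fst).codChart_mem_maximalAtlas

theorem src_mem (c : P.Composable) {a : G} (ha : a ∈ (P.φ c).source) :
    P.src a ∈ (P.ψ c).source :=
  (P.isSubmersionAt_fibreModel c.fst).mapsto_domChart_source_codChart_source ha

theorem ψ_src (c : P.Composable) {a : G} (ha : a ∈ (P.φ c).source) :
    P.ψ c (P.src a) = (P.split c (P.φ c a)).1 := by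
  have h := P.isSubmersionAt_fibreModel c.fst
  have hz : P.φ c a ∈ (h.domChart.extend 𝓘(ℝ, EG)).target := by
    rw [OpenPartialHomeomorph.extend_target]
    exact ⟨(P.φ c).map_source ha, Set.mem_range_self _⟩
  have h1 := h.writtenInCharts hz
  have h2 := (P.φ c).left_inv ha
  simp only [φ] at h2
  simpa [φ, ψ, split, h2] using h1

/-- The coordinates `(g, h) ↦ (χ(h), v(g))` on `G⁽²⁾` near `c`, where `χ` is a chart of `G` at
`c.snd` and `v` is the fibre component of a chart of `G` at `c.fst` adapted to `src`. -/
def coord (c : P.Composable) (p : G × G) : PairModel EM EG :=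
  (chartAt EG c.snd p.2, (P.split c (P.φ c p.1)).2)

/-- The object `t(χ⁻¹(y))`. -/
def midpoint (c : P.Composable) (q : PairModel EM EG) : M :=
  P.tgt ((chartAt EG c.snd).symm q.1)

/-- The inverse of `coord`. -/
def uncoord (c : P.Composable) (q : PairModel EM EG) : G × G :=
  ((P.φ c).symm ((P.split c).symm (P.ψ c (P.midpoint c q), q.2)), (chartAt EG c.snd).symm q.1)

/-- The domain in `G × G` of the coordinates near `c`. -/
def coordSource (c : P.Composable) : Set (G × G) := (P.φ c).source ×ˢ (chartAt EG c.snd).source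

/-- The image of the coordinates near `c`. -/
def coordTarget (c : P.Composable) : Set (PairModel EM EG) :=
  {q | (q.1 ∈ (chartAt EG c.snd).target ∧ P.midpoint c q ∈ (P.ψ c).source) ∧
    (P.split c).symm (P.ψ c (P.midpoint c q), q.2) ∈ (P.φ c).target}

theorem uncoord_mem (c : P.Composable) {q : PairModel EM EG} (hq : q ∈ P.coordTarget c) :
    P.uncoord c q ∈ P.coordSource c :=
  ⟨(P.φ c).map_target hq.2, (chartAt EG c.snd).map_target hq.1.1⟩

theorem src_uncoord (c : P.Composable) {q : PairModel EM EG} (hq : q ∈ P.coordTarget c) :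
    P.src (P.uncoord c q).1 = P.tgt (P.uncoord c q).2 := by
  have h1 := (P.uncoord_mem c hq).1
  refine (P.ψ c).injOn (P.src_mem c h1) hq.1.2 ?_
  rw [P.ψ_src c h1]
  simp only [uncoord]
  rw [(P.φ c).right_inv hq.2, ContinuousLinearEquiv.apply_symm_apply]
  rfl

theorem coord_uncoord (c : P.Composable) {q : PairModel EM EG} (hq : q ∈ P.coordTarget c) :
    P.coord c (P.uncoord c q) = q := by
  refine Prod.ext ((chartAt EG c.snd).right_inv hq.1.1) ?_
  simp only [uncoord, coord]
  rw [(P.φ c).right_inv hq.2, ContinuousLinearEquiv.apply_symm_apply]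

theorem split_coord (c : P.Composable) {p : G × G} (hp : p ∈ P.coordSource c)
    (h : P.src p.1 = P.tgt p.2) :
    (P.split c).symm (P.ψ c (P.midpoint c (P.coord c p)), (P.coord c p).2) = P.φ c p.1 := by
  have : P.midpoint c (P.coord c p) = P.src p.1 := by
    rw [h]
    exact congrArg P.tgt ((chartAt EG c.snd).left_inv hp.2)
  rw [this, P.ψ_src c hp.1, ContinuousLinearEquiv.symm_apply_eq]
  rfl

theorem uncoord_coord (c : P.Composable) {p : G × G} (hp : p ∈ P.coordSource c)
    (h : P.src p.1 = P.tgt p.2) : P.uncoord c (P.coord c p) = p := by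
  refine Prod.ext ?_ ((chartAt EG c.snd).left_inv hp.2)
  simp only [uncoord]
  rw [P.split_coord c hp h, (P.φ c).left_inv hp.1]

theorem coord_mem (c : P.Composable) {p : G × G} (hp : p ∈ P.coordSource c)
    (h : P.src p.1 = P.tgt p.2) : P.coord c p ∈ P.coordTarget c := by
  refine ⟨⟨(chartAt EG c.snd).map_source hp.2, ?_⟩, ?_⟩
  · have : P.midpoint c (P.coord c p) = P.src p.1 := by
      rw [h]
      exact congrArg P.tgt ((chartAt EG c.snd).left_inv hp.2)
    rw [this]
    exact P.src_mem c hp.1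
  · rw [P.split_coord c hp h]
    exact (P.φ c).map_source hp.1

theorem isOpen_coordSource (c : P.Composable) : IsOpen (P.coordSource c) :=
  (P.φ c).open_source.prod (chartAt EG c.snd).open_source

theorem isOpen_coordTarget (c : P.Composable) : IsOpen (P.coordTarget c) := by
  have h0 : IsOpen {q : PairModel EM EG | q.1 ∈ (chartAt EG c.snd).target} :=
    (chartAt EG c.snd).open_target.preimage continuous_fst
  have hm : ContinuousOn (P.midpoint c) {q | q.1 ∈ (chartAt EG c.snd).target} :=
    P.contMDiff_tgt.continuous.comp_continuousOn
      ((chartAt EG c.snd).continuousOn_symm.comp continuous_fst.continuousOn fun _ h => h)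
  have h1 := hm.isOpen_inter_preimage h0 (P.ψ c).open_source
  have h2 : ContinuousOn (fun q : PairModel EM EG =>
      (P.split c).symm (P.ψ c (P.midpoint c q), q.2))
      ({q | q.1 ∈ (chartAt EG c.snd).target} ∩ P.midpoint c ⁻¹' (P.ψ c).source) :=
    (P.split c).symm.continuous.comp_continuousOn
      (((P.ψ c).continuousOn.comp (hm.mono Set.inter_subset_left) fun _ h => h.2).prodMk
        continuous_snd.continuousOn)
  exact h2.isOpen_inter_preimage h1 (P.φ c).open_target

section smooth
variable [IsManifold 𝓘(ℝ, EG) ∞ G]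

theorem contMDiffOn_coord (c : P.Composable) :
    ContMDiffOn (𝓘(ℝ, EG).prod 𝓘(ℝ, EG)) 𝓘(ℝ, PairModel EM EG) ∞ (P.coord c)
      (P.coordSource c) := by
  have h1 : ContMDiffOn (𝓘(ℝ, EG).prod 𝓘(ℝ, EG)) 𝓘(ℝ, EG) ∞
      (fun p : G × G => chartAt EG c.snd p.2) (P.coordSource c) :=
    (contMDiffOn_chart (I := 𝓘(ℝ, EG)) (x := c.snd)).comp contMDiff_snd.contMDiffOn
      fun _ h => h.2
  have h2 : ContMDiffOn (𝓘(ℝ, EG).prod 𝓘(ℝ, EG)) 𝓘(ℝ, EG) ∞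
      (fun p : G × G => P.φ c p.1) (P.coordSource c) :=
    (contMDiffOn_of_mem_maximalAtlas (P.φ_mem c)).comp contMDiff_fst.contMDiffOn fun _ h => h.1
  have h3 : ContMDiff 𝓘(ℝ, EG) 𝓘(ℝ, FibreModel EM EG) ∞ fun z => (P.split c z).2 :=
    (contDiff_snd.comp (P.split c).contDiff).contMDiff
  exact h1.prodMk_space (h3.comp_contMDiffOn h2)

theorem contMDiffOn_uncoord (c : P.Composable) :
    ContMDiffOn 𝓘(ℝ, PairModel EM EG) (𝓘(ℝ, EG).prod 𝓘(ℝ, EG)) ∞ (P.uncoord c)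
      (P.coordTarget c) := by
  have h1 : ContMDiffOn 𝓘(ℝ, PairModel EM EG) 𝓘(ℝ, EG) ∞
      (fun q : PairModel EM EG => (chartAt EG c.snd).symm q.1) (P.coordTarget c) :=
    (contMDiffOn_chart_symm (I := 𝓘(ℝ, EG)) (x := c.snd)).comp
      contDiff_fst.contMDiff.contMDiffOn fun _ h => h.1.1
  have h2 : ContMDiffOn 𝓘(ℝ, PairModel EM EG) 𝓘(ℝ, EM) ∞ (P.midpoint c) (P.coordTarget c) :=
    P.contMDiff_tgt.comp_contMDiffOn h1
  have h3 : ContMDiffOn 𝓘(ℝ, PairModel EM EG) 𝓘(ℝ, EM) ∞ (fun q => P.ψ c (P.midpoint c q))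
      (P.coordTarget c) :=
    (contMDiffOn_of_mem_maximalAtlas (P.ψ_mem c)).comp h2 fun _ h => h.1.2
  have h4 : ContMDiffOn 𝓘(ℝ, PairModel EM EG) 𝓘(ℝ, EG) ∞
      (fun q => (P.split c).symm (P.ψ c (P.midpoint c q), q.2)) (P.coordTarget c) :=
    (P.split c).symm.contDiff.contMDiff.comp_contMDiffOn
      (h3.prodMk_space contDiff_snd.contMDiff.contMDiffOn)
  exact ((contMDiffOn_symm_of_mem_maximalAtlas (P.φ_mem c)).comp h4 fun _ h => h.2).prodMk h1

end smooth

theorem continuousOn_coord (c : P.Composable) : ContinuousOn (P.coord c) (P.coordSource c) :=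
  ((chartAt EG c.snd).continuousOn.comp continuousOn_snd fun _ h => h.2).prodMk
    (((continuous_snd.comp (P.split c).continuous).comp_continuousOn
      ((P.φ c).continuousOn.comp continuousOn_fst fun _ h => h.1)))

theorem continuousOn_uncoord (c : P.Composable) :
    ContinuousOn (P.uncoord c) (P.coordTarget c) := by
  have h1 : ContinuousOn (fun q : PairModel EM EG => (chartAt EG c.snd).symm q.1)
      (P.coordTarget c) :=
    (chartAt EG c.snd).continuousOn_symm.comp continuousOn_fst fun _ h => h.1.1
  have h2 : ContinuousOn (fun q => P.ψ c (P.midpoint c q)) (P.coordTarget c) :=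
    (P.ψ c).continuousOn.comp (P.contMDiff_tgt.continuous.comp_continuousOn h1) fun _ h => h.1.2
  exact ((P.φ c).continuousOn_symm.comp
    ((P.split c).symm.continuous.comp_continuousOn (h2.prodMk continuousOn_snd))
      fun _ h => h.2).prodMk h1

open Classical in
/-- The chart of `G⁽²⁾` at `c`. -/
def pairChart (c : P.Composable) : OpenPartialHomeomorph P.Composable (PairModel EM EG) where
  toFun p := P.coord c (P.incl p)
  invFun q := if h : P.src (P.uncoord c q).1 = P.tgt (P.uncoord c q).2 then ⟨_, _, h⟩ else c
  source := P.incl ⁻¹' P.coordSource c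
  target := P.coordTarget c
  map_source' p hp := P.coord_mem c hp p.src_fst
  map_target' q hq := by
    rw [dif_pos (P.src_uncoord c hq)]
    exact P.uncoord_mem c hq
  left_inv' p hp := by
    have h := P.uncoord_coord c hp p.src_fst
    have h' : P.src (P.uncoord c (P.coord c (P.incl p))).1
        = P.tgt (P.uncoord c (P.coord c (P.incl p))).2 := by rw [h]; exact p.src_fst
    rw [dif_pos h']
    exact Composable.ext (congrArg Prod.fst h) (congrArg Prod.snd h)
  right_inv' q hq := by
    rw [dif_pos (P.src_uncoord c hq)]
    exact P.coord_uncoord c hq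
  open_source := (P.isOpen_coordSource c).preimage P.continuous_incl
  open_target := P.isOpen_coordTarget c
  continuousOn_toFun := (P.continuousOn_coord c).comp P.continuous_incl.continuousOn fun _ h => h
  continuousOn_invFun := by
    rw [(⟨rfl⟩ : Topology.IsInducing P.incl).continuousOn_iff]
    refine (P.continuousOn_uncoord c).congr fun q hq => ?_
    simp only [Function.comp]
    rw [dif_pos (P.src_uncoord c hq)]
    rfl

theorem incl_pairChart_symm (c : P.Composable) {q : PairModel EM EG} (hq : q ∈ P.coordTarget c) :
    P.incl ((P.pairChart c).symm q) = P.uncoord c q := by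
  simp only [pairChart, OpenPartialHomeomorph.coe_mk_symm, PartialEquiv.coe_symm_mk]
  rw [dif_pos (P.src_uncoord c hq)]
  rfl

/-- The manifold structure of `G⁽²⁾`, as a submanifold of `G × G`. -/
instance : ChartedSpace (PairModel EM EG) P.Composable where
  atlas := Set.range P.pairChart
  chartAt := P.pairChart
  mem_chart_source c := ⟨(P.isSubmersionAt_fibreModel c.fst).mem_domChart_source,
    mem_chart_source EG c.snd⟩
  chart_mem_atlas c := ⟨c, rfl⟩

instance [IsManifold 𝓘(ℝ, EM) ∞ M] [IsManifold 𝓘(ℝ, EG) ∞ G] :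
    IsManifold 𝓘(ℝ, PairModel EM EG) ∞ P.Composable := by
  refine isManifold_of_contDiffOn _ _ _ ?_
  rintro _ _ ⟨c, rfl⟩ ⟨c', rfl⟩
  simp only [modelWithCornersSelf_coe, modelWithCornersSelf_coe_symm, Function.id_comp,
    Function.comp_id, Set.preimage_id, Set.range_id, Set.inter_univ]
  refine ContMDiffOn.contDiffOn (((P.contMDiffOn_coord c').comp
    ((P.contMDiffOn_uncoord c).mono ?_) ?_).congr ?_)
  · exact fun q hq => hq.1
  · intro q hq
    rw [Set.mem_preimage, ← P.incl_pairChart_symm c hq.1]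
    exact hq.2
  · intro q hq
    change P.coord c' (P.incl ((P.pairChart c).symm q)) = _
    rw [P.incl_pairChart_symm c hq.1]
    rfl

/-- The inclusion of `G⁽²⁾` into `G × G` is smooth. -/
theorem contMDiff_incl [IsManifold 𝓘(ℝ, EM) ∞ M] [IsManifold 𝓘(ℝ, EG) ∞ G] :
    ContMDiff 𝓘(ℝ, PairModel EM EG) (𝓘(ℝ, EG).prod 𝓘(ℝ, EG)) ∞ P.incl := by
  intro c
  have hc : c ∈ (P.pairChart c).source := mem_chart_source (PairModel EM EG) c
  have h1 : ContMDiffAt 𝓘(ℝ, PairModel EM EG) (𝓘(ℝ, EG).prod 𝓘(ℝ, EG)) ∞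
      (P.uncoord c ∘ P.pairChart c) c :=
    ((P.contMDiffOn_uncoord c).contMDiffAt
      ((P.isOpen_coordTarget c).mem_nhds ((P.pairChart c).map_source hc))).comp c
      (contMDiffAt_of_mem_maximalAtlas (IsManifold.chart_mem_maximalAtlas c) hc)
  refine h1.congr_of_eventuallyEq ?_
  filter_upwards [(P.pairChart c).open_source.mem_nhds hc] with p hp
  exact (P.uncoord_coord c hp p.src_fst).symm

end chart
end SourceTarget

/-! ### Lie groupoids -/

/-- A Lie groupoid `G ⇉ M`. The product `mul (g, h)` is defined when `src g = tgt h`, and the manifold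
structure on the set of composable arrows is that of a submanifold of `G × G`. -/
structure LieGroupoid (EM EG M G : Type*) [NormedAddCommGroup EM] [NormedSpace ℝ EM]
    [FiniteDimensional ℝ EM] [NormedAddCommGroup EG] [NormedSpace ℝ EG] [FiniteDimensional ℝ EG]
    [TopologicalSpace M] [ChartedSpace EM M] [TopologicalSpace G] [ChartedSpace EG G]
    extends SourceTarget EM EG M G where
  unit : M → G
  inv : G → G
  mul : toSourceTarget.Composable → G
  contMDiff_unit : ContMDiff 𝓘(ℝ, EM) 𝓘(ℝ, EG) ∞ unit
  contMDiff_inv : ContMDiff 𝓘(ℝ, EG) 𝓘(ℝ, EG) ∞ inv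
  contMDiff_mul : ContMDiff 𝓘(ℝ, PairModel EM EG) 𝓘(ℝ, EG) ∞ mul
  src_unit : ∀ x, src (unit x) = x
  tgt_unit : ∀ x, tgt (unit x) = x
  src_inv : ∀ g, src (inv g) = tgt g
  tgt_inv : ∀ g, tgt (inv g) = src g
  src_mul : ∀ c, src (mul c) = src c.snd
  tgt_mul : ∀ c, tgt (mul c) = tgt c.fst
  unit_mul : ∀ g, mul ⟨unit (tgt g), g, src_unit _⟩ = g
  mul_unit : ∀ g, mul ⟨g, unit (src g), (tgt_unit _).symm⟩ = g
  inv_mul : ∀ g, mul ⟨inv g, g, src_inv _⟩ = unit (src g)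
  mul_inv : ∀ g, mul ⟨g, inv g, (tgt_inv _).symm⟩ = unit (tgt g)
  mul_assoc : ∀ (g h k : G) (hgh : src g = tgt h) (hhk : src h = tgt k),
    mul ⟨mul ⟨g, h, hgh⟩, k, (src_mul _).trans hhk⟩ =
      mul ⟨g, mul ⟨h, k, hhk⟩, hgh.trans (tgt_mul ⟨h, k, hhk⟩).symm⟩

/-- The structure maps of a groupoid with arrows `G` and objects `M`, together with its composable
pairs `C`, given with their two components. -/
structure GroupoidMaps (M G C : Type*) where
  src : G → M
  tgt : G → M
  unit : M → G
  inv : G → G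
  fst : C → G
  snd : C → G
  mul : C → G

/-- The structure maps of a Lie groupoid. -/
def LieGroupoid.maps {EM EG M G : Type*} [NormedAddCommGroup EM] [NormedSpace ℝ EM]
    [FiniteDimensional ℝ EM] [NormedAddCommGroup EG] [NormedSpace ℝ EG] [FiniteDimensional ℝ EG]
    [TopologicalSpace M] [ChartedSpace EM M] [TopologicalSpace G] [ChartedSpace EG G]
    (K : LieGroupoid EM EG M G) : GroupoidMaps M G K.Composable where
  src := K.src
  tgt := K.tgt
  unit := K.unit
  inv := K.inv
  fst := SourceTarget.Composable.fst
  snd := SourceTarget.Composable.snd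
  mul := K.mul

section manifolds

variable {EM HM EG HG EC HC : Type*}
  [NormedAddCommGroup EM] [NormedSpace ℝ EM] [TopologicalSpace HM]
  [NormedAddCommGroup EG] [NormedSpace ℝ EG] [TopologicalSpace HG]
  [NormedAddCommGroup EC] [NormedSpace ℝ EC] [TopologicalSpace HC]
  (IM : ModelWithCorners ℝ EM HM) (IG : ModelWithCorners ℝ EG HG) (IC : ModelWithCorners ℝ EC HC)
  {M G C : Type*} [TopologicalSpace M] [ChartedSpace HM M] [TopologicalSpace G] [ChartedSpace HG G]
  [TopologicalSpace C] [ChartedSpace HC C]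

/-- The tangent prolongation `TG ⇉ TM` of a Lie groupoid `G ⇉ M`: all structure maps are the tangent
maps of those of `G ⇉ M`. As `s` is a submersion, `v ↦ (T fst v, T snd v)` identifies `T(G⁽²⁾)` with
the composable pairs `{(v, w) ∈ TG × TG | Ts v = Tt w}` of the prolongation. -/
def GroupoidMaps.tangent (D : GroupoidMaps M G C) :
    GroupoidMaps (TangentBundle IM M) (TangentBundle IG G) (TangentBundle IC C) where
  src := tangentMap IG IM D.src
  tgt := tangentMap IG IM D.tgt
  unit := tangentMap IM IG D.unit
  inv := tangentMap IG IG D.inv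
  fst := tangentMap IC IG D.fst
  snd := tangentMap IC IG D.snd
  mul := tangentMap IC IG D.mul

/-- The tangent prolongation `TG ⇉ TM` of the Lie groupoid `K = (G ⇉ M)`. -/
def LieGroupoid.tangentMaps {EM EG M G : Type*} [NormedAddCommGroup EM] [NormedSpace ℝ EM]
    [FiniteDimensional ℝ EM] [NormedAddCommGroup EG] [NormedSpace ℝ EG] [FiniteDimensional ℝ EG]
    [TopologicalSpace M] [ChartedSpace EM M] [TopologicalSpace G] [ChartedSpace EG G]
    (K : LieGroupoid EM EG M G) :
    GroupoidMaps (TangentBundle 𝓘(ℝ, EM) M) (TangentBundle 𝓘(ℝ, EG) G)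
      (TangentBundle 𝓘(ℝ, PairModel EM EG) K.Composable) :=
  K.maps.tangent 𝓘(ℝ, EM) 𝓘(ℝ, EG) 𝓘(ℝ, PairModel EM EG)

/-- The tangent prolongation `TTG ⇉ TTM` of `TG ⇉ TM`. -/
def LieGroupoid.tangentTangentMaps {EM EG M G : Type*} [NormedAddCommGroup EM] [NormedSpace ℝ EM]
    [FiniteDimensional ℝ EM] [NormedAddCommGroup EG] [NormedSpace ℝ EG] [FiniteDimensional ℝ EG]
    [TopologicalSpace M] [ChartedSpace EM M] [IsManifold 𝓘(ℝ, EM) ∞ M]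
    [TopologicalSpace G] [ChartedSpace EG G] [IsManifold 𝓘(ℝ, EG) ∞ G]
    (K : LieGroupoid EM EG M G) :
    GroupoidMaps (TangentBundle 𝓘(ℝ, EM).tangent (TangentBundle 𝓘(ℝ, EM) M))
      (TangentBundle 𝓘(ℝ, EG).tangent (TangentBundle 𝓘(ℝ, EG) G))
      (TangentBundle 𝓘(ℝ, PairModel EM EG).tangent
        (TangentBundle 𝓘(ℝ, PairModel EM EG) K.Composable)) :=
  K.tangentMaps.tangent 𝓘(ℝ, EM).tangent 𝓘(ℝ, EG).tangent 𝓘(ℝ, PairModel EM EG).tangent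

/-- The inclusion of the composable pairs into `G × G`. -/
def GroupoidMaps.incl (D : GroupoidMaps M G C) (c : C) : G × G := (D.fst c, D.snd c)

/-! ### Vector fields, tensors and relatedness -/

/-- A (not necessarily smooth) vector field. -/
abbrev VField (M : Type*) [TopologicalSpace M] [ChartedSpace HM M] : Type _ :=
  (x : M) → TangentSpace IM x

/-- A (not necessarily smooth) `(p, 1)`-tensor, as a field of `p`-linear maps from the tangent spaces
to themselves. -/
abbrev Tensor (p : ℕ) (M : Type*) [TopologicalSpace M] [ChartedSpace HM M] : Type _ :=
  (x : M) → MultilinearMap ℝ (fun _ : Fin p => TangentSpace IM x) (TangentSpace IM x)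

/-- A connection in the tangent bundle; `cov Y x (X x)` is `(∇_X Y)(x)`. -/
abbrev Conn (M : Type*) [TopologicalSpace M] [ChartedSpace HM M] [IsManifold IM ∞ M] : Type _ :=
  CovariantDerivative IM EM (TangentSpace IM : M → Type _)

section
variable {IM}

/-- A vector field `X` on `M` as a map `M → TM`. -/
def VField.toMap (X : VField IM M) (x : M) : TangentBundle IM M := ⟨x, X x⟩

/-- Smoothness of a vector field. -/
def VField.IsSmooth [IsManifold IM ∞ M] (X : VField IM M) : Prop :=
  ContMDiff IM IM.tangent ∞ X.toMap

/-- Smoothness of a `(p, 1)`-tensor: it maps smooth vector fields to smooth vector fields. -/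
def Tensor.IsSmooth [IsManifold IM ∞ M] {p : ℕ} (τ : Tensor IM p M) : Prop :=
  ∀ X : Fin p → VField IM M, (∀ i, (X i).IsSmooth) →
    VField.IsSmooth (IM := IM) fun x => τ x fun i => X i x

/-- Smoothness of a connection: it maps smooth vector fields to smooth tensors. -/
abbrev Conn.IsSmooth [IsManifold IM ∞ M] (cov : Conn IM M) : Prop :=
  CovariantDerivative.ContMDiffCovariantDerivative cov ∞

end

section
variable {IM IG}

/-- Vector fields related by `F`. -/
def VField.Related (F : M → G) (X : VField IM M) (Y : VField IG G) : Prop :=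
  ∀ x, mfderiv IM IG F x (X x) = Y (F x)

/-- `(p, 1)`-tensors related by `F`. -/
def Tensor.Related {p : ℕ} (F : M → G) (τ : Tensor IM p M) (τ' : Tensor IG p G) : Prop :=
  ∀ (x : M) (v : Fin p → TangentSpace IM x),
    mfderiv IM IG F x (τ x v) = τ' (F x) fun i => mfderiv IM IG F x (v i)

/-- Connections related by `F`: if `X₁, Y₁` and `X₂, Y₂` are pairs of `F`-related vector fields, then
`∇_{X₁} X₂` and `∇_{Y₁} Y₂` are `F`-related. -/
def Conn.Related [IsManifold IM ∞ M] [IsManifold IG ∞ G] (F : M → G) (cov : Conn IM M)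
    (cov' : Conn IG G) : Prop :=
  ∀ (X₁ X₂ : VField IM M) (Y₁ Y₂ : VField IG G),
    X₁.IsSmooth → X₂.IsSmooth → Y₁.IsSmooth → Y₂.IsSmooth →
    X₁.Related F Y₁ → X₂.Related F Y₂ →
    VField.Related (IM := IM) (IG := IG) F (fun x => cov X₂ x (X₁ x)) fun y => cov' Y₂ y (Y₁ y)

end

/-! ### Multiplicative tensors and connections -/

/-- A `(p, 1)`-tensor `τ` on the arrows of a Lie groupoid is multiplicative if it is
`(s, t)`-projectable and the restriction `τC` of `τ × τ` to the composable pairs is related to `τ`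
by the multiplication. -/
def Tensor.IsMultiplicative [IsManifold IM ∞ M] [IsManifold IG ∞ G] [IsManifold IC ∞ C]
    (D : GroupoidMaps M G C) {p : ℕ} (τ : Tensor IG p G) : Prop :=
  τ.IsSmooth ∧
  (∃ τM : Tensor IM p M, τM.IsSmooth ∧ τ.Related D.src τM ∧ τ.Related D.tgt τM) ∧
  ∃ (τ2 : Tensor (IG.prod IG) p (G × G)) (τC : Tensor IC p C),
    τ2.IsSmooth ∧ τ2.Related Prod.fst τ ∧ τ2.Related Prod.snd τ ∧
    τC.IsSmooth ∧ τC.Related D.incl τ2 ∧ τC.Related D.mul τ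

/-- A connection `cov` in `TG` is multiplicative if it is `(s, t)`-projectable and the restriction
`covC` of `cov × cov` to the composable pairs is related to `cov` by the multiplication. -/
def Conn.IsMultiplicative [IsManifold IM ∞ M] [IsManifold IG ∞ G] [IsManifold IC ∞ C]
    (D : GroupoidMaps M G C) (cov : Conn IG G) : Prop :=
  cov.IsSmooth ∧
  (∃ covM : Conn IM M, covM.IsSmooth ∧ cov.Related D.src covM ∧ cov.Related D.tgt covM) ∧
  ∃ (cov2 : Conn (IG.prod IG) (G × G)) (covC : Conn IC C),
    cov2.IsSmooth ∧ cov2.Related Prod.fst cov ∧ cov2.Related Prod.snd cov ∧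
    covC.IsSmooth ∧ covC.Related D.incl cov2 ∧ covC.Related D.mul cov

/-! ### Torsion, symmetric part, horizontal distribution, vertical projection, geodesic spray -/

section
variable {IM}
variable [IsManifold IM ∞ M]

/-- A vector field as a `(0, 1)`-tensor. -/
def VField.toTensor (X : VField IM M) : Tensor IM 0 M :=
  fun x => MultilinearMap.constOfIsEmpty ℝ (fun _ : Fin 0 => TangentSpace IM x) (X x)

/-- A field of endomorphisms of the tangent spaces as a `(1, 1)`-tensor. -/
def endoToTensor (A : (x : M) → TangentSpace IM x →ₗ[ℝ] TangentSpace IM x) : Tensor IM 1 M :=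
  fun x => MultilinearMap.ofSubsingleton ℝ (TangentSpace IM x) (TangentSpace IM x) (0 : Fin 1) (A x)

/-- The torsion `T(X, Y) = ∇_X Y - ∇_Y X - [X, Y]` as a `(2, 1)`-tensor. -/
def Conn.torsionTensor [FiniteDimensional ℝ EM] (cov : Conn IM M) : Tensor IM 2 M :=
  fun x =>
    { toFun := fun v => cov.torsion x (v 0) (v 1)
      map_update_add' := by
        intro _ v i a b
        fin_cases i <;> simp
      map_update_smul' := by
        intro _ v i a b
        fin_cases i <;> simp }

/-- The symmetric part `∇^sym_X Y = ∇_X Y + ½ T(Y, X) = ∇_X Y - ½ T(X, Y)`. -/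
def Conn.symPart [FiniteDimensional ℝ EM] (cov : Conn IM M) : Conn IM M :=
  cov.addOneForm fun x => (1 / 2 : ℝ) • cov.torsion x

theorem Conn.symPart_apply [FiniteDimensional ℝ EM] (cov : Conn IM M) (Y : VField IM M) (x : M)
    (w : TangentSpace IM x) :
    cov.symPart Y x w = cov Y x w - (1 / 2 : ℝ) • cov.torsion x w (Y x) := by
  change cov Y x w + (1 / 2 : ℝ) • cov.torsion x (Y x) w = _
  rw [cov.torsion_antisymm, smul_neg, sub_eq_add_neg]

/-- The horizontal distribution in `T(TM)`: the vectors `Tσ(w)`, for a smooth vector field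
`σ : M → TM` and a tangent vector `w` of `M` with `∇_w σ = 0`. -/
def Conn.horizontal (cov : Conn IM M) : Set (TangentBundle IM.tangent (TangentBundle IM M)) :=
  {ξ | ∃ (σ : VField IM M) (x : M) (w : TangentSpace IM x), σ.IsSmooth ∧ cov σ x w = 0 ∧
    ξ = tangentMap IM IM.tangent σ.toMap ⟨x, w⟩}

/-- The tangent map at `e` of the bundle projection `TM → M`. -/
def dproj (e : TangentBundle IM M) :
    TangentSpace IM.tangent e →L[ℝ] TangentSpace IM e.proj :=
  mfderiv IM.tangent IM (Bundle.TotalSpace.proj : TangentBundle IM M → M) e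

/-- `θ` is the vertical projection of the connection: at each `e ∈ TM`, it is the projection of
`T_e(TM)` onto the vertical vectors whose kernel is the horizontal distribution. -/
def Conn.IsVerticalProjection (cov : Conn IM M)
    (θ : (e : TangentBundle IM M) → TangentSpace IM.tangent e →ₗ[ℝ] TangentSpace IM.tangent e) :
    Prop :=
  ∀ e : TangentBundle IM M,
    (∀ ξ, dproj e (θ e ξ) = 0) ∧ (∀ ξ, dproj e ξ = 0 → θ e ξ = ξ) ∧
    ∀ ξ, θ e ξ = 0 ↔ (⟨e, ξ⟩ : TangentBundle IM.tangent (TangentBundle IM M)) ∈ cov.horizontal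

/-- `Z` is the geodesic spray of the connection: `Z(e)` is the horizontal vector at `e ∈ TM` that
projects to `e`. -/
def Conn.IsGeodesicSpray (cov : Conn IM M) (Z : VField IM.tangent (TangentBundle IM M)) : Prop :=
  ∀ e : TangentBundle IM M, Z.toMap e ∈ cov.horizontal ∧ dproj e (Z e) = e.snd

end

/-! ### Lie subgroupoids -/

/-- The set `S` of arrows is a Lie subgroupoid of a Lie groupoid with the structure maps `D`: there
are submanifold structures on `S` and on a set `S₀` of objects, and a Lie groupoid structure on
`S ⇉ S₀` for which the inclusions form a morphism of groupoids. -/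
def IsLieSubgroupoid (D : GroupoidMaps M G C) (S : Set G) : Prop :=
  ∃ (S₀ : Set M) (k n : ℕ)
    (_ : ChartedSpace (EuclideanSpace ℝ (Fin k)) S₀) (_ : IsManifold (𝓡 k) ∞ S₀)
    (_ : ChartedSpace (EuclideanSpace ℝ (Fin n)) S) (_ : IsManifold (𝓡 n) ∞ S)
    (L : LieGroupoid (EuclideanSpace ℝ (Fin k)) (EuclideanSpace ℝ (Fin n)) S₀ S),
    IsSmoothEmbedding (𝓡 k) IM ∞ (Subtype.val : S₀ → M) ∧
    IsSmoothEmbedding (𝓡 n) IG ∞ (Subtype.val : S → G) ∧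
    (∀ g, (L.src g : M) = D.src g) ∧ (∀ g, (L.tgt g : M) = D.tgt g) ∧
    (∀ x, (L.unit x : G) = D.unit x) ∧ (∀ g, (L.inv g : G) = D.inv g) ∧
    ∀ (c : C) (d : L.Composable), D.fst c = d.fst → D.snd c = d.snd → (L.mul d : G) = D.mul c

end manifolds

end MultConn

end

/-! Each tangent space is identified with the model space through the preferred chart at its base
point. In these charts a connection is a family of bilinear maps Γ(e, w), with ∇_w X = dX(w) + Γ(X,
w): the field comes first, the direction second. For a smooth map F the pointwise content of
F-relatedness is the law dF Γ(e, w) = hess F (w, e) + Γ'(dF e, dF w), called `RelChr`. Two facts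
carry everything. The second tangent map sends (e, w, η) to (dF e, dF w, hess F (w, e) + dF η)
(`D_tangentMap`), and the Hessian is symmetric (`hess_symm`).

Each of the five conditions is shown equivalent to `IsMulChr`: the law holds for s, t, m and the two
projections of G⁽²⁾, with some functions on M and G⁽²⁾ in the role of Christoffel symbols. Neither
bilinearity nor smoothness of these functions is asked. Both follow, since bilinearity passes along
surjective and jointly injective differentials and horizontal lifts depend smoothly on their data
(`IsMulChr.exists_conns`).

Condition 1: relatedness of connections speaks only of pairs of related global fields, so the law
follows when every tangent vector extends to such a pair. Along submersions the extension comes from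
a partition of unity (`exists_lift`); along G⁽²⁾ ⊆ G × G it comes from lifting one field of M
through both s and t (`hasRelatedFields_incl`). Condition 2: in the symmetric part of the law the
Hessian remains, in the antisymmetric part it cancels; conversely Γ is the symmetric part plus half
the torsion. Condition 3: H is the set η = -Γ(e, w), so the law says that the second tangent map
preserves horizontal vectors. Condition 4: the vertical projection is (w, η) ↦ (0, η + Γ(e, w)), and
the law can be read off from its vertical component. Condition 5: the spray is (e, -Γ(e, e)).
Polarization recovers the symmetric part, and the torsion supplies the rest.

The longest step makes H a Lie groupoid. The law for the units and the inversion is not part of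
`IsMulChr`; it follows because the failure of the law transforms like a tensor
(`RelChr.obstruction_comp`, `relChr_unit`, `relChr_inv`). A horizontal vector is determined by its
two projections to TG (`Conn.eq_lift`), so H is TG ⊕ TG as a manifold. This gives its charts, and it
reduces associativity in H to associativity in TG (`D_mul_assoc`). -/

noncomputable section

namespace MultConn

open Bundle Filter
open scoped Topology

set_option linter.unusedSectionVars false

section coordinates

variable {E H E' H' E'' H'' EP HP : Type*}
  [NormedAddCommGroup E] [NormedSpace ℝ E] [TopologicalSpace H]
  [NormedAddCommGroup E'] [NormedSpace ℝ E'] [TopologicalSpace H']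
  [NormedAddCommGroup E''] [NormedSpace ℝ E''] [TopologicalSpace H'']
  [NormedAddCommGroup EP] [NormedSpace ℝ EP] [TopologicalSpace HP]
  (I : ModelWithCorners ℝ E H) (J : ModelWithCorners ℝ E' H') (K : ModelWithCorners ℝ E'' H'')
  (IP : ModelWithCorners ℝ EP HP)
  {M N Q P : Type*} [TopologicalSpace M] [ChartedSpace H M] [TopologicalSpace N] [ChartedSpace H' N]
  [TopologicalSpace Q] [ChartedSpace H'' Q] [TopologicalSpace P] [ChartedSpace HP P]

/-! ### Tangent vectors in the preferred charts -/

/-- The derivative of `F` at `x`, as a map between the model spaces. -/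
def D (F : M → N) (x : M) : E →L[ℝ] E' := mfderiv I J F x

/-- The second derivative of `F` at `x`, in the preferred charts at `x` and `F x`. -/
def hess (F : M → N) (x : M) : E →L[ℝ] E →L[ℝ] E' :=
  fderiv ℝ (fderiv ℝ (writtenInExtChartAt I J x F)) (extChartAt I x x)

/-- The tangent vector of `M` at `x` with the components `v` in the preferred chart at `x`. -/
def vec (x : M) (v : E) : TangentBundle I M := ⟨x, v⟩

variable {I} in
/-- The components of a tangent vector in the preferred chart at its base point. -/
def fib (p : TangentBundle I M) : E := p.2

/-- The components of a tangent vector in the preferred chart at `x`. -/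
def crd [IsManifold I ∞ M] (x : M) (p : TangentBundle I M) : E :=
  (trivializationAt E (TangentSpace I : M → Type _) x p).2

/-- The vector `(w, η)` tangent to `TM` at `(x, e)`, in the preferred chart at `x`. -/
def tt [IsManifold I ∞ M] (x : M) (e w η : E) :
    TangentBundle I.tangent (TangentBundle I M) := vec I.tangent (vec I x e) (w, η)

variable {I J K IP}

theorem tangentMap_vec (F : M → N) (x : M) (v : E) :
    tangentMap I J F (vec I x v) = vec J (F x) (D I J F x v) := rfl

theorem tangentMap_eq (F : M → N) (p : TangentBundle I M) :
    tangentMap I J F p = vec J (F p.proj) (D I J F p.proj (fib p)) := rfl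

@[simp] theorem vec_proj_fib (p : TangentBundle I M) : vec I p.proj (fib p) = p := rfl

@[simp] theorem fib_vec (x : M) (v : E) : fib (vec I x v) = v := rfl

theorem vec_inj {x : M} {v w : E} : vec I x v = vec I x w ↔ v = w :=
  ⟨fun h => by simpa using congrArg fib h, fun h => h ▸ rfl⟩

theorem tt_inj [IsManifold I ∞ M] {x : M} {e w η e' w' η' : E} :
    tt I x e w η = tt I x e' w' η' ↔ e = e' ∧ w = w' ∧ η = η' := by
  constructor
  · intro h
    have h1 : vec I x e = vec I x e' := congrArg (fun p => p.proj) h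
    have h2 : ((w, η) : E × E) = (w', η') := congrArg fib h
    exact ⟨vec_inj.1 h1, congrArg Prod.fst h2, congrArg Prod.snd h2⟩
  · rintro ⟨rfl, rfl, rfl⟩; rfl

theorem tt_surj [IsManifold I ∞ M] (ξ : TangentBundle I.tangent (TangentBundle I M)) :
    ξ = tt I ξ.proj.proj (fib ξ.proj) (fib ξ).1 (fib ξ).2 := rfl

theorem D_congr {F F' : M → N} {x : M} (h : F =ᶠ[𝓝 x] F') : D I J F x = D I J F' x :=
  h.mfderiv_eq

theorem D_id (x : M) : D I I (id : M → M) x = ContinuousLinearMap.id ℝ E := mfderiv_id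

theorem D_const (x : M) (y : N) : D I J (fun _ : M => y) x = 0 := mfderiv_const

theorem D_comp {F : M → N} {F' : N → Q} {x : M} (hF' : ContMDiffAt J K ∞ F' (F x))
    (hF : ContMDiffAt I J ∞ F x) : D I K (F' ∘ F) x = (D J K F' (F x)).comp (D I J F x) :=
  mfderiv_comp x (hF'.mdifferentiableAt (by simp)) (hF.mdifferentiableAt (by simp))

theorem D_comp_apply' {F : M → N} {F' : N → Q} {x : M} (hF' : MDifferentiableAt J K F' (F x))
    (hF : MDifferentiableAt I J F x) (v : E) :
    D I K (F' ∘ F) x v = D J K F' (F x) (D I J F x v) :=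
  congrArg (fun L : E →L[ℝ] E'' => L v) (mfderiv_comp x hF' hF)

theorem D_comp_apply {F : M → N} {F' : N → Q} {x : M} (hF' : ContMDiffAt J K ∞ F' (F x))
    (hF : ContMDiffAt I J ∞ F x) (v : E) :
    D I K (F' ∘ F) x v = D J K F' (F x) (D I J F x v) := by
  rw [D_comp hF' hF]; rfl

theorem D_clm (L : E →L[ℝ] E') (x : E) : D 𝓘(ℝ, E) 𝓘(ℝ, E') L x = L :=
  L.hasMFDerivAt.mfderiv

theorem D_prodMk {f : P → M} {g : P → N} {p : P} (hf : ContMDiffAt IP I ∞ f p)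
    (hg : ContMDiffAt IP J ∞ g p) (v : EP) :
    D IP (I.prod J) (fun q => (f q, g q)) p v = (D IP I f p v, D IP J g p v) := by
  have := (hf.mdifferentiableAt (by simp)).mfderiv_prod (hg.mdifferentiableAt (by simp))
  rw [D, this]
  rfl

theorem D_prodMk_space {f : P → E} {g : P → E'} {p : P} (hf : ContMDiffAt IP 𝓘(ℝ, E) ∞ f p)
    (hg : ContMDiffAt IP 𝓘(ℝ, E') ∞ g p) (v : EP) :
    D IP 𝓘(ℝ, E × E') (fun q => (f q, g q)) p v =
      (D IP 𝓘(ℝ, E) f p v, D IP 𝓘(ℝ, E') g p v) := by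
  have h := hf.prodMk_space hg
  have h1 := D_comp_apply (K := 𝓘(ℝ, E)) (F' := ContinuousLinearMap.fst ℝ E E')
    (ContinuousLinearMap.fst ℝ E E').contDiff.contMDiff.contMDiffAt h v
  have h2 := D_comp_apply (K := 𝓘(ℝ, E')) (F' := ContinuousLinearMap.snd ℝ E E')
    (ContinuousLinearMap.snd ℝ E E').contDiff.contMDiff.contMDiffAt h v
  rw [D_clm] at h1 h2
  exact Prod.ext h1.symm h2.symm

theorem D_eq_fderiv (f : E → E') (x : E) : D 𝓘(ℝ, E) 𝓘(ℝ, E') f x = fderiv ℝ f x := mfderiv_eq_fderiv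

section
variable [IsManifold I ∞ M] [IsManifold J ∞ N] [IsManifold K ∞ Q]

theorem crd_self (x : M) (v : E) : crd I x (vec I x v) = v := by
  simpa [crd, vec] using!
    (tangentBundleCore I M).coordChange_self (achart H x) x (mem_chart_source H x) v

theorem crd_eq {x y : M} (h : y ∈ (chartAt H x).source) (v : E) :
    crd I x (vec I y v) = D I 𝓘(ℝ, E) (extChartAt I x) y v := by
  have := TangentBundle.continuousLinearMapAt_trivializationAt (I := I) h
  rw [D, ← this]
  have h' : y ∈ (trivializationAt E (TangentSpace I : M → Type _) x).baseSet := h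
  exact (congrFun (Trivialization.coe_linearMapAt_of_mem (R := ℝ)
    (trivializationAt E (TangentSpace I : M → Type _) x) h') v).symm

theorem D_extChartAt_self (x : M) : D I 𝓘(ℝ, E) (extChartAt I x) x = ContinuousLinearMap.id ℝ E :=
  mfderiv_extChartAt_self

theorem D_extChartAt_symm_self [I.Boundaryless] (x : M) :
    D 𝓘(ℝ, E) I (extChartAt I x).symm (extChartAt I x x) = ContinuousLinearMap.id ℝ E := by
  have := mfderivWithin_range_extChartAt_symm (I := I) (x := x)
  rw [I.range_eq_univ, mfderivWithin_univ] at this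
  exact this

theorem extChartAt_tangent (p q : TangentBundle I M) :
    extChartAt I.tangent p q = (extChartAt I p.proj q.proj, crd I p.proj q) := by
  rw [FiberBundle.extChartAt]
  rfl

theorem contMDiffAt_toTangentBundle {f : P → TangentBundle I M} {p : P} :
    ContMDiffAt IP I.tangent ∞ f p ↔ ContMDiffAt IP I ∞ (fun q => (f q).proj) p ∧
      ContMDiffAt IP 𝓘(ℝ, E) ∞ (fun q => crd I (f p).proj (f q)) p :=
  Bundle.contMDiffAt_totalSpace

/-- The derivative of a map into a tangent bundle. -/
theorem D_toTangentBundle {f : P → TangentBundle I M} {p : P}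
    (hf : ContMDiffAt IP I.tangent ∞ f p) (v : EP) :
    D IP I.tangent f p v = (D IP I (fun q => (f q).proj) p v,
      D IP 𝓘(ℝ, E) (fun q => crd I (f p).proj (f q)) p v) := by
  -- A preferred chart has identity derivative at its own centre, so `f` may be replaced by its
  -- expression in that chart, whose two components are differentiated separately.
  have h0 : D IP I.tangent f p = D IP 𝓘(ℝ, E × E) (extChartAt I.tangent (f p) ∘ f) p := by
    rw [D_comp (J := I.tangent) (contMDiffAt_extChartAt) hf, D_extChartAt_self]
    rfl
  have hb := contMDiffAt_toTangentBundle.1 hf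
  have h1 : ContMDiffAt IP 𝓘(ℝ, E) ∞ (extChartAt I (f p).proj ∘ fun q => (f q).proj) p :=
    (contMDiffAt_extChartAt).comp p hb.1
  have h2 : D IP I (fun q => (f q).proj) p =
      D IP 𝓘(ℝ, E) (extChartAt I (f p).proj ∘ fun q => (f q).proj) p := by
    rw [D_comp (J := I) (contMDiffAt_extChartAt) hb.1, D_extChartAt_self]
    rfl
  have h3 : (extChartAt I.tangent (f p) ∘ f) = fun q =>
      ((extChartAt I (f p).proj ∘ fun q => (f q).proj) q, crd I (f p).proj (f q)) := by
    funext q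
    exact extChartAt_tangent _ _
  rw [h0, h2, h3, D_prodMk_space h1 hb.2]

theorem contMDiffAt_tangentMap {F : M → N} {p : TangentBundle I M}
    (hF : ContMDiffAt I J ∞ F p.proj) :
    ContMDiffAt I.tangent J.tangent ∞ (tangentMap I J F) p := by
  have hb₂ : ContMDiffAt I.tangent J ∞ (fun q : TangentBundle I M => F q.proj) p :=
    hF.comp p (Bundle.contMDiffAt_proj _)
  have hv : ContMDiffAt I.tangent I.tangent ∞
      (fun q : TangentBundle I M => (⟨q.proj, q.2⟩ : TangentBundle I M)) p := contMDiffAt_id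
  have A := ContMDiffAt.mfderiv_const (m := ∞) hF (by simp)
  exact ContMDiffAt.clm_apply_of_inCoordinates (b₁ := fun q : TangentBundle I M => q.proj)
    (b₂ := fun q => F q.proj) (ϕ := fun q => mfderiv I J F q.proj)
    (A.comp p (Bundle.contMDiffAt_proj _)) hv hb₂

theorem contMDiff_tangentMap {F : M → N} (hF : ContMDiff I J ∞ F) :
   ContMDiff I.tangent J.tangent ∞ (tangentMap I J F) := fun _ => contMDiffAt_tangentMap (hF _)

theorem contMDiffAt_proj {p : TangentBundle I M} :
    ContMDiffAt I.tangent I ∞ (fun q : TangentBundle I M => q.proj) p :=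
  Bundle.contMDiffAt_proj _

theorem D_proj (p : TangentBundle I M) (ξ : E × E) :
    D I.tangent I (fun q : TangentBundle I M => q.proj) p ξ = ξ.1 := by
  have h := D_toTangentBundle (I := I) (f := (id : TangentBundle I M → TangentBundle I M))
     (p := p) (contMDiffAt_id) ξ
  rw [D_id] at h
  exact (congrArg Prod.fst h).symm

theorem dproj_eq (p : TangentBundle I M) (ξ : E × E) : dproj p ξ = ξ.1 := D_proj p ξ

theorem eventually_mdifferentiableAt {F : M → N} {x : M} (hF : ContMDiffAt I J ∞ F x) :
    ∀ᶠ y in 𝓝 x, MDifferentiableAt I J F y :=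
  ((contMDiffAt_iff_contMDiffAt_nhds (n := 1) (by simp)).1 (hF.of_le (by simp))).mono
    fun _ h => h.mdifferentiableAt (by simp)

/-- The chain rule at a point `y` near `x`, with both charts kept fixed at `x` and `F x`. Having it
on a neighbourhood, and not only at `x`, is what allows the tangent map to be differentiated once
more. -/
theorem crd_tangentMap [I.Boundaryless] {F : M → N} {x y : M} (hF : MDifferentiableAt I J F y)
    (hy : y ∈ (chartAt H x).source) (hFy : F y ∈ (chartAt H' (F x)).source) (v : E) :
    crd J (F x) (vec J (F y) (D I J F y v)) =
      fderiv ℝ (writtenInExtChartAt I J x F) (extChartAt I x y) (crd I x (vec I y v)) := by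
  have hφ : MDifferentiableAt I 𝓘(ℝ, E) (extChartAt I x) y := mdifferentiableAt_extChartAt hy
  have hφ' : MDifferentiableAt J 𝓘(ℝ, E') (extChartAt J (F x)) (F y) :=
    mdifferentiableAt_extChartAt hFy
  have hys : y ∈ (extChartAt I x).source := by rwa [extChartAt_source]
  have hl : (extChartAt I x).symm (extChartAt I x y) = y := (extChartAt I x).left_inv hys
  have hψ : MDifferentiableAt 𝓘(ℝ, E) I (extChartAt I x).symm (extChartAt I x y) := by
    have := mdifferentiableWithinAt_extChartAt_symm (I := I) ((extChartAt I x).map_source hys)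
    rwa [I.range_eq_univ, mdifferentiableWithinAt_univ] at this
  rw [crd_eq hFy, crd_eq hy, ← D_comp_apply' hφ' hF, ← D_eq_fderiv, writtenInExtChartAt]
  have h1 : MDifferentiableAt I 𝓘(ℝ, E') (extChartAt J (F x) ∘ F)
      ((extChartAt I x).symm (extChartAt I x y)) := by rw [hl]; exact hφ'.comp y hF
  rw [← Function.comp_assoc, ← D_comp_apply' (h1.comp _ hψ) hφ]
  refine congrArg (fun L : E →L[ℝ] E' => L v) (D_congr ?_)
  filter_upwards [extChartAt_source_mem_nhds' (I := I) hys] with q hq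
  simp only [Function.comp]
  rw [(extChartAt I x).left_inv hq]

omit [IsManifold I ∞ M] [IsManifold J ∞ N] in
theorem contDiffAt_writtenInExtChartAt [I.Boundaryless] {F : M → N} {x : M} {n : ℕ∞ω}
    (hF : ContMDiffAt I J n F x) :
    ContDiffAt ℝ n (writtenInExtChartAt I J x F) (extChartAt I x x) := by
  have := (contMDiffAt_iff.1 hF).2
  rwa [I.range_eq_univ, contDiffWithinAt_univ] at this

theorem fderiv_writtenInExtChartAt [I.Boundaryless] {F : M → N} {x : M}
    (hF : MDifferentiableAt I J F x) :
    fderiv ℝ (writtenInExtChartAt I J x F) (extChartAt I x x) = D I J F x := by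
  ext v
  have h := crd_tangentMap hF (mem_chart_source H x) (mem_chart_source H' (F x)) v
  rw [crd_self, crd_self] at h
  exact h.symm

theorem hess_symm [I.Boundaryless] {F : M → N} {x : M} (hF : ContMDiffAt I J ∞ F x) (v w : E) :
    hess I J F x v w = hess I J F x w v := by
  have h := (contDiffAt_writtenInExtChartAt hF).isSymmSndFDerivAt
    (by rw [minSmoothness_of_isRCLikeNormedField]; exact WithTop.coe_le_coe.2 (le_top : (2 : ℕ∞) ≤ ⊤))
  exact h.eq v w

/-- The second tangent map, in the preferred charts. -/
theorem D_tangentMap [I.Boundaryless] {F : M → N} {x : M} (hx : ContMDiffAt I J ∞ F x)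
    (e w η : E) : D I.tangent J.tangent (tangentMap I J F) (vec I x e) (w, η) =
      (D I J F x w, hess I J F x w e + D I J F x η) := by
  set z₀ := extChartAt I x x with hz₀
  have hT := contMDiffAt_tangentMap (p := vec I x e) hx
  -- Precomposing with the inverse chart, whose derivative at the centre is the identity, moves the
  -- computation to `E × E`.
  set σ := (extChartAt I.tangent (vec I x e)).symm with hσ
  have hp : extChartAt I.tangent (vec I x e) (vec I x e) = (z₀, e) := by
    rw [extChartAt_tangent]; exact Prod.ext rfl (crd_self x e)
  have hσs : ContMDiffAt 𝓘(ℝ, E × E) I.tangent ∞ σ (z₀, e) := by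
    rw [← hp]
    exact (contMDiffOn_extChartAt_symm _).contMDiffAt (extChartAt_target_mem_nhds _)
  have hσp : σ (z₀, e) = vec I x e := by rw [← hp]; exact extChartAt_to_inv _
  have hDσ : D 𝓘(ℝ, E × E) I.tangent σ (z₀, e) = ContinuousLinearMap.id ℝ (E × E) := by
    rw [← hp]; exact D_extChartAt_symm_self _
  have h1 : D I.tangent J.tangent (tangentMap I J F) (vec I x e) (w, η) =
      D 𝓘(ℝ, E × E) J.tangent (tangentMap I J F ∘ σ) (z₀, e) (w, η) := by
    rw [D_comp_apply (J := I.tangent) (by rw [hσp]; exact hT) hσs, hDσ, hσp]; rfl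
  have hTσ : ContMDiffAt 𝓘(ℝ, E × E) J.tangent ∞ (tangentMap I J F ∘ σ) (z₀, e) :=
    ContMDiffAt.comp (I' := I.tangent) _ (by rw [hσp]; exact hT) hσs
  have hσ1 : ∀ᶠ q in 𝓝 ((z₀, e) : E × E), (σ q).proj = (extChartAt I x).symm q.1 ∧
      extChartAt I x (σ q).proj = q.1 ∧ crd I x (σ q) = q.2 ∧ (σ q).proj ∈ (chartAt H x).source := by
    have : (extChartAt I.tangent (vec I x e)).target ∈ 𝓝 ((z₀, e) : E × E) := by
      rw [← hp]; exact extChartAt_target_mem_nhds _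
    filter_upwards [this] with q hq
    have h := (extChartAt I.tangent (vec I x e)).right_inv hq
    rw [extChartAt_tangent] at h
    have hs := (extChartAt I.tangent (vec I x e)).map_target hq
    rw [extChartAt_source] at hs
    have hs' : (σ q).proj ∈ (chartAt H x).source := (TangentBundle.mem_chart_source_iff _ _).1 hs
    refine ⟨?_, congrArg Prod.fst h, congrArg Prod.snd h, hs'⟩
    rw [← congrArg Prod.fst h]
    exact ((extChartAt I x).left_inv (by rw [extChartAt_source]; exact hs')).symm
  have hφ : ContMDiffAt 𝓘(ℝ, E) I ∞ (extChartAt I x).symm z₀ :=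
    (contMDiffOn_extChartAt_symm _).contMDiffAt (extChartAt_target_mem_nhds _)
  have hφx : (extChartAt I x).symm z₀ = x := extChartAt_to_inv x
  have hσb : ContMDiffAt 𝓘(ℝ, E × E) I ∞ (fun q => (σ q).proj) (z₀, e) :=
    (contMDiffAt_toTangentBundle.1 hσs).1
  rw [h1, D_toTangentBundle hTσ]
  have hfst : ContMDiffAt 𝓘(ℝ, E × E) 𝓘(ℝ, E) ∞ (ContinuousLinearMap.fst ℝ E E) (z₀, e) :=
    (ContinuousLinearMap.fst ℝ E E).contDiff.contMDiff.contMDiffAt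
  have e1 : (fun q => ((tangentMap I J F ∘ σ) q).proj) =ᶠ[𝓝 ((z₀, e) : E × E)]
      (F ∘ (extChartAt I x).symm) ∘ ContinuousLinearMap.fst ℝ E E := by
    filter_upwards [hσ1] with q hq
    exact congrArg F hq.1
  have hFφ : ContMDiffAt 𝓘(ℝ, E) J ∞ (F ∘ (extChartAt I x).symm) z₀ :=
    ContMDiffAt.comp (I' := I) z₀ (by rw [hφx]; exact hx) hφ
  -- In coordinates the fibre component is (z, v) ↦ f'(z) v. The product rule then splits its
  -- derivative into the Hessian term and the term `D I J F x η`.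
  have e2 : (fun q => crd J ((tangentMap I J F ∘ σ) (z₀, e)).proj ((tangentMap I J F ∘ σ) q))
      =ᶠ[𝓝 ((z₀, e) : E × E)]
      fun q => fderiv ℝ (writtenInExtChartAt I J x F) q.1 q.2 := by
    have hσpx : (σ (z₀, e)).proj = x := by rw [hσp]; rfl
    have ht : Tendsto (fun q => (σ q).proj) (𝓝 ((z₀, e) : E × E)) (𝓝 x) := by
      have := hσb.continuousAt.tendsto
      rwa [hσpx] at this
    filter_upwards [hσ1, ht.eventually (eventually_mdifferentiableAt hx),
      ht.eventually (hx.continuousAt.eventually (chart_source_mem_nhds H' (F x)))] with q hq h2 h3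
    have : ((tangentMap I J F ∘ σ) (z₀, e)).proj = F x := congrArg F hσpx
    rw [this, Function.comp_apply, tangentMap_eq, crd_tangentMap h2 hq.2.2.2 h3, vec_proj_fib,
      hq.2.1, hq.2.2.1]
  rw [D_congr e1, D_congr e2, D_comp_apply (J := 𝓘(ℝ, E)) (by exact hFφ) hfst, D_clm]
  have hF1 := fderiv_writtenInExtChartAt (hx.mdifferentiableAt (by simp))
  refine Prod.ext ?_ ?_
  · change D 𝓘(ℝ, E) J (F ∘ (extChartAt I x).symm) z₀ w = D I J F x w
    rw [D_comp_apply (J := I) (by rw [hφx]; exact hx) hφ, D_extChartAt_symm_self]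
    rw [hφx]; rfl
  · change D 𝓘(ℝ, E × E) 𝓘(ℝ, E') _ (z₀, e) (w, η) = hess I J F x w e + D I J F x η
    rw [D_eq_fderiv]
    have hc := contDiffAt_writtenInExtChartAt hx
    have hd : DifferentiableAt ℝ (fderiv ℝ (writtenInExtChartAt I J x F)) z₀ :=
      (hc.fderiv_right (m := ∞) (by simp)).differentiableAt (by simp)
    have hd1 : HasFDerivAt (fun q : E × E => fderiv ℝ (writtenInExtChartAt I J x F) q.1)
        ((hess I J F x).comp (ContinuousLinearMap.fst ℝ E E)) (z₀, e) :=
      HasFDerivAt.comp (z₀, e) (f := Prod.fst) hd.hasFDerivAt hasFDerivAt_fst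
    rw [(hd1.clm_apply hasFDerivAt_snd).fderiv]
    change fderiv ℝ _ z₀ η + hess I J F x w e = _
    rw [hz₀, hF1, add_comm]

theorem tangentMap_tt [I.Boundaryless] {F : M → N} {x : M} (hx : ContMDiffAt I J ∞ F x)
    (e w η : E) : tangentMap I.tangent J.tangent (tangentMap I J F) (tt I x e w η) =
      tt J (F x) (D I J F x e) (D I J F x w) (hess I J F x w e + D I J F x η) := by
  rw [tt, tangentMap_vec, D_tangentMap hx]
  rfl

/-- The tangent map is functorial, so differentiating T(F' ∘ F) = TF' ∘ TF and comparing the second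
components given by `D_tangentMap`, with vertical input 0, yields the second-order chain rule
without a coordinate computation. -/
theorem hess_comp [I.Boundaryless] [J.Boundaryless] {F : M → N} {F' : N → Q} {x : M}
    (hF' : ContMDiffAt J K ∞ F' (F x)) (hF : ContMDiffAt I J ∞ F x) (w e : E) :
    hess I K (F' ∘ F) x w e = hess J K F' (F x) (D I J F x w) (D I J F x e) +
      D J K F' (F x) (hess I J F x w e) := by
  have h1 := D_tangentMap (hF'.comp x hF) e w 0
  have h2 : tangentMap I K (F' ∘ F) =ᶠ[𝓝 (vec I x e)] tangentMap J K F' ∘ tangentMap I J F := by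
    have hc : ContinuousAt (fun p : TangentBundle I M => p.proj) (vec I x e) :=
      contMDiffAt_proj.continuousAt
    filter_upwards [hc.eventually (eventually_mdifferentiableAt hF),
      hc.eventually (hF.continuousAt.eventually (eventually_mdifferentiableAt hF'))] with p hp hp'
    exact tangentMap_comp_at p hp' hp
  rw [D_congr h2, D_comp_apply (J := J.tangent) (contMDiffAt_tangentMap (by exact hF'))
    (contMDiffAt_tangentMap hF), D_tangentMap hF, tangentMap_vec, D_tangentMap hF'] at h1
  simpa using (congrArg Prod.snd h1).symm


end
end coordinates

section connections

variable {E H E' H' EP HP : Type*}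
  [NormedAddCommGroup E] [NormedSpace ℝ E] [TopologicalSpace H]
  [NormedAddCommGroup E'] [NormedSpace ℝ E'] [TopologicalSpace H']
  [NormedAddCommGroup EP] [NormedSpace ℝ EP] [TopologicalSpace HP]
  {I : ModelWithCorners ℝ E H} {J : ModelWithCorners ℝ E' H'} {IP : ModelWithCorners ℝ EP HP}
  {M N P : Type*} [TopologicalSpace M] [ChartedSpace H M] [TopologicalSpace N] [ChartedSpace H' N]
  [TopologicalSpace P] [ChartedSpace HP P] [IsManifold I ∞ M] [IsManifold J ∞ N]

/-! ### Vector fields in the preferred charts -/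

theorem crd_add (x : M) {y : M} (hy : y ∈ (chartAt H x).source) (v w : E) :
    crd I x (vec I y (v + w)) = crd I x (vec I y v) + crd I x (vec I y w) := by
  simp only [crd_eq hy, map_add]

theorem crd_smul (x : M) {y : M} (hy : y ∈ (chartAt H x).source) (c : ℝ) (v : E) :
    crd I x (vec I y (c • v)) = c • crd I x (vec I y v) := by
  simp only [crd_eq hy, map_smul]

/-- The value of a vector field at `x` in the preferred chart at `x`. -/
def VField.val (X : VField I M) (x : M) : E := X x

/-- The derivative of a vector field at `x` in the preferred chart at `x`. -/
def VField.deriv (X : VField I M) (x : M) : E →L[ℝ] E :=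
  D I 𝓘(ℝ, E) (fun y => crd I x (vec I y (X.val y))) x

theorem VField.toMap_apply (X : VField I M) (x : M) : X.toMap x = vec I x (X.val x) := rfl

theorem VField.ext_val {X Y : VField I M} (h : ∀ x, X.val x = Y.val x) : X = Y := funext h

theorem VField.mdifferentiableAt_crd {X : VField I M} {x : M}
    (hX : MDifferentiableAt I I.tangent X.toMap x) :
    MDifferentiableAt I 𝓘(ℝ, E) (fun y => crd I x (vec I y (X.val y))) x :=
  (mdifferentiableAt_section I X).1 hX

theorem VField.D_toMap {X : VField I M} {x : M} (hX : ContMDiffAt I I.tangent ∞ X.toMap x)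
    (w : E) : D I I.tangent X.toMap x w = (w, X.deriv x w) := by
  rw [D_toTangentBundle hX]
  refine Prod.ext ?_ rfl
  exact congrArg (fun L : E →L[ℝ] E => L w) (D_id (I := I) x)

theorem VField.tangentMap_toMap {X : VField I M} {x : M} (hX : ContMDiffAt I I.tangent ∞ X.toMap x)
    (w : E) : tangentMap I I.tangent X.toMap (vec I x w) = tt I x (X.val x) w (X.deriv x w) := by
  rw [tangentMap_vec, VField.D_toMap hX]
  rfl

/-- A vector field with a given expression in the chart at `x`. -/
theorem exists_vField [T2Space M] [FiniteDimensional ℝ E] (x : M) {f : E → E}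
    (hf : ContDiff ℝ ∞ f) :
    ∃ X : VField I M, X.IsSmooth ∧
      ∀ᶠ y in 𝓝 x, crd I x (X.toMap y) = f (extChartAt I x y) := by
  let t := trivializationAt E (TangentSpace I : M → Type _) x
  -- The local field has the prescribed expression on the whole chart domain. The bump function
  -- makes it global and is 1 near `x`.
  let χ : SmoothBumpFunction I x := Classical.arbitrary _
  let s : VField I M := fun y => t.symm y (f (extChartAt I x y))
  have hs : ∀ y ∈ (chartAt H x).source, crd I x (s.toMap y) = f (extChartAt I x y) := fun y hy =>
    congrArg Prod.snd (t.apply_mk_symm (show y ∈ t.baseSet from hy) _)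
  have hsm : ContMDiffOn I I.tangent ∞ s.toMap (chartAt H x).source := by
    intro y hy
    refine (t.contMDiffWithinAt_section _ (show y ∈ t.baseSet from hy)).2 ?_
    refine ContMDiffWithinAt.congr ?_ hs (hs y hy)
    exact hf.contMDiff.contMDiffAt.comp_contMDiffWithinAt y
      (contMDiffOn_extChartAt (I := I) (x := x) y hy)
  refine ⟨fun y => χ y • s y, ?_, ?_⟩
  · exact ContMDiffOn.smul_section_of_tsupport (χ.contMDiff.contMDiffOn) (chartAt H x).open_source
      χ.tsupport_subset_chartAt_source hsm
  · filter_upwards [χ.eventuallyEq_one, chart_source_mem_nhds H x] with y hy hys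
    rw [← hs y hys]
    change crd I x (vec I y (χ y • s.val y)) = crd I x (vec I y (s.val y))
    rw [hy]
    simp

/-- An affine expression in the chart realizes any 1-jet. Identities that are known for all vector
fields can thus be tested on an arbitrary value, and parallel fields at a point can be constructed.
-/
theorem exists_vField_jet [T2Space M] [FiniteDimensional ℝ E] [I.Boundaryless]
    (x : M) (e : E) (L : E →L[ℝ] E) :
    ∃ X : VField I M, X.IsSmooth ∧ X.val x = e ∧ X.deriv x = L := by
  obtain ⟨X, hX, h⟩ := exists_vField (I := I) x (f := fun z => e + L (z - extChartAt I x x))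
    (by fun_prop)
  refine ⟨X, hX, ?_, ?_⟩
  · have := h.self_of_nhds
    rw [VField.toMap_apply, crd_self] at this
    simpa using this
  · rw [VField.deriv]
    have h1 : (fun y => crd I x (vec I y (X.val y))) =ᶠ[𝓝 x]
        (fun z => e + L (z - extChartAt I x x)) ∘ extChartAt I x := h
    rw [D_congr h1]
    ext v
    have h2 : ContDiff ℝ ∞ (fun z : E => e + L (z - extChartAt I x x)) := by fun_prop
    rw [D_comp_apply (J := 𝓘(ℝ, E)) h2.contMDiff.contMDiffAt contMDiffAt_extChartAt,
      D_extChartAt_self, D_eq_fderiv]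
    have h3 : HasFDerivAt (fun z : E => e + L (z - extChartAt I x x)) L (extChartAt I x x) := by
      simpa using (L.hasFDerivAt.comp (extChartAt I x x)
        ((hasFDerivAt_id (extChartAt I x x)).sub_const (extChartAt I x x))).const_add e
    rw [h3.fderiv]
    rfl

/-! ### The Christoffel symbols of a connection -/

omit [IsManifold I ∞ M] in
theorem D_smul {g : M → ℝ} {f : M → E'} {x : M} (hg : MDifferentiableAt I 𝓘(ℝ, ℝ) g x)
    (hf : MDifferentiableAt I 𝓘(ℝ, E') f x) :
    D I 𝓘(ℝ, E') (fun y => g y • f y) x =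
      g x • D I 𝓘(ℝ, E') f x + (D I 𝓘(ℝ, ℝ) g x).smulRight (f x) := by
  have h1 := HasFDerivWithinAt.smul hg.hasMFDerivAt.2 hf.hasMFDerivAt.2
  have h2 : HasMFDerivAt I 𝓘(ℝ, E') (fun y => g y • f y) x _ :=
    ⟨hg.continuousAt.smul hf.continuousAt, h1⟩
  have h3 := h2.mfderiv
  have h4 : writtenInExtChartAt I 𝓘(ℝ, ℝ) x g (extChartAt I x x) = g x :=
    congrArg g (extChartAt_to_inv x)
  have h5 : writtenInExtChartAt I 𝓘(ℝ, E') x f (extChartAt I x x) = f x :=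
    congrArg f (extChartAt_to_inv x)
  rw [h4, h5] at h3
  exact h3

variable (I M) in
/-- The derivative in the preferred charts: a connection that is not continuous in general. -/
def chartConn : Conn I M where
  toFun X x := (VField.deriv X x : E →L[ℝ] E)
  isCovariantDerivativeOnUniv :=
    { add := by
        intro X Y x hX hY _
        have h1 : (fun y => crd I x (vec I y (VField.val (I := I) (X + Y) y))) =ᶠ[𝓝 x] fun y =>
            crd I x (vec I y (VField.val (I := I) X y)) +
              crd I x (vec I y (VField.val (I := I) Y y)) := by
          filter_upwards [chart_source_mem_nhds H x] with y hy
          exact crd_add x hy _ _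
        have h2 := ((VField.mdifferentiableAt_crd hX).hasMFDerivAt.add
          (VField.mdifferentiableAt_crd hY).hasMFDerivAt).mfderiv
        exact (D_congr h1).trans h2
      leibniz := by
        intro X g x hX hg _
        have h1 : (fun y => crd I x (vec I y (VField.val (I := I) (g • X) y))) =ᶠ[𝓝 x] fun y =>
            g y • crd I x (vec I y (VField.val (I := I) X y)) := by
          filter_upwards [chart_source_mem_nhds H x] with y hy
          exact crd_smul x hy _ _
        have h2 := D_smul hg (VField.mdifferentiableAt_crd hX)
        rw [crd_self] at h2
        exact (D_congr h1).trans h2 }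

variable [FiniteDimensional ℝ E] [FiniteDimensional ℝ E']

/-- The Christoffel symbols of a connection in the preferred charts, with
`∇_w X = dX(w) + Γ(X)(w)`. -/
def Conn.chr (cov : Conn I M) (x : M) : E →L[ℝ] E →L[ℝ] E := cov.difference (chartConn I M) x

/-- The value of a connection, in the preferred charts. -/
def Conn.app (cov : Conn I M) (X : VField I M) (x : M) (w : E) : E := cov X x w

theorem Conn.apply_eq (cov : Conn I M) {X : VField I M} {x : M}
    (hX : MDifferentiableAt I I.tangent X.toMap x) (w : E) :
    cov.app X x w = X.deriv x w + cov.chr x (X.val x) w := by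
  have h := IsCovariantDerivativeOn.difference_apply cov.isCovariantDerivativeOnUniv
    (chartConn I M).isCovariantDerivativeOnUniv (x := x) (Set.mem_univ x) hX
  have h2 := congrArg (fun L : E →L[ℝ] E => L w) h
  change cov.chr x (X.val x) w = cov.app X x w - X.deriv x w at h2
  rw [h2]
  abel

/-- The connection with given Christoffel symbols. -/
def Conn.ofChr (γ : M → E →L[ℝ] E →L[ℝ] E) : Conn I M := (chartConn I M).addOneForm γ

theorem Conn.chr_eq_of_apply {cov : Conn I M} [T2Space M] [I.Boundaryless] {x : M}
    {γ : E →L[ℝ] E →L[ℝ] E}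
    (h : ∀ X : VField I M, X.IsSmooth → ∀ w : E, cov.app X x w = X.deriv x w + γ (X.val x) w) :
    cov.chr x = γ := by
  ext e w
  obtain ⟨X, hX, rfl, h2⟩ := exists_vField_jet (I := I) x e 0
  have := h X hX w
  rw [cov.apply_eq ((hX x).mdifferentiableAt (by simp))] at this
  exact add_left_cancel this

theorem Conn.chr_ofChr [T2Space M] [I.Boundaryless] (γ : M → E →L[ℝ] E →L[ℝ] E) :
    (Conn.ofChr γ : Conn I M).chr = γ :=
  funext fun _ => Conn.chr_eq_of_apply fun _ _ _ => rfl

/-- The vector dσ(w) has components (w, dσ(w)) over σ(x), and ∇_w σ = 0 says that dσ(w) = -Γ(σ(x),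
w). Conversely a field with value `e` and derivative -Γ(e, ·) at `x` is parallel there in all
directions. -/
theorem Conn.tt_mem_horizontal [T2Space M] [I.Boundaryless] (cov : Conn I M) {x : M} {e w η : E} :
    tt I x e w η ∈ cov.horizontal ↔ η = -cov.chr x e w := by
  constructor
  · rintro ⟨X, y, v, hX, h0, h⟩
    have hb : x = y := congrArg (fun p => p.proj.proj) h
    subst hb
    have h' : tt I x e w η = tt I x (X.val x) v (X.deriv x v) :=
      h.trans (VField.tangentMap_toMap (hX x) v)
    obtain ⟨rfl, rfl, rfl⟩ := tt_inj.1 h'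
    have := (cov.apply_eq ((hX x).mdifferentiableAt (by simp)) _).symm.trans h0
    exact eq_neg_of_add_eq_zero_left this
  · rintro rfl
    obtain ⟨X, hX, rfl, h2⟩ := exists_vField_jet (I := I) x e (-cov.chr x e)
    refine ⟨X, x, w, hX, ?_, ?_⟩
    · refine (cov.apply_eq ((hX x).mdifferentiableAt (by simp)) w).trans ?_
      rw [h2]
      exact neg_add_cancel _
    · refine Eq.trans ?_ (VField.tangentMap_toMap (hX x) w).symm
      rw [h2]; rfl

end connections

section smoothness

variable {E H E' H' EP HP : Type*}
  [NormedAddCommGroup E] [NormedSpace ℝ E] [TopologicalSpace H]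
  [NormedAddCommGroup E'] [NormedSpace ℝ E'] [TopologicalSpace H']
  [NormedAddCommGroup EP] [NormedSpace ℝ EP] [TopologicalSpace HP]
  {I : ModelWithCorners ℝ E H} {J : ModelWithCorners ℝ E' H'} {IP : ModelWithCorners ℝ EP HP}
  {M N P : Type*} [TopologicalSpace M] [ChartedSpace H M] [TopologicalSpace N] [ChartedSpace H' N]
  [TopologicalSpace P] [ChartedSpace HP P] [IsManifold I ∞ M] [IsManifold J ∞ N]

/-! ### Smooth maps to tangent bundles -/

theorem crd_inj (x : M) {y : M} (hy : y ∈ (chartAt H x).source) {v w : E} :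
    crd I x (vec I y v) = crd I x (vec I y w) ↔ v = w := by
  refine ⟨fun h => ?_, fun h => h ▸ rfl⟩
  have h1 := (trivializationAt E (TangentSpace I : M → Type _) x).injOn
    (show vec I y v ∈ _ from ((trivializationAt E (TangentSpace I : M → Type _) x).mem_source).2 hy)
    (show vec I y w ∈ _ from ((trivializationAt E (TangentSpace I : M → Type _) x).mem_source).2 hy)
  refine vec_inj.1 (h1 (Prod.ext ?_ h))
  exact ((trivializationAt E (TangentSpace I : M → Type _) x).coe_fst'
    (show (vec I y v).proj ∈ _ from hy)).trans
    ((trivializationAt E (TangentSpace I : M → Type _) x).coe_fst'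
      (show (vec I y w).proj ∈ _ from hy)).symm

theorem contMDiffAt_vec_iff {b : P → M} {v : P → E} {p : P} :
    ContMDiffAt IP I.tangent ∞ (fun q => vec I (b q) (v q)) p ↔ ContMDiffAt IP I ∞ b p ∧
      ContMDiffAt IP 𝓘(ℝ, E) ∞ (fun q => crd I (b p) (vec I (b q) (v q))) p :=
  contMDiffAt_toTangentBundle

/-- The smoothness of a map to a tangent bundle, checked in a chart around the value. -/
theorem contMDiffAt_vec_iff' {b : P → M} {v : P → E} {p : P} (x : M)
    (hx : b p ∈ (chartAt H x).source) :
    ContMDiffAt IP I.tangent ∞ (fun q => vec I (b q) (v q)) p ↔ ContMDiffAt IP I ∞ b p ∧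
      ContMDiffAt IP 𝓘(ℝ, E) ∞ (fun q => crd I x (vec I (b q) (v q))) p :=
  (trivializationAt E (TangentSpace I : M → Type _) x).contMDiffAt_iff
    (((trivializationAt E (TangentSpace I : M → Type _) x).mem_source).2 hx)

theorem contMDiffAt_crd {x : M} {p : TangentBundle I M} (h : p.proj ∈ (chartAt H x).source) :
    ContMDiffAt I.tangent 𝓘(ℝ, E) ∞ (crd I x) p :=
  ((contMDiffAt_vec_iff' (b := fun q : TangentBundle I M => q.proj) (v := fib) x h).1
    contMDiffAt_id).2

theorem eventually_mem_source {b : P → M} {p : P} (h : ContMDiffAt IP I ∞ b p) :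
    ∀ᶠ q in 𝓝 p, b q ∈ (chartAt H (b p)).source :=
  h.continuousAt.eventually (chart_source_mem_nhds H (b p))

theorem ContMDiffAt.vec_add {b : P → M} {v w : P → E} {p : P}
    (hv : ContMDiffAt IP I.tangent ∞ (fun q => vec I (b q) (v q)) p)
    (hw : ContMDiffAt IP I.tangent ∞ (fun q => vec I (b q) (w q)) p) :
    ContMDiffAt IP I.tangent ∞ (fun q => vec I (b q) (v q + w q)) p := by
  rw [contMDiffAt_vec_iff] at *
  refine ⟨hv.1, (hv.2.add hw.2).congr_of_eventuallyEq ?_⟩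
  filter_upwards [eventually_mem_source hv.1] with q hq
  exact crd_add _ hq _ _

theorem ContMDiffAt.vec_smul {b : P → M} {c : P → ℝ} {v : P → E} {p : P}
    (hc : ContMDiffAt IP 𝓘(ℝ, ℝ) ∞ c p)
    (hv : ContMDiffAt IP I.tangent ∞ (fun q => vec I (b q) (v q)) p) :
    ContMDiffAt IP I.tangent ∞ (fun q => vec I (b q) (c q • v q)) p := by
  rw [contMDiffAt_vec_iff] at *
  refine ⟨hv.1, (hc.smul hv.2).congr_of_eventuallyEq ?_⟩
  filter_upwards [eventually_mem_source hv.1] with q hq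
  exact crd_smul _ hq _ _

theorem ContMDiffAt.vec_sub {b : P → M} {v w : P → E} {p : P}
    (hv : ContMDiffAt IP I.tangent ∞ (fun q => vec I (b q) (v q)) p)
    (hw : ContMDiffAt IP I.tangent ∞ (fun q => vec I (b q) (w q)) p) :
    ContMDiffAt IP I.tangent ∞ (fun q => vec I (b q) (v q - w q)) p := by
  have := ContMDiffAt.vec_add hv (ContMDiffAt.vec_smul (c := fun _ => -1) contMDiffAt_const hw)
  simpa [sub_eq_add_neg] using this

theorem contMDiffAt_vec_zero {b : P → M} {p : P} (hb : ContMDiffAt IP I ∞ b p) :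
    ContMDiffAt IP I.tangent ∞ (fun q => vec I (b q) 0) p := by
  refine contMDiffAt_vec_iff.2 ⟨hb, (contMDiffAt_const (c := (0 : E))).congr_of_eventuallyEq ?_⟩
  filter_upwards [eventually_mem_source hb] with q hq
  rw [crd_eq hq, map_zero]

theorem ContMDiffAt.vec_sum {ι : Type*} (s : Finset ι) {b : P → M} {v : ι → P → E} {p : P}
    (hb : ContMDiffAt IP I ∞ b p)
    (hv : ∀ i ∈ s, ContMDiffAt IP I.tangent ∞ (fun q => vec I (b q) (v i q)) p) :
    ContMDiffAt IP I.tangent ∞ (fun q => vec I (b q) (∑ i ∈ s, v i q)) p := by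
  classical
  induction s using Finset.induction_on with
  | empty => simpa using contMDiffAt_vec_zero hb
  | insert i s hi ih =>
    simp only [Finset.sum_insert hi]
    exact ContMDiffAt.vec_add (hv i (by simp)) (ih fun j hj => hv j (by simp [hj]))

theorem crd_modelSpace (a b v : E) : crd 𝓘(ℝ, E) a (vec 𝓘(ℝ, E) b v) = v := by
  rw [crd_eq (by rw [chartAt_self_eq]; trivial)]
  have : (extChartAt 𝓘(ℝ, E) a : E → E) = (ContinuousLinearMap.id ℝ E : E → E) := by
    ext; simp [chartAt_self_eq]
  rw [this, D_clm]
  rfl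

theorem contMDiffAt_vec_modelSpace {b v : P → E} {p : P} :
    ContMDiffAt IP 𝓘(ℝ, E).tangent ∞ (fun q => vec 𝓘(ℝ, E) (b q) (v q)) p ↔
      ContMDiffAt IP 𝓘(ℝ, E) ∞ b p ∧ ContMDiffAt IP 𝓘(ℝ, E) ∞ v p := by
  rw [contMDiffAt_vec_iff]
  simp only [crd_modelSpace]

theorem contMDiffAt_vec_prod {b : P → M} {b' : P → N} {v : P → E} {v' : P → E'} {p : P} :
    ContMDiffAt IP (I.prod J).tangent ∞ (fun q => vec (I.prod J) (b q, b' q) (v q, v' q)) p ↔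
      ContMDiffAt IP I.tangent ∞ (fun q => vec I (b q) (v q)) p ∧
      ContMDiffAt IP J.tangent ∞ (fun q => vec J (b' q) (v' q)) p := by
  constructor
  · intro h
    have := (contMDiff_equivTangentBundleProd (I := I) (M := M) (I' := J) (M' := N)
      (n := ∞)).contMDiffAt.comp p h
    exact ⟨contMDiffAt_fst.comp p this, contMDiffAt_snd.comp p this⟩
  · rintro ⟨h, h'⟩
    exact (contMDiff_equivTangentBundleProd_symm (I := I) (M := M) (I' := J) (M' := N)
      (n := ∞)).contMDiffAt.comp p (h.prodMk h')

theorem ContMDiffAt.vec_tangentMap {F : M → N} {b : P → M} {v : P → E} {p : P}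
    (hF : ContMDiffAt I J ∞ F (b p))
    (hv : ContMDiffAt IP I.tangent ∞ (fun q => vec I (b q) (v q)) p) :
    ContMDiffAt IP J.tangent ∞ (fun q => vec J (F (b q)) (D I J F (b q) (v q))) p :=
  (contMDiffAt_tangentMap (p := vec I (b p) (v p)) hF).comp p hv

/-! ### Frames and vertical vectors -/

/-- On a finite-dimensional space an operator is a finite sum of rank-one operators built from its
values on a basis. -/
theorem contMDiffAt_clm_of_apply [FiniteDimensional ℝ E] {L : P → E →L[ℝ] E'} {p : P}
    (h : ∀ v, ContMDiffAt IP 𝓘(ℝ, E') ∞ (fun q => L q v) p) :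
    ContMDiffAt IP 𝓘(ℝ, E →L[ℝ] E') ∞ L p := by
  let b := Module.finBasis ℝ E
  have h1 : ∀ i, ContDiff ℝ ∞ fun z : E' => (b.coord i).toContinuousLinearMap.smulRight z :=
    fun i => (ContinuousLinearMap.smulRightL ℝ E E'
      ((b.coord i).toContinuousLinearMap)).contDiff
  have h2 : L = fun q => ∑ i, (b.coord i).toContinuousLinearMap.smulRight (L q (b i)) := by
    funext q
    ext v
    conv_lhs => rw [← b.sum_repr v, map_sum]
    simp only [sum_apply, ContinuousLinearMap.smulRight_apply, map_smul]
    rfl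
  rw [h2]
  exact contMDiffAt_finsetSum fun i _ => (h1 i).contMDiff.contMDiffAt.comp p (h (b i))

variable [FiniteDimensional ℝ E] [FiniteDimensional ℝ E'] [T2Space M] [T2Space N]

variable (I) in
/-- Smooth vector fields that form a frame near `x`, and are constant in the preferred chart at `x`. -/
theorem exists_frame (x : M) : ∃ B : M → E →L[ℝ] E,
    ContMDiff (I.prod 𝓘(ℝ, E)) I.tangent ∞ (fun q : M × E => vec I q.1 (B q.1 q.2)) ∧
    ∃ U : Set M, IsOpen U ∧ x ∈ U ∧ U ⊆ (chartAt H x).source ∧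
      ∀ y ∈ U, ∀ v, crd I x (vec I y (B y v)) = v := by
  let b := Module.finBasis ℝ E
  choose X hX h using fun i => exists_vField (I := I) x (f := fun _ => b i) contDiff_const
  refine ⟨fun y => ∑ i, (b.coord i).toContinuousLinearMap.smulRight ((X i).val y), fun q => ?_, ?_⟩
  · simp only [sum_apply, ContinuousLinearMap.smulRight_apply]
    refine ContMDiffAt.vec_sum _ contMDiffAt_fst fun i _ => ContMDiffAt.vec_smul ?_ ?_
    · exact (b.coord i).toContinuousLinearMap.contDiff.contMDiff.contMDiffAt.comp q contMDiffAt_snd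
    · exact (hX i q.1).comp q contMDiffAt_fst
  · have := (eventually_all.2 h).and (chart_source_mem_nhds H x)
    obtain ⟨U, hU, hUo, hxU⟩ := eventually_nhds_iff.1 this
    refine ⟨U, hUo, hxU, fun y hy => (hU y hy).2, fun y hy v => ?_⟩
    rw [crd_eq (hU y hy).2]
    simp only [sum_apply, ContinuousLinearMap.smulRight_apply, map_sum, map_smul]
    conv_rhs => rw [← b.sum_repr v]
    refine Finset.sum_congr rfl fun i _ => ?_
    rw [← crd_eq (hU y hy).2]
    exact congrArg _ ((hU y hy).1 i)

theorem D_frame {B : M → E →L[ℝ] E}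
    (hB : ContMDiff (I.prod 𝓘(ℝ, E)) I.tangent ∞ (fun q : M × E => vec I q.1 (B q.1 q.2)))
    (y : M) (a w α : E) :
    D (I.prod 𝓘(ℝ, E)) I.tangent (fun q : M × E => vec I q.1 (B q.1 q.2)) (y, a) (w, α) =
      (w, VField.deriv (I := I) (fun y => B y a) y w + B y α) := by
  rw [D_toTangentBundle (hB (y, a))]
  have h2 := (contMDiffAt_toTangentBundle.1 (hB (y, a))).2
  refine Prod.ext ?_ ?_
  · have := congrArg (fun L : E × E →L[ℝ] E => L (w, α))
      (mfderiv_fst (I := I) (I' := 𝓘(ℝ, E)) (x := (y, a)))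
    exact this
  -- The two summands are treated separately: along `M` the field with frozen coefficients `a` is
  -- differentiated, along `E` the map is linear.
  · have e1 : ((w, α) : E × E) = (w, 0) + (0, α) := by simp
    change D (I.prod 𝓘(ℝ, E)) 𝓘(ℝ, E) _ (y, a) (w, α) = _
    rw [e1, map_add]
    congr 1
    · have h := D_comp_apply (F := fun y' : M => (y', a)) h2
        (contMDiffAt_id.prodMk contMDiffAt_const) w
      have h3 := D_prodMk (IP := I) (I := I) (J := 𝓘(ℝ, E)) (f := fun y' : M => y')
        (g := fun _ : M => a) (p := y) contMDiffAt_id contMDiffAt_const w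
      have h4 : D I I (fun y' : M => y') y = ContinuousLinearMap.id ℝ E := D_id y
      rw [h3, D_const, h4] at h
      exact h.symm
    · have h := D_comp_apply (F := fun a' : E => (y, a')) (x := a) h2
        (contMDiffAt_const.prodMk contMDiffAt_id) α
      have h3 := D_prodMk (IP := 𝓘(ℝ, E)) (I := I) (J := 𝓘(ℝ, E)) (f := fun _ : E => y)
        (g := fun a' : E => a') (p := a) contMDiffAt_const contMDiffAt_id α
      have h4 : D 𝓘(ℝ, E) 𝓘(ℝ, E) (fun a' : E => a') a = ContinuousLinearMap.id ℝ E := D_id a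
      rw [h3, D_const, h4] at h
      refine h.symm.trans ?_
      have h3 : (fun q : M × E => crd I y (vec I q.1 (B q.1 q.2))) ∘ (fun a' : E => (y, a')) =
          B y := by
        funext a'
        exact crd_self _ _
      change D 𝓘(ℝ, E) 𝓘(ℝ, E) ((fun q : M × E => crd I y (vec I q.1 (B q.1 q.2))) ∘
        (fun a' : E => (y, a'))) a α = _
      rw [h3, D_clm]

/-- The vector tangent to `TM` with the given components in a frame, as a smooth map. -/
theorem contMDiffAt_tt_frame {B : M → E →L[ℝ] E}
    (hB : ContMDiff (I.prod 𝓘(ℝ, E)) I.tangent ∞ (fun q : M × E => vec I q.1 (B q.1 q.2)))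
    {b : P → M} {w a α : P → E} {p : P}
    (hw : ContMDiffAt IP I.tangent ∞ (fun q => vec I (b q) (w q)) p)
    (ha : ContMDiffAt IP 𝓘(ℝ, E) ∞ a p) (hα : ContMDiffAt IP 𝓘(ℝ, E) ∞ α p) :
    ContMDiffAt IP I.tangent.tangent ∞ (fun q => tt I (b q) (B (b q) (a q)) (w q)
      (VField.deriv (I := I) (fun y => B y (a q)) (b q) (w q) + B (b q) (α q))) p := by
  -- The vector in question is the image of (w, α) under the tangent map of the frame (y, a) ↦ B(y)
  -- a, so its smoothness is that of a tangent map.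
  have h1 : ContMDiffAt IP (I.prod 𝓘(ℝ, E)).tangent ∞
      (fun q => vec (I.prod 𝓘(ℝ, E)) (b q, a q) (w q, α q)) p :=
    contMDiffAt_vec_prod.2 ⟨hw, contMDiffAt_vec_modelSpace.2 ⟨ha, hα⟩⟩
  have h2 := ContMDiffAt.vec_tangentMap (hB _) h1
  simp only [D_frame hB] at h2
  exact h2

theorem frame_crd {x : M} {B : M → E →L[ℝ] E} {U : Set M} (hU : U ⊆ (chartAt H x).source)
    (hB : ∀ y ∈ U, ∀ v, crd I x (vec I y (B y v)) = v) {y : M} (hy : y ∈ U) (v : E) :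
    B y (crd I x (vec I y v)) = v :=
  (crd_inj x (hU hy)).1 (hB y hy _)

/-- With direction `w = 0` the derivative of the frame drops out of `contMDiffAt_tt_frame`, and the
frame coordinates of `e` and `ζ` are the required coefficients. -/
theorem contMDiffAt_vertical {b : P → M} {e ζ : P → E} {p : P}
    (he : ContMDiffAt IP I.tangent ∞ (fun q => vec I (b q) (e q)) p)
    (hζ : ContMDiffAt IP I.tangent ∞ (fun q => vec I (b q) (ζ q)) p) :
    ContMDiffAt IP I.tangent.tangent ∞ (fun q => tt I (b q) (e q) 0 (ζ q)) p := by
  obtain ⟨B, hB, U, hUo, hxU, hU, hBU⟩ := exists_frame I (b p)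
  have hb := (contMDiffAt_vec_iff.1 he).1
  refine (contMDiffAt_tt_frame hB (contMDiffAt_vec_zero hb) (contMDiffAt_vec_iff.1 he).2
    (contMDiffAt_vec_iff.1 hζ).2).congr_of_eventuallyEq ?_
  filter_upwards [hb.continuousAt.eventually (hUo.mem_nhds hxU)] with q hq
  rw [frame_crd hU hBU hq, frame_crd hU hBU hq, map_zero, zero_add]

/-- The difference of two vectors tangent to `TM` with the same projections. -/
theorem contMDiffAt_tt_sub [I.Boundaryless] {b : P → M} {e w η η' : P → E} {p : P}
    (h : ContMDiffAt IP I.tangent.tangent ∞ (fun q => tt I (b q) (e q) (w q) (η q)) p)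
    (h' : ContMDiffAt IP I.tangent.tangent ∞ (fun q => tt I (b q) (e q) (w q) (η' q)) p) :
    ContMDiffAt IP I.tangent ∞ (fun q => vec I (b q) (η q - η' q)) p := by
  have he : ContMDiffAt IP I.tangent ∞ (fun q => vec I (b q) (e q)) p :=
    (contMDiffAt_toTangentBundle.1 h).1
  have hb := (contMDiffAt_vec_iff.1 he).1
  refine contMDiffAt_vec_iff.2 ⟨hb, ?_⟩
  have hc : ContMDiffAt I.tangent 𝓘(ℝ, E) ∞ (crd I (b p)) (vec I (b p) (e p)) :=
    contMDiffAt_crd (mem_chart_source H (b p))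
  have k1 := (contMDiffAt_vec_modelSpace.1 (ContMDiffAt.vec_tangentMap (b := fun q => vec I (b q) (e q)) hc h)).2
  have k2 := (contMDiffAt_vec_modelSpace.1 (ContMDiffAt.vec_tangentMap (b := fun q => vec I (b q) (e q)) hc h')).2
  refine (k1.sub k2).congr_of_eventuallyEq ?_
  filter_upwards [eventually_mem_source hb] with q hq
  have hc' : ContMDiffAt I.tangent 𝓘(ℝ, E) ∞ (crd I (b p)) (vec I (b q) (e q)) :=
    contMDiffAt_crd hq
  -- The difference of the two vectors is vertical, so only the restriction of the fibre coordinate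
  -- to a single fibre is differentiated, and this restriction is linear.
  rw [← map_sub, Prod.mk_sub_mk, sub_self]
  have hv : ContMDiff 𝓘(ℝ, E) I.tangent ∞ (fun a : E => vec I (b q) a) := fun a => by
    refine contMDiffAt_vec_iff.2 ⟨contMDiffAt_const, ?_⟩
    simpa only [crd_self] using! contMDiffAt_id
  have h1 := D_comp_apply (F := fun a : E => vec I (b q) a) (x := e q) hc' (hv _) (η q - η' q)
  have h2 : crd I (b p) ∘ (fun a : E => vec I (b q) a) = D I 𝓘(ℝ, E) (extChartAt I (b p)) (b q) := by
    funext a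
    exact crd_eq hq a
  rw [h2, D_clm, ← crd_eq hq, D_toTangentBundle (hv _)] at h1
  rw [h1]
  congr 1
  refine Prod.ext ?_ ?_
  · exact congrArg (fun L : E →L[ℝ] E => L (η q - η' q))
      (D_const (I := 𝓘(ℝ, E)) (J := I) (e q) (b q))
  · change D 𝓘(ℝ, E) 𝓘(ℝ, E) (fun a : E => crd I (b q) (vec I (b q) a)) (e q) (η q - η' q) = _
    simp only [crd_self]
    exact congrArg (fun L : E →L[ℝ] E => L (η q - η' q)) (D_id (I := 𝓘(ℝ, E)) (e q))

/-- A field of endomorphisms is smooth if it maps smooth fields to smooth fields. -/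
theorem contMDiff_hom_of_apply {A : M → E →L[ℝ] E}
    (h : ∀ X : VField I M, X.IsSmooth → ContMDiff I I.tangent ∞ fun y => vec I y (A y (X.val y))) :
    ContMDiff I (I.prod 𝓘(ℝ, E →L[ℝ] E)) ∞ (fun y => (⟨y, A y⟩ : TotalSpace (E →L[ℝ] E)
      fun y : M => TangentSpace I y →L[ℝ] TangentSpace I y)) := by
  intro x
  rw [contMDiffAt_hom_bundle]
  refine ⟨contMDiffAt_id, contMDiffAt_clm_of_apply fun v => ?_⟩
  obtain ⟨B, hB, U, hUo, hxU, hU, hBU⟩ := exists_frame I x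
  -- It suffices to test on the frame fields: near `x` they have the constant component `v`, so the
  -- components of their images are the matrix entries of `A`.
  have h1 := h (fun y => B y v) fun y =>
    (hB (y, v)).comp y (contMDiffAt_id.prodMk contMDiffAt_const)
  refine (contMDiffAt_vec_iff.1 (h1 x)).2.congr_of_eventuallyEq ?_
  filter_upwards [hUo.mem_nhds hxU] with y hy
  have hy' := hU hy
  have hyb : y ∈ (trivializationAt E (TangentSpace I : M → Type _) x).baseSet := hy'
  have h4 := congrArg (fun L : E →L[ℝ] E => L v) (ContinuousLinearMap.inCoordinates_eq
    (F := E) (E := (TangentSpace I : M → Type _)) (F' := E) (E' := (TangentSpace I : M → Type _))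
    (ϕ := A y) hyb hyb)
  refine h4.trans ?_
  have h3 : ((trivializationAt E (TangentSpace I : M → Type _) x).continuousLinearEquivAt ℝ y
      hyb).symm v = B y v :=
    (ContinuousLinearEquiv.symm_apply_eq _).2 (hBU y hy v).symm
  change ((trivializationAt E (TangentSpace I : M → Type _) x).continuousLinearEquivAt ℝ y hyb)
    (A y (((trivializationAt E (TangentSpace I : M → Type _) x).continuousLinearEquivAt ℝ y
      hyb).symm v)) = _
  rw [h3]
  rfl

end smoothness

section connections

variable {E H E' H' E'' H'' EP HP : Type*}
  [NormedAddCommGroup E] [NormedSpace ℝ E] [TopologicalSpace H]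
  [NormedAddCommGroup E'] [NormedSpace ℝ E'] [TopologicalSpace H']
  [NormedAddCommGroup E''] [NormedSpace ℝ E''] [TopologicalSpace H'']
  [NormedAddCommGroup EP] [NormedSpace ℝ EP] [TopologicalSpace HP]
  {I : ModelWithCorners ℝ E H} {J : ModelWithCorners ℝ E' H'} {K : ModelWithCorners ℝ E'' H''}
  {IP : ModelWithCorners ℝ EP HP}
  {M N Q P : Type*} [TopologicalSpace M] [ChartedSpace H M] [TopologicalSpace N] [ChartedSpace H' N]
  [TopologicalSpace Q] [ChartedSpace H'' Q]
  [TopologicalSpace P] [ChartedSpace HP P] [IsManifold I ∞ M] [IsManifold J ∞ N]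
  [IsManifold K ∞ Q]
  [FiniteDimensional ℝ E] [FiniteDimensional ℝ E'] [FiniteDimensional ℝ E'']

/-! ### Smooth connections -/

/-- The Christoffel symbols of a connection, as functions. -/
def Conn.Γ (cov : Conn I M) (x : M) (e w : E) : E := cov.chr x e w

theorem Conn.app_eq (cov : Conn I M) {X : VField I M} {x : M}
    (hX : ContMDiffAt I I.tangent ∞ X.toMap x) (w : E) :
    cov.app X x w = X.deriv x w + cov.Γ x (X.val x) w :=
  cov.apply_eq (hX.mdifferentiableAt (by simp)) w

/-- The covariant differential of a field is a field of endomorphisms, and by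
`contMDiff_hom_of_apply` such a field is smooth as soon as it preserves smooth vector fields. -/
theorem Conn.isSmooth_iff [T2Space M] {cov : Conn I M} :
    cov.IsSmooth ↔ ∀ X Y : VField I M, X.IsSmooth → Y.IsSmooth →
      ContMDiff I I.tangent ∞ fun y => vec I y (cov.app X y (Y.val y)) := by
  constructor
  · intro h X Y hX hY x
    have h1 := contMDiffOn_univ.1 (h.contMDiff.contMDiff (σ := X) (contMDiffOn_univ.2 hX))
    exact ContMDiffAt.clm_bundle_apply (h1 x) (hY x)
  · intro h
    refine ⟨⟨fun {X} hX => contMDiffOn_univ.2 ?_⟩⟩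
    have hX' : VField.IsSmooth (IM := I) X := contMDiffOn_univ.1 hX
    exact contMDiff_hom_of_apply (A := fun y => (cov X y : E →L[ℝ] E)) fun Y hY => h X Y hX' hY

theorem Conn.IsSmooth.contMDiffAt_app [T2Space M] {cov : Conn I M} (h : cov.IsSmooth)
    {X : VField I M} (hX : X.IsSmooth) {b : P → M} {w : P → E} {p : P}
    (hw : ContMDiffAt IP I.tangent ∞ (fun q => vec I (b q) (w q)) p) :
    ContMDiffAt IP I.tangent ∞ (fun q => vec I (b q) (cov.app X (b q) (w q))) p := by
  have h1 := contMDiffOn_univ.1 (h.contMDiff.contMDiff (σ := X) (contMDiffOn_univ.2 hX))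
  exact ContMDiffAt.clm_bundle_apply
    ((h1 (b p)).comp p (contMDiffAt_vec_iff.1 hw).1) hw

section horizontal

variable [T2Space M]

/-- Linearity of ∇ over constants. It serves to expand ∇ of the field `B · a` in a basis when the
coefficient vector `a` varies with a parameter that is not the point of the manifold. -/
theorem Conn.exists_app_frame (cov : Conn I M) {B : M → E →L[ℝ] E}
    (hB : ∀ v x, MDifferentiableAt I I.tangent (VField.toMap (IM := I) fun y => B y v) x)
    (x : M) (w : E) : ∃ L : E →ₗ[ℝ] E, ∀ a, cov.app (fun y => B y a) x w = L a := by
  refine ⟨{ toFun := fun a => cov.app (fun y => B y a) x w, map_add' := fun a a' => ?_,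
            map_smul' := fun c a => ?_ }, fun a => rfl⟩
  · have h1 := cov.isCovariantDerivativeOnUniv.add (hB a x) (hB a' x)
    have h2 : (fun y => B y (a + a') : VField I M) = (fun y => B y a : VField I M) +
        (fun y => B y a' : VField I M) := VField.ext_val (I := I) fun y => map_add (B y) a a'
    rw [h2]
    exact congrArg (fun L : E →L[ℝ] E => L w) h1
  · have h1 := cov.isCovariantDerivativeOnUniv.smul_const c (hB a x)
    have h2 : (fun y => B y (c • a) : VField I M) = c • (fun y => B y a : VField I M) :=
      VField.ext_val (I := I) fun y => map_smul (B y) c a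
    rw [h2]
    exact congrArg (fun L : E →L[ℝ] E => L w) h1

/-- Horizontal lifts depend smoothly on the vectors. -/
theorem Conn.IsSmooth.contMDiffAt_lift {cov : Conn I M} (h : cov.IsSmooth)
    {b : P → M} {e w : P → E} {p : P}
    (he : ContMDiffAt IP I.tangent ∞ (fun q => vec I (b q) (e q)) p)
    (hw : ContMDiffAt IP I.tangent ∞ (fun q => vec I (b q) (w q)) p) :
    ContMDiffAt IP I.tangent.tangent ∞
      (fun q => tt I (b q) (e q) (w q) (-cov.Γ (b q) (e q) (w q))) p := by
  obtain ⟨B, hB, U, hUo, hxU, hU, hBU⟩ := exists_frame I (b p)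
  have hb := (contMDiffAt_vec_iff.1 he).1
  have hBs : ∀ v, VField.IsSmooth (IM := I) (fun y => B y v) := fun v y =>
    (hB (y, v)).comp y (contMDiffAt_id.prodMk contMDiffAt_const)
  -- For each `q` the frame coefficients of `e q` are frozen, which gives a field through `e q`. Its
  -- covariant derivative along `w q` is a combination, with smooth coefficients, of those of
  -- finitely many fixed frame fields.
  have hL : ContMDiffAt IP 𝓘(ℝ, E) ∞ (fun q => crd I (b p) (vec I (b q)
      (cov.app (fun y => B y (crd I (b p) (vec I (b q) (e q)))) (b q) (w q)))) p := by
    let β := Module.finBasis ℝ E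
    have h1 : ∀ i, ContMDiffAt IP I.tangent ∞ (fun q => vec I (b q)
        (β.coord i (crd I (b p) (vec I (b q) (e q))) •
          cov.app (fun y => B y (β i)) (b q) (w q))) p := fun i =>
      ContMDiffAt.vec_smul
        ((β.coord i).toContinuousLinearMap.contDiff.contMDiff.contMDiffAt.comp p
          (contMDiffAt_vec_iff.1 he).2) (h.contMDiffAt_app (hBs _) hw)
    have h2 := ContMDiffAt.vec_sum Finset.univ hb fun i _ => h1 i
    refine (contMDiffAt_vec_iff.1 h2).2.congr_of_eventuallyEq (.of_forall fun q => ?_)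
    obtain ⟨L, hL⟩ := cov.exists_app_frame (B := B) (fun v x => (hBs v x).mdifferentiableAt
      (by simp)) (b q) (w q)
    simp only [hL, ← map_smul, ← map_sum]
    simp only [Module.Basis.coord_apply, β.sum_repr]
  -- The derivative of the frozen field minus its covariant derivative is -Γ(e, w), so the lift is
  -- the image of (w, minus the coordinates of ∇_w) under the tangent map of the frame.
  refine (contMDiffAt_tt_frame hB hw (contMDiffAt_vec_iff.1 he).2 hL.neg).congr_of_eventuallyEq ?_
  filter_upwards [hb.continuousAt.eventually (hUo.mem_nhds hxU)] with q hq
  rw [frame_crd hU hBU hq, map_neg, frame_crd hU hBU hq, cov.app_eq (hBs _ _)]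
  change _ = tt I (b q) (e q) (w q) (_ + -(_ + cov.Γ (b q) (B (b q) _) (w q)))
  rw [frame_crd hU hBU hq, neg_add_rev, add_comm (-_) (-_), add_neg_cancel_left]

/-- The vertical part of a vector tangent to `TM` depends smoothly on it. -/
theorem Conn.IsSmooth.contMDiffAt_vertical [I.Boundaryless] {cov : Conn I M} (h : cov.IsSmooth)
    {b : P → M} {e w η : P → E} {p : P}
    (hξ : ContMDiffAt IP I.tangent.tangent ∞ (fun q => tt I (b q) (e q) (w q) (η q)) p) :
    ContMDiffAt IP I.tangent ∞ (fun q => vec I (b q) (η q + cov.Γ (b q) (e q) (w q))) p := by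
  have he : ContMDiffAt IP I.tangent ∞ (fun q => vec I (b q) (e q)) p :=
    (contMDiffAt_vec_iff.1 hξ).1
  have hw : ContMDiffAt IP I.tangent ∞ (fun q => vec I (b q) (w q)) p := by
    have := ContMDiffAt.vec_tangentMap (b := fun q => vec I (b q) (e q)) contMDiffAt_proj hξ
    simp only [D_proj] at this
    exact this
  have := contMDiffAt_tt_sub hξ (h.contMDiffAt_lift he hw)
  simpa only [sub_neg_eq_add] using this

theorem VField.IsSmooth.contMDiff_tangentMap {X Y : VField I M} (hX : X.IsSmooth)
    (hY : Y.IsSmooth) : ContMDiff I I.tangent.tangent ∞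
      fun x => tt I x (X.val x) (Y.val x) (X.deriv x (Y.val x)) := by
  intro x
  have h := (contMDiffAt_tangentMap (p := Y.toMap x) (hX x)).comp x (hY x)
  refine h.congr_of_eventuallyEq (.of_forall fun y => ?_)
  exact (VField.tangentMap_toMap (hX y) _).symm

/-- A connection with smooth horizontal lifts is smooth. -/
theorem Conn.isSmooth_of_lift [I.Boundaryless] {cov : Conn I M}
    (h : ∀ X Y : VField I M, X.IsSmooth → Y.IsSmooth → ContMDiff I I.tangent.tangent ∞
      fun x => tt I x (X.val x) (Y.val x) (-cov.Γ x (X.val x) (Y.val x))) : cov.IsSmooth := by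
  refine Conn.isSmooth_iff.2 fun X Y hX hY x => ?_
  have h1 := contMDiffAt_tt_sub (hX.contMDiff_tangentMap hY x) (h X Y hX hY x)
  refine h1.congr_of_eventuallyEq (.of_forall fun y => ?_)
  dsimp only
  rw [cov.app_eq (hX y), sub_neg_eq_add]

/-! ### Torsion and symmetric part -/

/-- Both fields are constant near the centre after pullback by the inverse chart, and constant
fields on a vector space commute. -/
theorem mlieBracket_eq_zero [I.Boundaryless] {X Y : VField I M} {x : M} {v w : E}
    (hX : ∀ᶠ y in 𝓝 x, crd I x (X.toMap y) = v) (hY : ∀ᶠ y in 𝓝 x, crd I x (Y.toMap y) = w) :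
    VectorField.mlieBracket I X Y x = 0 := by
  have key : ∀ {X : VField I M} {v : E}, (∀ᶠ y in 𝓝 x, crd I x (X.toMap y) = v) →
      (VectorField.mpullbackWithin 𝓘(ℝ, E) I (extChartAt I x).symm X (Set.range I) : E → E)
        =ᶠ[𝓝 (extChartAt I x x)] fun _ => v := by
    intro X v hX
    have h1 : Tendsto (extChartAt I x).symm (𝓝 (extChartAt I x x)) (𝓝 x) := by
      have := continuousAt_extChartAt_symm (I := I) x
      rwa [ContinuousAt, extChartAt_to_inv] at this
    filter_upwards [h1.eventually hX, extChartAt_target_mem_nhds (I := I) x] with z hz hzt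
    refine (ContinuousLinearMap.IsInvertible.inverse_apply_eq
      (isInvertible_mfderivWithin_extChartAt_symm hzt)).2 ?_
    have h2 : (extChartAt I x).symm z ∈ (chartAt H x).source := by
      have := (extChartAt I x).map_target hzt
      rwa [extChartAt_source] at this
    rw [VField.toMap_apply, crd_eq h2] at hz
    have h3 := congrArg (fun L : E →L[ℝ] E => L (X.val ((extChartAt I x).symm z)))
      (mfderivWithin_extChartAt_symm_comp_mfderiv_extChartAt hzt)
    subst hz
    exact h3.symm
  rw [← VectorField.mlieBracketWithin_univ, VectorField.mlieBracketWithin_apply]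
  have h := (key hX).lieBracketWithin_vectorField_eq_nhds (𝕜 := ℝ) (key hY)
    (s := (extChartAt I x).symm ⁻¹' Set.univ ∩ Set.range I)
  have h0 : VectorField.lieBracketWithin ℝ (fun _ : E => v) (fun _ : E => w)
    ((extChartAt I x).symm ⁻¹' Set.univ ∩ Set.range I) (extChartAt I x x) = 0 := by
    simp [VectorField.lieBracketWithin]
  exact (congrArg _ (h.trans h0)).trans (map_zero _)

/-- The torsion in the preferred charts. -/
def Conn.tor (cov : Conn I M) (x : M) : E →L[ℝ] E →L[ℝ] E := cov.torsion x

/-- Tested on two fields with constant components near `x`: their derivatives at `x` and their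
bracket vanish, and only the Christoffel symbols remain. -/
theorem Conn.tor_eq [I.Boundaryless] (cov : Conn I M) (x : M) (w e : E) :
    cov.tor x w e = cov.Γ x e w - cov.Γ x w e := by
  have key : ∀ v : E, ∃ X : VField I M, X.IsSmooth ∧ X.val x = v ∧ X.deriv x = 0 ∧
      ∀ᶠ y in 𝓝 x, crd I x (X.toMap y) = v := by
    intro v
    obtain ⟨X, hX, h⟩ := exists_vField (I := I) x (f := fun _ => v) contDiff_const
    refine ⟨X, hX, ?_, ?_, h⟩
    · have := h.self_of_nhds
      rwa [VField.toMap_apply, crd_self] at this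
    · have h' : (fun y => crd I x (vec I y (X.val y))) =ᶠ[𝓝 x] fun _ => v := h
      rw [VField.deriv, D_congr h', D_const]
  obtain ⟨X, hX, rfl, hX', hXc⟩ := key w
  obtain ⟨Y, hY, rfl, hY', hYc⟩ := key e
  have h := cov.torsion_apply ((hX x).mdifferentiableAt (by simp))
    ((hY x).mdifferentiableAt (by simp))
  rw [mlieBracket_eq_zero hXc hYc, sub_zero] at h
  change cov.tor x (X.val x) (Y.val x) = cov.app Y x (X.val x) - cov.app X x (Y.val x) at h
  rw [h, cov.app_eq (hX x), cov.app_eq (hY x), hX', hY']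
  simp

theorem Conn.IsSmooth.torsion [I.Boundaryless] {cov : Conn I M} (h : cov.IsSmooth)
    {X Y : VField I M} (hX : X.IsSmooth) (hY : Y.IsSmooth) :
    ContMDiff I I.tangent ∞ fun x => vec I x (cov.tor x (X.val x) (Y.val x)) := by
  have : IsManifold I (minSmoothness ℝ 2) M := by
    rw [minSmoothness_of_isRCLikeNormedField]
    exact IsManifold.of_le (n := ∞) (WithTop.coe_le_coe.2 le_top)
  have h0 : ContMDiff I I.tangent ∞
      (VField.toMap (IM := I) fun x => VectorField.mlieBracket I X Y x) :=
    have : IsManifold I ((⊤ : ℕ∞) + 1) M := by simpa using ‹IsManifold I ∞ M›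
    ContDiff.mlieBracket_vectorField (n := ⊤) (m := ⊤) hX hY
      (by rw [minSmoothness_of_isRCLikeNormedField]; simp)
  intro x
  have h1 := ContMDiffAt.vec_sub (ContMDiffAt.vec_sub (Conn.isSmooth_iff.1 h Y X hY hX x)
    (Conn.isSmooth_iff.1 h X Y hX hY x)) (h0 x)
  refine h1.congr_of_eventuallyEq (.of_forall fun y => ?_)
  exact congrArg (vec I y) (cov.torsion_apply ((hX y).mdifferentiableAt (by simp))
    ((hY y).mdifferentiableAt (by simp)))

theorem Conn.IsSmooth.torsionTensor [I.Boundaryless] {cov : Conn I M} (h : cov.IsSmooth) :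
    cov.torsionTensor.IsSmooth := fun _ hX => h.torsion (hX 0) (hX 1)

theorem Conn.symPart_app (cov : Conn I M) (X : VField I M) (x : M) (w : E) :
    cov.symPart.app X x w = cov.app X x w - (1 / 2 : ℝ) • cov.tor x w (X.val x) :=
  cov.symPart_apply X x w

theorem Conn.IsSmooth.symPart [I.Boundaryless] {cov : Conn I M} (h : cov.IsSmooth) :
    cov.symPart.IsSmooth := by
  refine Conn.isSmooth_iff.2 fun X Y hX hY x => ?_
  simp only [Conn.symPart_app]
  exact ContMDiffAt.vec_sub (Conn.isSmooth_iff.1 h X Y hX hY x)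
    (ContMDiffAt.vec_smul contMDiffAt_const (h.torsion hY hX x))

theorem Conn.Γ_symPart [I.Boundaryless] (cov : Conn I M) (x : M) (e w : E) :
    cov.symPart.Γ x e w = (1 / 2 : ℝ) • (cov.Γ x e w + cov.Γ x w e) := by
  obtain ⟨X, hX, rfl, h2⟩ := exists_vField_jet (I := I) x e 0
  have h3 := cov.symPart_app X x w
  rw [cov.app_eq (hX x), cov.symPart.app_eq (hX x), cov.tor_eq] at h3
  rw [add_right_inj (a := X.deriv x w) |>.1 (h3.trans (add_sub_assoc _ _ _))]
  module

end horizontal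

/-! ### Related connections -/

variable (I J) in
/-- The transformation law of Christoffel symbols under a map. -/
def RelChr (F : M → N)
    (γ : M → E → E → E) (γ' : N → E' → E' → E') : Prop :=
  ∀ x e w, D I J F x (γ x e w) = hess I J F x w e + γ' (F x) (D I J F x e) (D I J F x w)

variable (I J) in
/-- The transformation law of `(2, 1)`-tensors under a map. -/
def RelTensor (F : M → N)
    (τ : M → E → E → E) (τ' : N → E' → E' → E') : Prop :=
  ∀ x e w, D I J F x (τ x e w) = τ' (F x) (D I J F x e) (D I J F x w)

theorem RelChr.add {F : M → N} {γ τ : M → E → E → E} {γ' τ' : N → E' → E' → E'}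
    (h : RelChr I J F γ γ') (hτ : RelTensor I J F τ τ') : RelChr I J F (γ + τ) (γ' + τ') := by
  intro x e w
  simp only [Pi.add_apply, map_add]
  rw [h, hτ, add_assoc]

section
variable [I.Boundaryless] [J.Boundaryless]

theorem RelChr.comp {F : M → N} {F' : N → Q} (hF : ContMDiff I J ∞ F) (hF' : ContMDiff J K ∞ F')
    {γ : M → E → E → E} {γ' : N → E' → E' → E'} {γ'' : Q → E'' → E'' → E''}
    (h : RelChr I J F γ γ') (h' : RelChr J K F' γ' γ'') : RelChr I K (F' ∘ F) γ γ'' := by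
  intro x e w
  rw [D_comp_apply (hF' _) (hF x), D_comp_apply (hF' _) (hF x), D_comp_apply (hF' _) (hF x), h,
    map_add, h', hess_comp (hF' _) (hF x), Function.comp_apply, ← add_assoc,
    add_comm (D J K F' (F x) _)]

/-- The only inhomogeneous term of the law is the Hessian. Being symmetric, it survives
symmetrization unchanged here and disappears under antisymmetrization in `RelChr.tensor`; this is
the equivalence of the first two conditions at the level of a single map. -/
theorem RelChr.symm_part {F : M → N} (hF : ContMDiff I J ∞ F)
    {γ : M → E → E → E} {γ' : N → E' → E' → E'} (h : RelChr I J F γ γ') :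
    RelChr I J F (fun x e w => (1 / 2 : ℝ) • (γ x e w + γ x w e))
      fun x e w => (1 / 2 : ℝ) • (γ' x e w + γ' x w e) := by
  intro x e w
  rw [map_smul, map_add, h, h, hess_symm (hF x) e w]
  module

theorem RelChr.tensor {F : M → N} (hF : ContMDiff I J ∞ F)
    {γ : M → E → E → E} {γ' : N → E' → E' → E'} (h : RelChr I J F γ γ') :
    RelTensor I J F (fun x e w => γ x w e - γ x e w) fun x e w => γ' x w e - γ' x e w := by
  intro x e w
  rw [map_sub, h, h, hess_symm (hF x) e w, add_sub_add_left_eq_sub]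

/-- The derivatives of related vector fields. -/
theorem deriv_eq_of_related {F : M → N} {x : M} (hF : ContMDiffAt I J ∞ F x) {X : VField I M}
    {Y : VField J N} (hX : ContMDiffAt I I.tangent ∞ X.toMap x)
    (hY : ContMDiffAt J J.tangent ∞ Y.toMap (F x))
    (h : ∀ᶠ y in 𝓝 x, D I J F y (X.val y) = Y.val (F y)) (w : E) :
    Y.deriv (F x) (D I J F x w) = hess I J F x w (X.val x) + D I J F x (X.deriv x w) := by
  -- Relatedness is the identity TF ∘ X = Y ∘ F of maps into TN. It is differentiated, and the
  -- vertical components are compared.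
  have h1 : tangentMap I J F ∘ X.toMap =ᶠ[𝓝 x] Y.toMap ∘ F :=
    h.mono fun y hy => vec_inj.2 hy
  have h2 : D I J.tangent (tangentMap I J F ∘ X.toMap) x w = D I J.tangent (Y.toMap ∘ F) x w :=
    congrArg (fun L : E →L[ℝ] E' × E' => L w) (D_congr (I := I) (J := J.tangent) h1)
  rw [D_comp_apply (J := I.tangent) (contMDiffAt_tangentMap (p := X.toMap x) hF) hX,
    D_comp_apply (J := J) hY hF,
    VField.D_toMap hX, VField.D_toMap hY] at h2
  have h3 := D_tangentMap hF (X.val x) w (X.deriv x w)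
  exact (congrArg Prod.snd (h3.symm.trans h2)).symm

/-- By `deriv_eq_of_related` the derivatives of the two fields differ by exactly the Hessian term.
They cancel, and what is left depends only on the values at the point. -/
theorem app_related_iff {cov : Conn I M} {cov' : Conn J N} {F : M → N} {x : M}
    (hF : ContMDiffAt I J ∞ F x) {X : VField I M} {Y : VField J N}
    (hX : ContMDiffAt I I.tangent ∞ X.toMap x) (hY : ContMDiffAt J J.tangent ∞ Y.toMap (F x))
    (h : ∀ᶠ y in 𝓝 x, D I J F y (X.val y) = Y.val (F y)) (w : E) :
    D I J F x (cov.app X x w) = cov'.app Y (F x) (D I J F x w) ↔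
      D I J F x (cov.Γ x (X.val x) w) = hess I J F x w (X.val x) +
        cov'.Γ (F x) (D I J F x (X.val x)) (D I J F x w) := by
  rw [cov.app_eq hX, cov'.app_eq hY, deriv_eq_of_related hF hX hY h, map_add,
    h.self_of_nhds, add_comm (hess I J F x w _), add_assoc, add_right_inj]

variable (I J) in
/-- Every tangent vector extends to a vector field related to another one. -/
def HasRelatedFields (F : M → N) :
    Prop :=
  ∀ (x : M) (e : E), ∃ (X : VField I M) (Y : VField J N), X.IsSmooth ∧ Y.IsSmooth ∧
    X.Related F Y ∧ X.val x = e

theorem RelChr.related {cov : Conn I M} {cov' : Conn J N} {F : M → N} (hF : ContMDiff I J ∞ F)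
    (h : RelChr I J F cov.Γ cov'.Γ) : cov.Related F cov' := by
  intro X₁ X₂ Y₁ Y₂ _ hX₂ _ hY₂ h₁ h₂ x
  have := (app_related_iff (cov := cov) (cov' := cov') (hF x) (hX₂ x) (hY₂ (F x))
    (.of_forall h₂) (X₁.val x)).2 (h x _ _)
  refine this.trans ?_
  exact congrArg (cov'.app Y₂ (F x)) (h₁ x)

/-- Relatedness is hypothesized only for pairs of related global fields. The hypothesis `hR`
supplies enough of them to reach every pair of tangent vectors, which need not be possible for an
arbitrary map. -/
theorem Conn.Related.relChr {cov : Conn I M} {cov' : Conn J N} {F : M → N}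
    (hF : ContMDiff I J ∞ F) (hR : HasRelatedFields I J F) (h : cov.Related F cov') :
    RelChr I J F cov.Γ cov'.Γ := by
  intro x e w
  obtain ⟨X₂, Y₂, hX₂, hY₂, h₂, rfl⟩ := hR x e
  obtain ⟨X₁, Y₁, hX₁, hY₁, h₁, rfl⟩ := hR x w
  refine (app_related_iff (hF x) (hX₂ x) (hY₂ (F x)) (.of_forall h₂) (X₁.val x)).1 ?_
  refine (h X₁ X₂ Y₁ Y₂ hX₁ hX₂ hY₁ hY₂ h₁ h₂ x).trans ?_
  exact (congrArg (cov'.app Y₂ (F x)) (h₁ x)).symm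

theorem torsionTensor_related_iff {cov : Conn I M} {τ : Tensor J 2 N}
    {F : M → N} : cov.torsionTensor.Related F τ ↔ RelTensor I J F (fun x e w => cov.tor x e w)
      fun y e w => (τ y ![e, w] : E') := by
  constructor
  · intro h x e w
    refine (h x ![e, w]).trans (congrArg (τ (F x)) ?_)
    funext i
    fin_cases i <;> rfl
  · intro h x v
    refine (h x (v 0) (v 1)).trans (congrArg (τ (F x)) ?_)
    funext i
    fin_cases i <;> rfl

end


end connections

section lifts

variable {E H E' H' : Type*}
  [NormedAddCommGroup E] [NormedSpace ℝ E] [TopologicalSpace H]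
  [NormedAddCommGroup E'] [NormedSpace ℝ E'] [TopologicalSpace H']
  {I : ModelWithCorners ℝ E H} {J : ModelWithCorners ℝ E' H'}
  {M N : Type*} [TopologicalSpace M] [ChartedSpace H M] [TopologicalSpace N] [ChartedSpace H' N]
  [IsManifold I ∞ M] [IsManifold J ∞ N] [FiniteDimensional ℝ E] [FiniteDimensional ℝ E']
  [T2Space M]

/-! ### Lifts of vector fields along submersions -/

/-- In a frame and in a chart of the target, dF becomes a family of matrices A(y). With a right
inverse R of A(x), the product A(y) R stays invertible near x, and e + R (A R)⁻¹ (Y - A e) solves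
the equation; at x the residual Y - A e vanishes, so the value is e. -/
theorem exists_local_lift {F : M → N} (hF : ContMDiff I J ∞ F)
    {Y : VField J N} (hY : Y.IsSmooth) {x : M} (hs : Function.Surjective (D I J F x)) {e : E}
    (he : D I J F x e = Y.val (F x)) :
    ∃ U ∈ 𝓝 x, ∃ X : VField I M, ContMDiffOn I I.tangent ∞ X.toMap U ∧
      (∀ y ∈ U, D I J F y (X.val y) = Y.val (F y)) ∧ X.val x = e := by
  obtain ⟨B, hB, U, hUo, hxU, hU, hBU⟩ := exists_frame I x
  have hBx : ∀ v, B x v = v := fun v => by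
    have := frame_crd hU hBU hxU v
    rwa [crd_self] at this
  let A : M → E →L[ℝ] E' := fun y =>
    ((D J 𝓘(ℝ, E') (extChartAt J (F x)) (F y)).comp (D I J F y)).comp (B y)
  have hAx : A x = D I J F x := by
    ext v
    change D J 𝓘(ℝ, E') (extChartAt J (F x)) (F x) (D I J F x (B x v)) = D I J F x v
    rw [D_extChartAt_self, hBx]
    rfl
  let U₁ := U ∩ F ⁻¹' (chartAt H' (F x)).source
  have hU₁ : IsOpen U₁ := hUo.inter ((chartAt H' (F x)).open_source.preimage hF.continuous)
  have hA : ∀ y ∈ U₁, ∀ v, A y v = crd J (F x) (vec J (F y) (D I J F y (B y v))) :=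
    fun y hy v => (crd_eq hy.2 _).symm
  have hAs : ∀ y ∈ U₁, ContMDiffAt I 𝓘(ℝ, E →L[ℝ] E') ∞ A y := fun y hy => by
    refine contMDiffAt_clm_of_apply fun v => ?_
    have h1 : ContMDiffAt I I.tangent ∞ (fun z => vec I z (B z v)) y :=
      (hB (y, v)).comp y (contMDiffAt_id.prodMk contMDiffAt_const)
    have h2 := ((contMDiffAt_vec_iff' (F x) hy.2).1 (ContMDiffAt.vec_tangentMap (hF y) h1)).2
    exact h2.congr_of_eventuallyEq (mem_of_superset (hU₁.mem_nhds hy) fun z hz => hA z hz v)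
  obtain ⟨R₀, hR₀⟩ := (D I J F x).toLinearMap.exists_rightInverse_of_surjective
    (LinearMap.range_eq_top.2 hs)
  let R : E' →L[ℝ] E := R₀.toContinuousLinearMap
  let W := {y ∈ U₁ | ((A y).comp R).IsInvertible}
  let Yc : M → E' := fun y => crd J (F x) (vec J (F y) (Y.val (F y)))
  have hYc : ∀ y ∈ U₁, ContMDiffAt I 𝓘(ℝ, E') ∞ Yc y := fun y hy =>
    ((contMDiffAt_vec_iff' (F x) hy.2).1 ((hY (F y)).comp y (hF y))).2
  let α : M → E := fun y => e + R (((A y).comp R).inverse (Yc y - A y e))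
  have hAR : (A x).comp R = ContinuousLinearMap.id ℝ E' := by
    rw [hAx]
    ext v
    exact congrArg (fun L : E' →ₗ[ℝ] E' => L v) hR₀
  have hxW : x ∈ W := ⟨⟨hxU, mem_chart_source H' (F x)⟩, by
    rw [hAR]; exact ⟨ContinuousLinearEquiv.refl ℝ E', rfl⟩⟩
  have hARs : ∀ y ∈ U₁, ContMDiffAt I 𝓘(ℝ, E' →L[ℝ] E') ∞ (fun z => (A z).comp R) y :=
    fun y hy => (hAs y hy).clm_comp contMDiffAt_const
  have hW : IsOpen W := by
    have h1 : ContinuousOn (fun z => (A z).comp R) U₁ := fun y hy =>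
      (hARs y hy).continuousAt.continuousWithinAt
    exact h1.isOpen_inter_preimage hU₁ (ContinuousLinearEquiv.isOpen (𝕜 := ℝ))
  refine ⟨W, hW.mem_nhds hxW, fun y => B y (α y), fun y hy => ?_, fun y hy => ?_, ?_⟩
  · have hinv : ContMDiffAt I 𝓘(ℝ, E' →L[ℝ] E') ∞ (fun z => ((A z).comp R).inverse) y := by
      obtain ⟨L, hL⟩ := hy.2
      have h1 : ContDiffAt ℝ ∞ ContinuousLinearMap.inverse ((A y).comp R) := by
        rw [← hL]; exact contDiffAt_map_inverse L
      exact h1.contMDiffAt.comp y (hARs y hy.1)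
    have hα : ContMDiffAt I 𝓘(ℝ, E) ∞ α y :=
      contMDiffAt_const.add (contMDiffAt_const.clm_apply
        (hinv.clm_apply ((hYc y hy.1).sub ((hAs y hy.1).clm_apply contMDiffAt_const))))
    exact ((hB (y, α y)).comp y (contMDiffAt_id.prodMk hα)).contMDiffWithinAt
  · refine (crd_inj (I := J) (F x) hy.1.2).1 ?_
    have h1 := hA y hy.1 (α y)
    refine h1.symm.trans ?_
    change A y (e + R (((A y).comp R).inverse (Yc y - A y e))) = Yc y
    have h2 : A y (R (((A y).comp R).inverse (Yc y - A y e))) = Yc y - A y e :=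
      ((hy.2.inverse_apply_eq).1 rfl).symm
    rw [map_add, h2, add_sub_cancel]
  · change B x (e + R (((A x).comp R).inverse (Yc x - A x e))) = e
    have : Yc x - A x e = 0 := by
      rw [hAx, he]
      exact sub_eq_zero.2 (crd_self _ _)
    rw [this, map_zero, map_zero, add_zero, hBx]

/-- Vector fields lift along submersions, with a given value at a point. -/
theorem exists_lift [SigmaCompactSpace M] {F : M → N} (hF : ContMDiff I J ∞ F)
    (hs : ∀ x, Function.Surjective (D I J F x)) {Y : VField J N} (hY : Y.IsSmooth) {x : M} {e : E}
    (he : D I J F x e = Y.val (F x)) :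
    ∃ X : VField I M, X.IsSmooth ∧ X.Related F Y ∧ X.val x = e := by
  -- The admissible values form an affine subspace, cut down to the single vector `e` at `x`. All
  -- these sets are convex, so local lifts are glued by a partition of unity.
  let t : ∀ y : M, Set (TangentSpace I y) := fun y =>
    {v : E | D I J F y v = Y.val (F y) ∧ (y = x → v = e)}
  have ht : ∀ y, Convex ℝ (t y) := by
    intro y v hv w hw a b _ _ hab
    refine ⟨?_, fun h => ?_⟩
    · change D I J F y (a • (show E from v) + b • (show E from w)) = _
      rw [map_add, map_smul, map_smul, hv.1, hw.1, ← add_smul, hab, one_smul]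
    · change a • (show E from v) + b • (show E from w) = e
      have h1 : (show E from v) = e := hv.2 h
      have h2 : (show E from w) = e := hw.2 h
      rw [h1, h2, ← add_smul, hab, one_smul]
  have hloc : ∀ y, ∃ U ∈ 𝓝 y, ∃ X : (y : M) → TangentSpace I y,
      ContMDiffOn I I.tangent ∞ (VField.toMap X) U ∧ ∀ z ∈ U, X z ∈ t z := by
    intro y
    by_cases hy : y = x
    · subst hy
      obtain ⟨U, hU, X, h1, h2, h3⟩ := exists_local_lift hF hY (hs y) he
      refine ⟨U, hU, X, h1, fun z hz => ⟨h2 z hz, ?_⟩⟩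
      rintro rfl
      exact h3
    -- Away from `x` any preimage may start the local lift, and the neighbourhood is shrunk to avoid
    -- `x`, where a value is prescribed.
    · obtain ⟨v, hv⟩ := hs y (Y.val (F y))
      obtain ⟨U, hU, X, h1, h2, h3⟩ := exists_local_lift hF hY (hs y) hv
      refine ⟨U ∩ {x}ᶜ, inter_mem hU (isOpen_compl_singleton.mem_nhds hy), X,
        h1.mono Set.inter_subset_left, fun z hz => ⟨h2 z hz.1, fun h => absurd h hz.2⟩⟩
  obtain ⟨X, hX⟩ := exists_contMDiffSection_forall_mem_convex_of_local (n := ⊤) I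
    (TangentSpace I : M → Type _) (F_fiber := E) t ht hloc
  exact ⟨X, X.contMDiff, fun y => (hX y).1, (hX x).2 rfl⟩

theorem HasRelatedFields.of_surjective [SigmaCompactSpace M] [T2Space N] [J.Boundaryless]
    {F : M → N} (hF : ContMDiff I J ∞ F) (hs : ∀ x, Function.Surjective (D I J F x)) :
    HasRelatedFields I J F := by
  intro x e
  obtain ⟨Y, hY, h1, -⟩ := exists_vField_jet (I := J) (F x) (D I J F x e) 0
  obtain ⟨X, hX, h2, h3⟩ := exists_lift hF hs hY h1.symm
  exact ⟨X, Y, hX, hY, h2, h3⟩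

/-- The product of two vector fields. -/
def VField.prod (X : VField I M) (Y : VField J N) : VField (I.prod J) (M × N) :=
  fun q => (X.val q.1, Y.val q.2)

omit [T2Space M] in
theorem VField.IsSmooth.prod {X : VField I M} {Y : VField J N} (hX : X.IsSmooth)
    (hY : Y.IsSmooth) : (X.prod Y).IsSmooth := fun q =>
  contMDiffAt_vec_prod.2 ⟨(hX q.1).comp q contMDiffAt_fst, (hY q.2).comp q contMDiffAt_snd⟩

omit [T2Space M] in
theorem D_fst (q : M × N) (v : E × E') : D (I.prod J) I Prod.fst q v = v.1 :=
  congrArg (fun L : E × E' →L[ℝ] E => L v) (mfderiv_fst (I := I) (I' := J) (x := q))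

omit [T2Space M] in
theorem D_snd (q : M × N) (v : E × E') : D (I.prod J) J Prod.snd q v = v.2 :=
  congrArg (fun L : E × E' →L[ℝ] E' => L v) (mfderiv_snd (I := I) (I' := J) (x := q))

theorem HasRelatedFields.fst [T2Space N] [I.Boundaryless] [J.Boundaryless] :
    HasRelatedFields (I.prod J) I (Prod.fst : M × N → M) := by
  intro q e
  obtain ⟨X, hX, h1, -⟩ := exists_vField_jet (I := I) q.1 e.1 0
  obtain ⟨Y, hY, h2, -⟩ := exists_vField_jet (I := J) q.2 e.2 0
  exact ⟨X.prod Y, X, hX.prod hY, hX, fun q => D_fst q (X.val q.1, Y.val q.2), Prod.ext h1 h2⟩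

theorem HasRelatedFields.snd [T2Space N] [I.Boundaryless] [J.Boundaryless] :
    HasRelatedFields (I.prod J) J (Prod.snd : M × N → N) := by
  intro q e
  obtain ⟨X, hX, h1, -⟩ := exists_vField_jet (I := I) q.1 e.1 0
  obtain ⟨Y, hY, h2, -⟩ := exists_vField_jet (I := J) q.2 e.2 0
  exact ⟨X.prod Y, Y, hX.prod hY, hY, fun q => D_snd q (X.val q.1, Y.val q.2), Prod.ext h1 h2⟩

omit [T2Space M] in
theorem hess_fst [I.Boundaryless] (q : M × N) (w e : E × E') :
    hess (I.prod J) I (Prod.fst : M × N → M) q w e = 0 := by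
  have h1 : writtenInExtChartAt (I.prod J) I q Prod.fst =ᶠ[𝓝 (extChartAt (I.prod J) q q)]
      (ContinuousLinearMap.fst ℝ E E') := by
    have : ∀ᶠ z in 𝓝 (extChartAt (I.prod J) q q), z.1 ∈ (extChartAt I q.1).target :=
      continuous_fst.continuousAt.eventually (by
        rw [extChartAt_prod]; exact extChartAt_target_mem_nhds (I := I) q.1)
    exact this.mono fun z hz => (extChartAt I q.1).right_inv hz
  have h2 : fderiv ℝ (writtenInExtChartAt (I.prod J) I q Prod.fst)
      =ᶠ[𝓝 (extChartAt (I.prod J) q q)] fun _ => ContinuousLinearMap.fst ℝ E E' :=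
    h1.fderiv.trans (.of_forall fun z => ContinuousLinearMap.fderiv _)
  rw [hess, h2.fderiv_eq]
  simp

omit [T2Space M] in
theorem hess_snd [J.Boundaryless] (q : M × N) (w e : E × E') :
    hess (I.prod J) J (Prod.snd : M × N → N) q w e = 0 := by
  have h1 : writtenInExtChartAt (I.prod J) J q Prod.snd =ᶠ[𝓝 (extChartAt (I.prod J) q q)]
      (ContinuousLinearMap.snd ℝ E E') := by
    have : ∀ᶠ z in 𝓝 (extChartAt (I.prod J) q q), z.2 ∈ (extChartAt J q.2).target :=
      continuous_snd.continuousAt.eventually (by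
        rw [extChartAt_prod]; exact extChartAt_target_mem_nhds (I := J) q.2)
    exact this.mono fun z hz => (extChartAt J q.2).right_inv hz
  have h2 : fderiv ℝ (writtenInExtChartAt (I.prod J) J q Prod.snd)
      =ᶠ[𝓝 (extChartAt (I.prod J) q q)] fun _ => ContinuousLinearMap.snd ℝ E E' :=
    h1.fderiv.trans (.of_forall fun z => ContinuousLinearMap.fderiv _)
  rw [hess, h2.fderiv_eq]
  simp

end lifts

namespace LieGroupoid

variable {EM EG M G : Type*}
  [NormedAddCommGroup EM] [NormedSpace ℝ EM] [FiniteDimensional ℝ EM]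
  [NormedAddCommGroup EG] [NormedSpace ℝ EG] [FiniteDimensional ℝ EG]
  [TopologicalSpace M] [ChartedSpace EM M] [IsManifold 𝓘(ℝ, EM) ∞ M]
  [TopologicalSpace G] [ChartedSpace EG G] [IsManifold 𝓘(ℝ, EG) ∞ G]
  (K : LieGroupoid EM EG M G)

/-! ### Algebra of a groupoid -/

theorem composable_ext {c d : K.Composable} (h1 : c.fst = d.fst) (h2 : c.snd = d.snd) : c = d :=
  SourceTarget.Composable.ext h1 h2

theorem mul_congr {g g' h h' : G} (hg : g = g') (hh : h = h') (H : K.src g = K.tgt h) :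
    K.mul ⟨g, h, H⟩ = K.mul ⟨g', h', by rw [← hg, ← hh]; exact H⟩ := by subst hg hh; rfl

theorem mul_inv_cancel_right (u h : G) (H : K.src u = K.src h) :
    K.mul ⟨K.mul ⟨u, K.inv h, H.trans (K.tgt_inv h).symm⟩, h, (K.src_mul _).trans (K.src_inv h)⟩
      = u := by
  rw [K.mul_assoc u (K.inv h) h (H.trans (K.tgt_inv h).symm) (K.src_inv h),
    K.mul_congr rfl ((K.inv_mul h).trans (congrArg K.unit H.symm)), K.mul_unit]

theorem mul_mul_inv_cancel (g h : G) (H : K.src g = K.tgt h) :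
    K.mul ⟨K.mul ⟨g, h, H⟩, K.inv h, (K.src_mul _).trans (K.tgt_inv h).symm⟩ = g := by
  rw [K.mul_assoc g h (K.inv h) H (K.tgt_inv h).symm,
    K.mul_congr rfl ((K.mul_inv h).trans (congrArg K.unit H.symm)), K.mul_unit]

theorem inv_inv (g : G) : K.inv (K.inv g) = g := by
  have h1 := K.mul_assoc (K.inv (K.inv g)) (K.inv g) g (K.src_inv _) (K.src_inv _)
  rw [K.mul_congr (K.inv_mul (K.inv g)) rfl, K.mul_congr rfl (K.inv_mul g)] at h1
  rw [K.mul_congr (congrArg K.unit (K.src_inv g)) rfl, K.unit_mul] at h1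
  rw [K.mul_congr rfl (congrArg K.unit ((K.tgt_inv g).symm.trans (K.src_inv (K.inv g)).symm)),
    K.mul_unit] at h1
  exact h1.symm

/-! ### The manifold of composable arrows -/

theorem injective_incl : Function.Injective K.incl := fun _ _ h =>
  K.composable_ext (congrArg Prod.fst h) (congrArg Prod.snd h)

theorem isInducing_incl : Topology.IsInducing K.incl := ⟨rfl⟩

instance [T2Space G] : T2Space K.Composable :=
  T2Space.of_injective_continuous K.injective_incl K.continuous_incl

instance [SecondCountableTopology G] : SecondCountableTopology K.Composable :=
  K.isInducing_incl.secondCountableTopology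

theorem contMDiff_src : ContMDiff 𝓘(ℝ, EG) 𝓘(ℝ, EM) ∞ K.src := K.isSubmersion_src.contMDiff

theorem contMDiff_composable_fst : ContMDiff 𝓘(ℝ, PairModel EM EG) 𝓘(ℝ, EG) ∞
    (SourceTarget.Composable.fst : K.Composable → G) :=
  contMDiff_fst.comp K.contMDiff_incl

theorem contMDiff_composable_snd : ContMDiff 𝓘(ℝ, PairModel EM EG) 𝓘(ℝ, EG) ∞
    (SourceTarget.Composable.snd : K.Composable → G) :=
  contMDiff_snd.comp K.contMDiff_incl

/-- The coordinates of G⁽²⁾ are defined on an open subset of G × G, so following them by the inverse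
chart extends the identity of G⁽²⁾ to a neighbourhood. Smoothness of maps into G⁽²⁾ and injectivity
of its tangent inclusion both come from this map. -/
theorem exists_retraction (c : K.Composable) : ∃ ρ : G × G → K.Composable,
    ContMDiffAt (𝓘(ℝ, EG).prod 𝓘(ℝ, EG)) 𝓘(ℝ, PairModel EM EG) ∞ ρ (K.incl c) ∧
    ∀ᶠ d in 𝓝 c, ρ (K.incl d) = d := by
  have hc : c ∈ (K.pairChart c).source := mem_chart_source (PairModel EM EG) c
  refine ⟨(K.pairChart c).symm ∘ K.coord c, ?_, ?_⟩
  · have h1 : ContMDiffAt 𝓘(ℝ, PairModel EM EG) 𝓘(ℝ, PairModel EM EG) ∞ (K.pairChart c).symm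
        (K.coord c (K.incl c)) :=
      (contMDiffOn_chart_symm (I := 𝓘(ℝ, PairModel EM EG)) (x := c)).contMDiffAt
        ((K.isOpen_coordTarget c).mem_nhds ((K.pairChart c).map_source hc))
    exact h1.comp (K.incl c) ((K.contMDiffOn_coord c).contMDiffAt
      ((K.isOpen_coordSource c).mem_nhds hc))
  · filter_upwards [(K.pairChart c).open_source.mem_nhds hc] with d hd
    exact (K.pairChart c).left_inv hd

variable {EP HP P : Type*} [NormedAddCommGroup EP] [NormedSpace ℝ EP] [TopologicalSpace HP]
  {IP : ModelWithCorners ℝ EP HP} [TopologicalSpace P] [ChartedSpace HP P]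

variable {K} in
-- Smoothness into G × G gives continuity into G⁽²⁾, since its topology is induced; the local
-- retraction then turns smoothness into G × G into smoothness into G⁽²⁾.
theorem contMDiffAt_composable {f : P → K.Composable} {p : P} :
    ContMDiffAt IP 𝓘(ℝ, PairModel EM EG) ∞ f p ↔
      ContMDiffAt IP 𝓘(ℝ, EG) ∞ (fun q => (f q).fst) p ∧
      ContMDiffAt IP 𝓘(ℝ, EG) ∞ (fun q => (f q).snd) p := by
  constructor
  · exact fun h => ⟨(K.contMDiff_composable_fst _).comp p h, (K.contMDiff_composable_snd _).comp p h⟩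
  · rintro ⟨h1, h2⟩
    obtain ⟨ρ, hρ, hρ'⟩ := K.exists_retraction (f p)
    have h3 : ContMDiffAt IP (𝓘(ℝ, EG).prod 𝓘(ℝ, EG)) ∞ (fun q => K.incl (f q)) p :=
      h1.prodMk h2
    have hc : ContinuousAt f p := K.isInducing_incl.continuousAt_iff.2 h3.continuousAt
    refine (ContMDiffAt.comp p hρ h3).congr_of_eventuallyEq ?_
    exact (hc.eventually hρ').mono fun q hq => hq.symm

theorem exists_composable_map {f₁ f₂ : P → G} {p : P} (h₁ : ContMDiffAt IP 𝓘(ℝ, EG) ∞ f₁ p)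
    (h₂ : ContMDiffAt IP 𝓘(ℝ, EG) ∞ f₂ p) (h : ∀ᶠ q in 𝓝 p, K.src (f₁ q) = K.tgt (f₂ q)) :
    ∃ f : P → K.Composable, ContMDiffAt IP 𝓘(ℝ, PairModel EM EG) ∞ f p ∧
      (∀ q, K.src (f₁ q) = K.tgt (f₂ q) → (f q).fst = f₁ q ∧ (f q).snd = f₂ q) := by
  classical
  -- Where the two arrows are not composable the pair at `p` is a default value; it does not affect
  -- the germ at `p`.
  refine ⟨fun q => if H : K.src (f₁ q) = K.tgt (f₂ q) then ⟨_, _, H⟩ else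
    ⟨_, _, h.self_of_nhds⟩, ?_, fun q H => by simp [dif_pos H]⟩
  refine contMDiffAt_composable.2 ⟨h₁.congr_of_eventuallyEq ?_, h₂.congr_of_eventuallyEq ?_⟩
  all_goals exact h.mono fun q H => by simp [dif_pos H]

/-- The source map is locally a projection. -/
theorem exists_local_product (g₀ : G) : ∃ r : M × G → G,
    ContMDiffAt (𝓘(ℝ, EM).prod 𝓘(ℝ, EG)) 𝓘(ℝ, EG) ∞ r (K.src g₀, g₀) ∧
    (∀ᶠ q in 𝓝 (K.src g₀, g₀), K.src (r q) = q.1) ∧ ∀ᶠ g in 𝓝 g₀, r (K.src g, g) = g := by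
  -- The adapted charts are indexed by composable pairs, so `g₀` is completed by a unit merely to
  -- select the chart at `g₀`.
  let c : K.Composable := ⟨g₀, K.unit (K.src g₀), (K.tgt_unit _).symm⟩
  have hg₀ : g₀ ∈ (K.φ c).source := (K.isSubmersionAt_fibreModel g₀).mem_domChart_source
  have hφ : ∀ g ∈ (K.φ c).source,
      (K.split c).symm (K.ψ c (K.src g), (K.split c (K.φ c g)).2) = K.φ c g := fun g hg => by
    rw [K.ψ_src c hg, ContinuousLinearEquiv.symm_apply_eq]
  -- The base coordinates are taken from the point of `M`, the fibre coordinates from the arrow.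
  let α : M × G → EG := fun q => (K.split c).symm (K.ψ c q.1, (K.split c (K.φ c q.2)).2)
  have hα : ContMDiffAt (𝓘(ℝ, EM).prod 𝓘(ℝ, EG)) 𝓘(ℝ, EG) ∞ α (K.src g₀, g₀) := by
    have h1 : ContMDiffAt (𝓘(ℝ, EM).prod 𝓘(ℝ, EG)) 𝓘(ℝ, EM) ∞ (fun q : M × G => K.ψ c q.1)
        (K.src g₀, g₀) :=
      (contMDiffAt_of_mem_maximalAtlas (K.ψ_mem c) (K.src_mem c hg₀)).comp
        (K.src g₀, g₀) contMDiffAt_fst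
    have h2 : ContMDiffAt (𝓘(ℝ, EM).prod 𝓘(ℝ, EG)) 𝓘(ℝ, EG) ∞ (fun q : M × G => K.φ c q.2)
        (K.src g₀, g₀) :=
      (contMDiffAt_of_mem_maximalAtlas (K.φ_mem c) hg₀).comp
        (K.src g₀, g₀) contMDiffAt_snd
    have h3 : ContMDiff 𝓘(ℝ, EG) 𝓘(ℝ, FibreModel EM EG) ∞ fun z => (K.split c z).2 :=
      (contDiff_snd.comp (K.split c).contDiff).contMDiff
    exact (K.split c).symm.contDiff.contMDiff.contMDiffAt.comp (K.src g₀, g₀)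
      (h1.prodMk_space (h3.contMDiffAt.comp (K.src g₀, g₀) h2))
  have hα0 : α (K.src g₀, g₀) = K.φ c g₀ := hφ g₀ hg₀
  have hev : ∀ᶠ q in 𝓝 (K.src g₀, g₀), α q ∈ (K.φ c).target ∧ q.1 ∈ (K.ψ c).source := by
    refine (hα.continuousAt.eventually ?_).and (continuousAt_fst.eventually ?_)
    · exact (K.φ c).open_target.mem_nhds (by rw [hα0]; exact (K.φ c).map_source hg₀)
    · exact (K.ψ c).open_source.mem_nhds (K.src_mem c hg₀)
  refine ⟨fun q => (K.φ c).symm (α q), ?_, ?_, ?_⟩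
  · have h1 : ContMDiffAt 𝓘(ℝ, EG) 𝓘(ℝ, EG) ∞ (K.φ c).symm (α (K.src g₀, g₀)) :=
      (contMDiffOn_symm_of_mem_maximalAtlas (K.φ_mem c)).contMDiffAt
        ((K.φ c).open_target.mem_nhds (by rw [hα0]; exact (K.φ c).map_source hg₀))
    exact h1.comp _ hα
  · filter_upwards [hev] with q hq
    have h1 := (K.φ c).map_target hq.1
    refine (K.ψ c).injOn (K.src_mem c h1) hq.2 ?_
    rw [K.ψ_src c h1, (K.φ c).right_inv hq.1, ContinuousLinearEquiv.apply_symm_apply]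
  · filter_upwards [(K.φ c).open_source.mem_nhds hg₀] with g hg
    rw [show α (K.src g, g) = K.φ c g from hφ g hg, (K.φ c).left_inv hg]

/-! ### Tangent maps of the structure maps -/

theorem exists_local_section (g₀ : G) : ∃ σ : M → G,
    ContMDiffAt 𝓘(ℝ, EM) 𝓘(ℝ, EG) ∞ σ (K.src g₀) ∧ σ (K.src g₀) = g₀ ∧
    ∀ᶠ x in 𝓝 (K.src g₀), K.src (σ x) = x := by
  obtain ⟨r, hr, hr1, hr2⟩ := K.exists_local_product g₀
  have h1 : ContMDiffAt 𝓘(ℝ, EM) (𝓘(ℝ, EM).prod 𝓘(ℝ, EG)) ∞ (fun x : M => (x, g₀))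
    (K.src g₀) := contMDiffAt_id.prodMk contMDiffAt_const
  refine ⟨fun x => r (x, g₀), ContMDiffAt.comp (K.src g₀) hr h1, hr2.self_of_nhds, ?_⟩
  exact h1.continuousAt.eventually hr1

omit [IsManifold 𝓘(ℝ, EM) ∞ M] [IsManifold 𝓘(ℝ, EG) ∞ G] in
theorem surjective_of_local_section {E H E' H' N Q : Type*} [NormedAddCommGroup E]
    [NormedSpace ℝ E] [TopologicalSpace H] [NormedAddCommGroup E'] [NormedSpace ℝ E']
    [TopologicalSpace H'] {I : ModelWithCorners ℝ E H} {J : ModelWithCorners ℝ E' H'}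
    [TopologicalSpace N] [ChartedSpace H N] [TopologicalSpace Q] [ChartedSpace H' Q]
    {F : N → Q} {σ : Q → N} {x : N} (hF : ContMDiffAt I J ∞ F x)
    (hσ : ContMDiffAt J I ∞ σ (F x)) (hx : σ (F x) = x) (h : ∀ᶠ y in 𝓝 (F x), F (σ y) = y) :
    Function.Surjective (D I J F x) := fun v => by
  have h1 := D_comp_apply (K := J) (F' := F) (by rw [hx]; exact hF) hσ v
  have h2 : F ∘ σ =ᶠ[𝓝 (F x)] id := h
  rw [D_congr h2, D_id, hx] at h1
  exact ⟨_, h1.symm⟩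

theorem surjective_D_src (g : G) : Function.Surjective (D 𝓘(ℝ, EG) 𝓘(ℝ, EM) K.src g) := by
  obtain ⟨σ, h1, h2, h3⟩ := K.exists_local_section g
  exact surjective_of_local_section (K.contMDiff_src g) h1 h2 h3

theorem src_comp_inv : K.src ∘ K.inv = K.tgt := funext K.src_inv

theorem surjective_D_tgt (g : G) : Function.Surjective (D 𝓘(ℝ, EG) 𝓘(ℝ, EM) K.tgt g) := by
  have h1 := D_comp (I := 𝓘(ℝ, EG)) (J := 𝓘(ℝ, EG)) (K := 𝓘(ℝ, EM)) (K.contMDiff_src (K.inv g))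
    (K.contMDiff_inv g)
  rw [K.src_comp_inv] at h1
  rw [h1]
  refine (K.surjective_D_src (K.inv g)).comp (surjective_of_local_section (σ := K.inv)
    (K.contMDiff_inv g) (K.contMDiff_inv _) (K.inv_inv g) (.of_forall K.inv_inv))

/-- For a local section σ of the source through the second arrow of `c`, the map u ↦ (u σ(s u)⁻¹,
σ(s u)) is a section of the multiplication, and it passes through `c`. -/
theorem surjective_D_mul (c : K.Composable) :
    Function.Surjective (D 𝓘(ℝ, PairModel EM EG) 𝓘(ℝ, EG) K.mul c) := by
  obtain ⟨σ, h1, h2, h3⟩ := K.exists_local_section c.snd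
  have hs : K.src (K.mul c) = K.src c.snd := K.src_mul c
  rw [← hs] at h1 h2 h3
  have hσ : ContMDiffAt 𝓘(ℝ, EG) 𝓘(ℝ, EG) ∞ (fun u => σ (K.src u)) (K.mul c) :=
    h1.comp (K.mul c) (K.contMDiff_src _)
  have hev : ∀ᶠ u in 𝓝 (K.mul c), K.src (σ (K.src u)) = K.src u :=
    (K.contMDiff_src _).continuousAt.eventually h3
  obtain ⟨f, hf, hf'⟩ := K.exists_composable_map (f₁ := id) (f₂ := fun u => K.inv (σ (K.src u)))
    contMDiffAt_id ((K.contMDiff_inv _).comp (K.mul c) hσ)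
    (hev.mono fun u hu => (K.tgt_inv _).symm ▸ hu.symm)
  have hm : ContMDiffAt 𝓘(ℝ, EG) 𝓘(ℝ, EG) ∞ (fun u => K.mul (f u)) (K.mul c) :=
    (K.contMDiff_mul _).comp (K.mul c) hf
  have hfu : ∀ u, K.src (σ (K.src u)) = K.src u →
      (f u).fst = u ∧ (f u).snd = K.inv (σ (K.src u)) := fun u hu =>
    hf' u ((K.tgt_inv _).symm ▸ hu.symm)
  have hsrc : ∀ u, K.src (σ (K.src u)) = K.src u → K.src (K.mul (f u)) = K.tgt (σ (K.src u)) :=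
    fun u hu => by rw [K.src_mul, (hfu u hu).2, K.src_inv]
  obtain ⟨k, hk, hk'⟩ := K.exists_composable_map (f₁ := fun u => K.mul (f u))
    (f₂ := fun u => σ (K.src u)) hm hσ (hev.mono hsrc)
  refine surjective_of_local_section (K.contMDiff_mul c) hk ?_ ?_
  · have h0 := hev.self_of_nhds
    obtain ⟨e1, e2⟩ := hk' _ (hsrc _ h0)
    obtain ⟨e3, e4⟩ := hfu _ h0
    refine K.composable_ext ?_ (e2.trans h2)
    rw [e1]
    have h4 : (f (K.mul c)).snd = K.inv c.snd := e4.trans (congrArg K.inv h2)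
    have h5 : f (K.mul c) = ⟨K.mul ⟨c.fst, c.snd, c.src_fst⟩, K.inv c.snd,
        (K.src_mul _).trans (K.tgt_inv _).symm⟩ := K.composable_ext e3 h4
    rw [h5]
    exact K.mul_mul_inv_cancel c.fst c.snd c.src_fst
  · filter_upwards [hev] with u hu
    obtain ⟨e1, e2⟩ := hk' _ (hsrc _ hu)
    obtain ⟨e3, e4⟩ := hfu _ hu
    have h5 : f u = ⟨u, K.inv (σ (K.src u)), hu.symm.trans (K.tgt_inv _).symm⟩ :=
      K.composable_ext e3 e4
    have h6 : k u = ⟨K.mul ⟨u, K.inv (σ (K.src u)), hu.symm.trans (K.tgt_inv _).symm⟩, σ (K.src u),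
        (K.src_mul _).trans (K.src_inv _)⟩ := K.composable_ext (e1.trans (congrArg _ h5)) e2
    rw [h6]
    exact K.mul_inv_cancel_right u _ hu.symm

theorem D_incl (c : K.Composable) (v : PairModel EM EG) :
    D 𝓘(ℝ, PairModel EM EG) (𝓘(ℝ, EG).prod 𝓘(ℝ, EG)) K.incl c v =
      (D 𝓘(ℝ, PairModel EM EG) 𝓘(ℝ, EG) SourceTarget.Composable.fst c v,
        D 𝓘(ℝ, PairModel EM EG) 𝓘(ℝ, EG) SourceTarget.Composable.snd c v) :=
  D_prodMk (K.contMDiff_composable_fst c) (K.contMDiff_composable_snd c) v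

/-- The inclusion into G × G has a local left inverse, so its tangent map is injective. Unknown
vectors tangent to G⁽²⁾ are thereby controlled through their two components. -/
theorem D_composable_inj {c : K.Composable} {v w : PairModel EM EG}
    (h1 : D 𝓘(ℝ, PairModel EM EG) 𝓘(ℝ, EG) SourceTarget.Composable.fst c v =
      D 𝓘(ℝ, PairModel EM EG) 𝓘(ℝ, EG) SourceTarget.Composable.fst c w)
    (h2 : D 𝓘(ℝ, PairModel EM EG) 𝓘(ℝ, EG) SourceTarget.Composable.snd c v =
      D 𝓘(ℝ, PairModel EM EG) 𝓘(ℝ, EG) SourceTarget.Composable.snd c w) : v = w := by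
  obtain ⟨ρ, hρ, hρ'⟩ := K.exists_retraction c
  have key : ∀ v, D (𝓘(ℝ, EG).prod 𝓘(ℝ, EG)) 𝓘(ℝ, PairModel EM EG) ρ (K.incl c)
      (D 𝓘(ℝ, PairModel EM EG) (𝓘(ℝ, EG).prod 𝓘(ℝ, EG)) K.incl c v) = v := fun v => by
    rw [← D_comp_apply hρ (K.contMDiff_incl c)]
    have : ρ ∘ K.incl =ᶠ[𝓝 c] id := hρ'
    rw [D_congr this, D_id]
    rfl
  rw [← key v, ← key w, D_incl, D_incl, h1, h2]

theorem src_comp_fst : K.src ∘ (SourceTarget.Composable.fst : K.Composable → G) =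
    K.tgt ∘ SourceTarget.Composable.snd := funext fun c => c.src_fst

theorem D_src_fst (c : K.Composable) (v : PairModel EM EG) :
    D 𝓘(ℝ, EG) 𝓘(ℝ, EM) K.src c.fst
      (D 𝓘(ℝ, PairModel EM EG) 𝓘(ℝ, EG) SourceTarget.Composable.fst c v) =
    D 𝓘(ℝ, EG) 𝓘(ℝ, EM) K.tgt c.snd
      (D 𝓘(ℝ, PairModel EM EG) 𝓘(ℝ, EG) SourceTarget.Composable.snd c v) := by
  rw [← D_comp_apply (K.contMDiff_src _) (K.contMDiff_composable_fst c),
    ← D_comp_apply (K.contMDiff_tgt _) (K.contMDiff_composable_snd c), K.src_comp_fst]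

/-- A local retraction of `G × G` to the composable arrows that fixes the second component. -/
theorem exists_retraction_snd (c : K.Composable) : ∃ ρ : G × G → K.Composable,
    ContMDiffAt (𝓘(ℝ, EG).prod 𝓘(ℝ, EG)) 𝓘(ℝ, PairModel EM EG) ∞ ρ (K.incl c) ∧
    ρ (K.incl c) = c ∧
    ∀ v₁ v₂ : EG, D 𝓘(ℝ, EG) 𝓘(ℝ, EM) K.src c.fst v₁ = D 𝓘(ℝ, EG) 𝓘(ℝ, EM) K.tgt c.snd v₂ →
      D 𝓘(ℝ, PairModel EM EG) 𝓘(ℝ, EG) SourceTarget.Composable.fst c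
        (D (𝓘(ℝ, EG).prod 𝓘(ℝ, EG)) 𝓘(ℝ, PairModel EM EG) ρ (K.incl c) (v₁, v₂)) = v₁ ∧
      D 𝓘(ℝ, PairModel EM EG) 𝓘(ℝ, EG) SourceTarget.Composable.snd c
        (D (𝓘(ℝ, EG).prod 𝓘(ℝ, EG)) 𝓘(ℝ, PairModel EM EG) ρ (K.incl c) (v₁, v₂)) = v₂ := by
  obtain ⟨r, hr, hr1, hr2⟩ := K.exists_local_product c.fst
  have ht : ContMDiffAt (𝓘(ℝ, EG).prod 𝓘(ℝ, EG)) 𝓘(ℝ, EM) ∞ (fun q : G × G => K.tgt q.2)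
      (K.incl c) := (K.contMDiff_tgt _).comp (K.incl c) contMDiffAt_snd
  have hi : ContMDiffAt (𝓘(ℝ, EG).prod 𝓘(ℝ, EG)) (𝓘(ℝ, EM).prod 𝓘(ℝ, EG)) ∞
      (fun q : G × G => (K.tgt q.2, q.1)) (K.incl c) := ht.prodMk contMDiffAt_fst
  have hp : (K.tgt (K.incl c).2, (K.incl c).1) = (K.src c.fst, c.fst) :=
    Prod.ext c.src_fst.symm rfl
  have hf₁ : ContMDiffAt (𝓘(ℝ, EG).prod 𝓘(ℝ, EG)) 𝓘(ℝ, EG) ∞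
      (fun q : G × G => r (K.tgt q.2, q.1)) (K.incl c) :=
    ContMDiffAt.comp (I' := 𝓘(ℝ, EM).prod 𝓘(ℝ, EG)) (K.incl c) (by rw [hp]; exact hr) hi
  have hev : ∀ᶠ q in 𝓝 (K.incl c), K.src (r (K.tgt q.2, q.1)) = K.tgt q.2 := by
    have := hi.continuousAt
    rw [ContinuousAt, hp] at this
    exact this.eventually hr1
  -- The retraction is (g, h) ↦ (r(t h, g), h): the first arrow is moved, with its fibre coordinates
  -- kept, until its source is t h.
  obtain ⟨ρ, hρ, hρ'⟩ := K.exists_composable_map (f₂ := Prod.snd) hf₁ contMDiffAt_snd hev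
  have hρc : ρ (K.incl c) = c := by
    obtain ⟨e1, e2⟩ := hρ' _ hev.self_of_nhds
    refine K.composable_ext (e1.trans ?_) e2
    rw [hp]
    exact hr2.self_of_nhds
  refine ⟨ρ, hρ, hρc, fun v₁ v₂ h => ⟨?_, ?_⟩⟩
  · have h1 := D_comp_apply (K := 𝓘(ℝ, EG)) (K.contMDiff_composable_fst (ρ (K.incl c))) hρ (v₁, v₂)
    rw [hρc] at h1
    rw [← h1]
    have h2 : SourceTarget.Composable.fst ∘ ρ =ᶠ[𝓝 (K.incl c)]
        r ∘ fun q : G × G => (K.tgt q.2, q.1) := hev.mono fun q hq => (hρ' q hq).1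
    rw [D_congr h2, D_comp_apply (J := 𝓘(ℝ, EM).prod 𝓘(ℝ, EG)) (by rw [hp]; exact hr) hi,
      D_prodMk ht contMDiffAt_fst, hp, D_fst,
      show (fun q : G × G => K.tgt q.2) = K.tgt ∘ Prod.snd from rfl,
      D_comp_apply (K.contMDiff_tgt _) contMDiffAt_snd, D_snd]
    change D (𝓘(ℝ, EM).prod 𝓘(ℝ, EG)) 𝓘(ℝ, EG) r (K.src c.fst, c.fst)
      (D 𝓘(ℝ, EG) 𝓘(ℝ, EM) K.tgt c.snd v₂, v₁) = v₁
    -- Because ds v₁ = dt v₂, the vector to which dr is applied is tangent to g ↦ (s g, g), and r is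
    -- the identity along this map.
    rw [← h]
    have hid : ContMDiffAt 𝓘(ℝ, EG) 𝓘(ℝ, EG) ∞ (fun g : G => g) c.fst := contMDiffAt_id
    have h3 := D_comp_apply (F := fun g : G => (K.src g, g)) (x := c.fst) hr
      ((K.contMDiff_src c.fst).prodMk hid) v₁
    rw [D_prodMk (K.contMDiff_src c.fst) hid] at h3
    have h4 : r ∘ (fun g : G => (K.src g, g)) =ᶠ[𝓝 c.fst] id := hr2
    have h5 : D 𝓘(ℝ, EG) 𝓘(ℝ, EG) (fun g : G => g) c.fst v₁ = v₁ :=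
      congrArg (fun L : EG →L[ℝ] EG => L v₁) (D_id (I := 𝓘(ℝ, EG)) c.fst)
    rw [D_congr h4, D_id, h5] at h3
    exact h3.symm
  · have h1 := D_comp_apply (K := 𝓘(ℝ, EG)) (K.contMDiff_composable_snd (ρ (K.incl c))) hρ (v₁, v₂)
    rw [hρc] at h1
    rw [← h1]
    have h2 : SourceTarget.Composable.snd ∘ ρ =ᶠ[𝓝 (K.incl c)] Prod.snd :=
      hev.mono fun q hq => (hρ' q hq).2
    rw [D_congr h2, D_snd]

/-- Together with `D_composable_inj` this identifies T(G⁽²⁾) with the composable pairs of TG. The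
witness is the image of (v₁, v₂) under the tangent map of the retraction. -/
theorem exists_D_composable (c : K.Composable) {v₁ v₂ : EG}
    (h : D 𝓘(ℝ, EG) 𝓘(ℝ, EM) K.src c.fst v₁ = D 𝓘(ℝ, EG) 𝓘(ℝ, EM) K.tgt c.snd v₂) :
    ∃ v : PairModel EM EG, D 𝓘(ℝ, PairModel EM EG) 𝓘(ℝ, EG) SourceTarget.Composable.fst c v = v₁ ∧
      D 𝓘(ℝ, PairModel EM EG) 𝓘(ℝ, EG) SourceTarget.Composable.snd c v = v₂ := by
  obtain ⟨ρ, -, -, hρ⟩ := K.exists_retraction_snd c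
  exact ⟨_, hρ v₁ v₂ h⟩

/-- The smoothness of a map to the tangent bundle of the composable arrows. -/
theorem contMDiffAt_vec_composable {b : P → K.Composable} {v : P → PairModel EM EG} {p : P}
    (h1 : ContMDiffAt IP 𝓘(ℝ, EG).tangent ∞ (fun q => vec 𝓘(ℝ, EG) (b q).fst
      (D 𝓘(ℝ, PairModel EM EG) 𝓘(ℝ, EG) SourceTarget.Composable.fst (b q) (v q))) p)
    (h2 : ContMDiffAt IP 𝓘(ℝ, EG).tangent ∞ (fun q => vec 𝓘(ℝ, EG) (b q).snd
      (D 𝓘(ℝ, PairModel EM EG) 𝓘(ℝ, EG) SourceTarget.Composable.snd (b q) (v q))) p) :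
    ContMDiffAt IP 𝓘(ℝ, PairModel EM EG).tangent ∞
      (fun q => vec 𝓘(ℝ, PairModel EM EG) (b q) (v q)) p := by
  obtain ⟨ρ, hρ, hρ'⟩ := K.exists_retraction (b p)
  have hb : ContMDiffAt IP 𝓘(ℝ, PairModel EM EG) ∞ b p :=
    contMDiffAt_composable.2 ⟨(contMDiffAt_vec_iff.1 h1).1, (contMDiffAt_vec_iff.1 h2).1⟩
  have h3 := contMDiffAt_vec_prod.2 ⟨h1, h2⟩
  simp only [← D_incl] at h3
  have h4 := ContMDiffAt.vec_tangentMap (b := fun q => K.incl (b q)) hρ h3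
  refine h4.congr_of_eventuallyEq ?_
  have h5 : ∀ᶠ d in 𝓝 (b p), ∀ᶠ d' in 𝓝 d, ρ (K.incl d') = d' := hρ'.eventually_nhds
  filter_upwards [hb.continuousAt.eventually h5, hb.continuousAt.eventually
    (K.contMDiff_incl.continuous.continuousAt.eventually (eventually_mdifferentiableAt hρ))]
    with q hq hq'
  rw [hq.self_of_nhds]
  refine congrArg (vec 𝓘(ℝ, PairModel EM EG) (b q)) ?_
  refine Eq.trans ?_ (D_comp_apply' hq'
    ((K.contMDiff_incl (b q)).mdifferentiableAt (by simp)) (v q))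
  have h6 : ρ ∘ K.incl =ᶠ[𝓝 (b q)] id := hq
  rw [D_congr h6, D_id]
  rfl

end LieGroupoid

section related

variable {E H E' H' EP HP : Type*}
  [NormedAddCommGroup E] [NormedSpace ℝ E] [TopologicalSpace H]
  [NormedAddCommGroup E'] [NormedSpace ℝ E'] [TopologicalSpace H']
  {I : ModelWithCorners ℝ E H} {J : ModelWithCorners ℝ E' H'}
  {M N : Type*} [TopologicalSpace M] [ChartedSpace H M] [TopologicalSpace N] [ChartedSpace H' N]
  [IsManifold I ∞ M] [IsManifold J ∞ N] [FiniteDimensional ℝ E] [FiniteDimensional ℝ E']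

/-- A map respecting two connections maps horizontal vectors to horizontal vectors. -/
theorem RelChr.tangentMap_lift [I.Boundaryless] {F : M → N} {γ : M → E → E → E}
    {γ' : N → E' → E' → E'} (h : RelChr I J F γ γ') {x : M} (hF : ContMDiffAt I J ∞ F x) (e w : E) :
    tangentMap I.tangent J.tangent (tangentMap I J F) (tt I x e w (-γ x e w)) =
      tt J (F x) (D I J F x e) (D I J F x w) (-γ' (F x) (D I J F x e) (D I J F x w)) := by
  rw [tangentMap_tt hF, map_neg, h, neg_add, add_neg_cancel_left]

/-- The vector dF(∇_Y X) is the vertical part, for the target connection, of the image of dX(Y)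
under the second tangent map of F. Only the target connection has to be smooth, so smoothness can be
obtained for connections that are constructed from their Christoffel symbols on G × G and G⁽²⁾. -/
theorem RelChr.contMDiff_app [T2Space M] [T2Space N] [I.Boundaryless] [J.Boundaryless]
    {F : M → N} (hF : ContMDiff I J ∞ F) {cov : Conn I M} {cov' : Conn J N}
    (h : RelChr I J F cov.Γ cov'.Γ) (hc : cov'.IsSmooth) {X Y : VField I M} (hX : X.IsSmooth)
    (hY : Y.IsSmooth) :
    ContMDiff I J.tangent ∞ fun x => vec J (F x) (D I J F x (cov.app X x (Y.val x))) := by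
  intro x
  have h1 := (contMDiff_tangentMap (contMDiff_tangentMap hF) _).comp x
    (hX.contMDiff_tangentMap hY x)
  have h2 : ContMDiffAt I J.tangent.tangent ∞ (fun x => tt J (F x) (D I J F x (X.val x))
      (D I J F x (Y.val x)) (hess I J F x (Y.val x) (X.val x) +
        D I J F x (X.deriv x (Y.val x)))) x :=
    h1.congr_of_eventuallyEq (.of_forall fun y => (tangentMap_tt (hF y) _ _ _).symm)
  refine (hc.contMDiffAt_vertical h2).congr_of_eventuallyEq (.of_forall fun y => ?_)
  dsimp only
  rw [cov.app_eq (hX y), map_add, h, vec_inj]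
  abel

/-! ### The geodesic spray -/

/-- The geodesic spray of a connection. -/
def Conn.spray (cov : Conn I M) : VField I.tangent (TangentBundle I M) :=
  fun p => ((fib p, -cov.Γ p.proj (fib p) (fib p)) : E × E)

theorem Conn.isGeodesicSpray_iff [T2Space M] [I.Boundaryless] {cov : Conn I M}
    {Z : VField I.tangent (TangentBundle I M)} : cov.IsGeodesicSpray Z ↔ Z = cov.spray := by
  constructor
  · intro h
    refine VField.ext_val (I := I.tangent) fun p => ?_
    obtain ⟨h1, h2⟩ := h p
    have h3 : (Z.val p).1 = fib p := (dproj_eq p (Z.val p)).symm.trans h2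
    have h4 : tt I p.proj (fib p) (Z.val p).1 (Z.val p).2 ∈ cov.horizontal := h1
    rw [cov.tt_mem_horizontal, h3] at h4
    exact Prod.ext h3 h4
  · rintro rfl p
    exact ⟨(cov.tt_mem_horizontal (x := p.proj) (e := fib p) (w := fib p)).2 rfl, dproj_eq p _⟩

theorem Conn.IsSmooth.spray [T2Space M] {cov : Conn I M} (h : cov.IsSmooth) :
    cov.spray.IsSmooth := fun p =>
  h.contMDiffAt_lift (b := fun p : TangentBundle I M => p.proj) (e := fib) (w := fib)
    (p := p) contMDiffAt_id contMDiffAt_id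

theorem RelChr.spray [I.Boundaryless] {F : M → N} (hF : ContMDiff I J ∞ F) {cov : Conn I M}
    {cov' : Conn J N} (h : RelChr I J F cov.Γ cov'.Γ) :
    cov.spray.Related (tangentMap I J F) cov'.spray := by
  intro p
  refine (D_tangentMap (hF p.proj) (fib p) (fib p) _).trans ?_
  rw [map_neg, h, neg_add, add_neg_cancel_left]
  rfl

/-! ### The vertical projection -/

/-- The vertical projection of a connection. -/
def Conn.vert (cov : Conn I M) (p : TangentBundle I M) : E × E →ₗ[ℝ] E × E :=
  (LinearMap.inr ℝ E E).comp
    (LinearMap.snd ℝ E E + (cov.chr p.proj (fib p)).toLinearMap.comp (LinearMap.fst ℝ E E))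

theorem Conn.vert_apply (cov : Conn I M) (p : TangentBundle I M) (ξ : E × E) :
    cov.vert p ξ = (0, ξ.2 + cov.Γ p.proj (fib p) ξ.1) := rfl

theorem Conn.vert_eq_self (cov : Conn I M) (p : TangentBundle I M) {ξ : E × E} (h : ξ.1 = 0) :
    cov.vert p ξ = ξ := by
  rw [cov.vert_apply, h]
  refine Prod.ext h.symm ?_
  change ξ.2 + cov.chr p.proj (fib p) 0 = _
  rw [map_zero, add_zero]

theorem Conn.vert_eq_zero_iff (cov : Conn I M) (p : TangentBundle I M) {ξ : E × E} :
    cov.vert p ξ = 0 ↔ ξ.2 = -cov.Γ p.proj (fib p) ξ.1 := by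
  rw [cov.vert_apply]
  constructor
  · exact fun h => eq_neg_of_add_eq_zero_left (congrArg Prod.snd h)
  · exact fun h => Prod.ext rfl (add_eq_zero_iff_eq_neg.2 h)

/-- The vertical projection, as a field of endomorphisms. -/
def Conn.vertField (cov : Conn I M) (p : TangentBundle I M) :
    TangentSpace I.tangent p →ₗ[ℝ] TangentSpace I.tangent p := cov.vert p

theorem Conn.isVerticalProjection_iff [T2Space M] [I.Boundaryless] {cov : Conn I M}
    {θ : (p : TangentBundle I M) → TangentSpace I.tangent p →ₗ[ℝ] TangentSpace I.tangent p} :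
    cov.IsVerticalProjection θ ↔ θ = cov.vertField := by
  constructor
  · intro h
    funext p
    obtain ⟨-, h2, h3⟩ := h p
    let L : E × E →ₗ[ℝ] E × E := θ p
    have h2' : ∀ η : E, L (0, η) = (0, η) := fun η => h2 _ (dproj_eq p (0, η))
    have h3' : ∀ w : E, L (w, -cov.Γ p.proj (fib p) w) = 0 := fun w =>
      (h3 _).2 ((cov.tt_mem_horizontal (x := p.proj) (e := fib p) (w := w)).2 rfl)
    refine LinearMap.ext fun ξ : E × E => ?_
    change L ξ = cov.vert p ξ
    -- The splitting into a horizontal and a vertical vector; the conditions on θ fix its value on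
    -- each of them.
    have h4 : ξ = (ξ.1, -cov.Γ p.proj (fib p) ξ.1) + (0, ξ.2 + cov.Γ p.proj (fib p) ξ.1) := by
      ext <;> simp
    conv_lhs => rw [h4]
    rw [map_add, h2', h3', zero_add, cov.vert_apply]
  · rintro rfl p
    refine ⟨fun ξ => dproj_eq p _, fun ξ hξ => ?_, fun ξ => ?_⟩
    · exact cov.vert_eq_self p ((dproj_eq p ξ).symm.trans hξ)
    · exact (cov.vert_eq_zero_iff p).trans (cov.tt_mem_horizontal (x := p.proj) (e := fib p)
        (w := (ξ : E × E).1) (η := (ξ : E × E).2)).symm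

theorem Conn.IsSmooth.contMDiffAt_vert [T2Space M] [I.Boundaryless]
    [NormedAddCommGroup EP] [NormedSpace ℝ EP] [TopologicalSpace HP]
    {IP : ModelWithCorners ℝ EP HP} {P : Type*} [TopologicalSpace P] [ChartedSpace HP P]
    {cov : Conn I M} (h : cov.IsSmooth) {b : P → TangentBundle I M} {ξ : P → E × E} {q : P}
    (hξ : ContMDiffAt IP I.tangent.tangent ∞ (fun p => vec I.tangent (b p) (ξ p)) q) :
    ContMDiffAt IP I.tangent.tangent ∞ (fun p => vec I.tangent (b p) (cov.vert (b p) (ξ p))) q := by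
  have hb : ContMDiffAt IP I.tangent ∞ b q := (contMDiffAt_vec_iff.1 hξ).1
  have h1 : ContMDiffAt IP I.tangent.tangent ∞
    (fun p => tt I (b p).proj (fib (b p)) (ξ p).1 (ξ p).2) q := hξ
  exact MultConn.contMDiffAt_vertical (b := fun p => (b p).proj) (e := fun p => fib (b p)) hb
    (h.contMDiffAt_vertical h1)

theorem Conn.IsSmooth.vert [T2Space M] [I.Boundaryless] {cov : Conn I M} (h : cov.IsSmooth) :
    (endoToTensor cov.vertField).IsSmooth := fun X hX p =>
  h.contMDiffAt_vert (b := id) (ξ := (X 0).val) (q := p) (hX 0 p)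

theorem RelChr.vert_apply [I.Boundaryless] {F : M → N} (hF : ContMDiff I J ∞ F) {cov : Conn I M}
    {cov' : Conn J N} (h : RelChr I J F cov.Γ cov'.Γ) (p : TangentBundle I M) (ξ : E × E) :
    D I.tangent J.tangent (tangentMap I J F) p (cov.vert p ξ) =
      cov'.vert (tangentMap I J F p) (D I.tangent J.tangent (tangentMap I J F) p ξ) := by
  have h1 := fun w η => D_tangentMap (hF p.proj) (fib p) w η
  rw [vec_proj_fib] at h1
  rw [cov.vert_apply, cov'.vert_apply, h1, h1 ξ.1 ξ.2, map_add, h, map_zero, map_zero]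
  refine Prod.ext rfl ?_
  change 0 + (D I J F p.proj ξ.2 + _) = hess I J F p.proj ξ.1 (fib p) + D I J F p.proj ξ.2 + _
  rw [zero_add, ← add_assoc, add_comm (D I J F p.proj ξ.2)]
  rfl

end related

/-! ### Relatedness of tensors of degree zero and one -/

section tensors

variable {E H E' H' E'' H'' : Type*}
  [NormedAddCommGroup E] [NormedSpace ℝ E] [TopologicalSpace H]
  [NormedAddCommGroup E'] [NormedSpace ℝ E'] [TopologicalSpace H']
  [NormedAddCommGroup E''] [NormedSpace ℝ E''] [TopologicalSpace H'']
  {I : ModelWithCorners ℝ E H} {J : ModelWithCorners ℝ E' H'} {K : ModelWithCorners ℝ E'' H''}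
  {M N Q : Type*} [TopologicalSpace M] [ChartedSpace H M] [TopologicalSpace N] [ChartedSpace H' N]
  [TopologicalSpace Q] [ChartedSpace H'' Q]

theorem Tensor.Related.comp {p : ℕ} {F : M → N} {F' : N → Q} (hF : ContMDiff I J ∞ F)
    (hF' : ContMDiff J K ∞ F') {τ : Tensor I p M} {τ' : Tensor J p N} {τ'' : Tensor K p Q}
    (h : τ.Related F τ') (h' : τ'.Related F' τ'') : τ.Related (F' ∘ F) τ'' := by
  intro x v
  have h1 : ∀ w : E, D I K (F' ∘ F) x w = D J K F' (F x) (D I J F x w) :=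
    fun w => D_comp_apply (hF' _) (hF x) w
  refine (h1 _).trans ?_
  have h2 : D I J F x (τ x v) = τ' (F x) (fun i => D I J F x (v i)) := h x v
  rw [h2]
  refine (h' _ _).trans ?_
  exact congrArg (τ'' (F' (F x))) (funext fun i => (h1 (v i)).symm)

theorem toTensor_related_iff {F : M → N} {X : VField I M} {τ : Tensor J 0 N} :
    X.toTensor.Related F τ ↔ X.Related F fun y => τ y ![] := by
  constructor
  · intro h x
    exact (h x ![]).trans (congrArg (τ (F x)) (Subsingleton.elim _ _))
  · intro h x v
    exact (h x).trans (congrArg (τ (F x)) (Subsingleton.elim _ _))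

theorem tensor_related_one_iff {F : M → N} {τ : Tensor I 1 M} {τ' : Tensor J 1 N} :
    τ.Related F τ' ↔
      ∀ (x : M) (v : E), D I J F x (τ x ![v]) = τ' (F x) ![D I J F x v] := by
  constructor
  · intro h x v
    refine (h x ![v]).trans (congrArg (τ' (F x)) ?_)
    funext i
    fin_cases i
    rfl
  · intro h x v
    have h1 : v = ![v 0] := by
      funext i
      fin_cases i
      rfl
    rw [h1]
    refine (h x (v 0)).trans (congrArg (τ' (F x)) ?_)
    funext i
    fin_cases i
    rfl

end tensors

/-! ### Sprays as quadratic maps, and their polarization -/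

section quadratic

variable {E H E' H' : Type*}
  [NormedAddCommGroup E] [NormedSpace ℝ E] [TopologicalSpace H]
  [NormedAddCommGroup E'] [NormedSpace ℝ E'] [TopologicalSpace H']
  {I : ModelWithCorners ℝ E H} {J : ModelWithCorners ℝ E' H'}
  {M N : Type*} [TopologicalSpace M] [ChartedSpace H M] [TopologicalSpace N] [ChartedSpace H' N]
  [IsManifold I ∞ M] [IsManifold J ∞ N]

variable (I J) in
/-- The transformation law of the quadratic maps that define sprays. -/
def RelQuad (F : M → N) (q : M → E → E) (q' : N → E' → E') : Prop :=
  ∀ x e, D I J F x (q x e) = hess I J F x e e + q' (F x) (D I J F x e)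

/-- The polarization of a quadratic map. -/
def polarize {V W X : Type*} [AddCommGroup V] [AddCommGroup W] [Module ℝ W] (q : X → V → W)
    (x : X) (e w : V) : W :=
  (1 / 2 : ℝ) • (q x (e + w) - q x e - q x w)

/-- The law is applied to e + w, e and w. Since the Hessian is symmetric and bilinear, its
polarization is the Hessian again. Homogeneity of `q` and `q'` is not needed. -/
theorem RelQuad.polarize [I.Boundaryless] [J.Boundaryless] {F : M → N} (hF : ContMDiff I J ∞ F)
    {q : M → E → E} {q' : N → E' → E'} (h : RelQuad I J F q q') :
    RelChr I J F (polarize q) (polarize q') := by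
  intro x e w
  simp only [MultConn.polarize, map_smul, map_sub]
  rw [h, h, h]
  simp only [map_add, add_apply]
  rw [hess_symm (hF x) e w]
  module

theorem RelTensor.half_flip {F : M → N} {τ : M → E → E → E} {τ' : N → E' → E' → E'}
    (h : RelTensor I J F τ τ') :
    RelTensor I J F (fun x e w => (1 / 2 : ℝ) • τ x w e) fun x e w => (1 / 2 : ℝ) • τ' x w e := by
  intro x e w
  rw [map_smul, h]

variable [FiniteDimensional ℝ E] [FiniteDimensional ℝ E'] [T2Space M] [T2Space N]
  [I.Boundaryless] [J.Boundaryless]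

/-- The field `Z` is not known to be the spray of a connection. The sign-reversed vertical component
of `Z` serves as the quadratic map on the target, and the law is the vertical component of
relatedness. -/
theorem relQuad_of_related {F : M → N} (hF : ContMDiff I J ∞ F) {cov : Conn I M}
    {Z : VField J.tangent (TangentBundle J N)} (h : cov.spray.Related (tangentMap I J F) Z) :
    RelQuad I J F (fun x e => cov.Γ x e e) fun y a => -(Z.val (vec J y a)).2 := by
  intro x e
  have h1 := D_tangentMap (hF x) e e (-cov.Γ x e e)
  have h2 : D I.tangent J.tangent (tangentMap I J F) (vec I x e) (e, -cov.Γ x e e) =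
    Z.val (vec J (F x) (D I J F x e)) := h (vec I x e)
  have h3 := congrArg Prod.snd (h1.symm.trans h2)
  change D I J F x (cov.Γ x e e) = hess I J F x e e + -(Z.val (vec J (F x) (D I J F x e))).2
  rw [← h3]
  simp

theorem polarize_Γ (cov : Conn I M) :
    polarize (fun x e => cov.Γ x e e) = cov.symPart.Γ := by
  funext x e w
  rw [cov.Γ_symPart]
  simp only [polarize, Conn.Γ, map_add, add_apply]
  congr 1
  abel

/-- The arguments of the torsion are swapped because `Γ` takes the value of the field before the
direction. -/
theorem Γ_eq_symPart_add (cov : Conn I M) :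
    cov.Γ = cov.symPart.Γ + fun x e w => (1 / 2 : ℝ) • cov.tor x w e := by
  funext x e w
  simp only [Pi.add_apply, cov.Γ_symPart, cov.tor_eq]
  module

end quadratic

/-! ### Compatibility of Christoffel symbols with the structure maps, deduced from conditions 1, 2,
4 and 5 -/

namespace LieGroupoid

variable {EM EG M G : Type*}
  [NormedAddCommGroup EM] [NormedSpace ℝ EM] [FiniteDimensional ℝ EM]
  [NormedAddCommGroup EG] [NormedSpace ℝ EG] [FiniteDimensional ℝ EG]
  [TopologicalSpace M] [ChartedSpace EM M] [IsManifold 𝓘(ℝ, EM) ∞ M]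
  [TopologicalSpace G] [ChartedSpace EG G] [IsManifold 𝓘(ℝ, EG) ∞ G]
  (K : LieGroupoid EM EG M G)

/-- The Christoffel symbols of a connection in `TG` are compatible with all structure maps. -/
def IsMulChr (γ : G → EG → EG → EG) : Prop :=
  ∃ (γM : M → EM → EM → EM)
    (γC : K.Composable → PairModel EM EG → PairModel EM EG → PairModel EM EG),
    RelChr 𝓘(ℝ, EG) 𝓘(ℝ, EM) K.src γ γM ∧ RelChr 𝓘(ℝ, EG) 𝓘(ℝ, EM) K.tgt γ γM ∧
    RelChr 𝓘(ℝ, PairModel EM EG) 𝓘(ℝ, EG) SourceTarget.Composable.fst γC γ ∧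
    RelChr 𝓘(ℝ, PairModel EM EG) 𝓘(ℝ, EG) SourceTarget.Composable.snd γC γ ∧
    RelChr 𝓘(ℝ, PairModel EM EG) 𝓘(ℝ, EG) K.mul γC γ

/-- The bilinear maps `τ` are compatible with all structure maps. -/
def IsMulTensor (τ : G → EG → EG → EG) : Prop :=
  ∃ (τM : M → EM → EM → EM)
    (τC : K.Composable → PairModel EM EG → PairModel EM EG → PairModel EM EG),
    RelTensor 𝓘(ℝ, EG) 𝓘(ℝ, EM) K.src τ τM ∧ RelTensor 𝓘(ℝ, EG) 𝓘(ℝ, EM) K.tgt τ τM ∧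
    RelTensor 𝓘(ℝ, PairModel EM EG) 𝓘(ℝ, EG) SourceTarget.Composable.fst τC τ ∧
    RelTensor 𝓘(ℝ, PairModel EM EG) 𝓘(ℝ, EG) SourceTarget.Composable.snd τC τ ∧
    RelTensor 𝓘(ℝ, PairModel EM EG) 𝓘(ℝ, EG) K.mul τC τ

/-- The quadratic maps `q` are compatible with all structure maps. -/
def IsMulQuad (q : G → EG → EG) : Prop :=
  ∃ (qM : M → EM → EM) (qC : K.Composable → PairModel EM EG → PairModel EM EG),
    RelQuad 𝓘(ℝ, EG) 𝓘(ℝ, EM) K.src q qM ∧ RelQuad 𝓘(ℝ, EG) 𝓘(ℝ, EM) K.tgt q qM ∧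
    RelQuad 𝓘(ℝ, PairModel EM EG) 𝓘(ℝ, EG) SourceTarget.Composable.fst qC q ∧
    RelQuad 𝓘(ℝ, PairModel EM EG) 𝓘(ℝ, EG) SourceTarget.Composable.snd qC q ∧
    RelQuad 𝓘(ℝ, PairModel EM EG) 𝓘(ℝ, EG) K.mul qC q

variable {K}

theorem IsMulChr.add {γ τ : G → EG → EG → EG} (h : K.IsMulChr γ) (hτ : K.IsMulTensor τ) :
    K.IsMulChr (γ + τ) := by
  obtain ⟨γM, γC, h1, h2, h3, h4, h5⟩ := h
  obtain ⟨τM, τC, k1, k2, k3, k4, k5⟩ := hτ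
  exact ⟨γM + τM, γC + τC, h1.add k1, h2.add k2, h3.add k3, h4.add k4, h5.add k5⟩

theorem IsMulTensor.half_flip {τ : G → EG → EG → EG} (h : K.IsMulTensor τ) :
    K.IsMulTensor fun x e w => (1 / 2 : ℝ) • τ x w e := by
  obtain ⟨τM, τC, k1, k2, k3, k4, k5⟩ := h
  exact ⟨_, _, k1.half_flip, k2.half_flip, k3.half_flip, k4.half_flip, k5.half_flip⟩

theorem IsMulQuad.polarize {q : G → EG → EG} (h : K.IsMulQuad q) :
    K.IsMulChr (MultConn.polarize q) := by
  obtain ⟨qM, qC, h1, h2, h3, h4, h5⟩ := h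
  exact ⟨_, _, h1.polarize K.contMDiff_src, h2.polarize K.contMDiff_tgt,
    h3.polarize K.contMDiff_composable_fst, h4.polarize K.contMDiff_composable_snd,
    h5.polarize K.contMDiff_mul⟩

variable [T2Space G]

theorem IsMulChr.symPart {cov : Conn 𝓘(ℝ, EG) G} (h : K.IsMulChr cov.Γ) :
    K.IsMulChr cov.symPart.Γ := by
  obtain ⟨γM, γC, h1, h2, h3, h4, h5⟩ := h
  have h0 : cov.symPart.Γ = fun x e w => (1 / 2 : ℝ) • (cov.Γ x e w + cov.Γ x w e) := by
    funext x e w; exact cov.Γ_symPart x e w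
  rw [h0]
  exact ⟨_, _, h1.symm_part K.contMDiff_src, h2.symm_part K.contMDiff_tgt,
    h3.symm_part K.contMDiff_composable_fst, h4.symm_part K.contMDiff_composable_snd,
    h5.symm_part K.contMDiff_mul⟩

theorem isMulChr_of_symPart {cov : Conn 𝓘(ℝ, EG) G} (h : K.IsMulChr cov.symPart.Γ)
    (h' : K.IsMulTensor fun x e w => cov.tor x e w) : K.IsMulChr cov.Γ := by
  rw [Γ_eq_symPart_add cov]
  exact h.add h'.half_flip

variable (K) in
-- The common projection of the two components of `e` to M is extended to a field on M. Its lifts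
-- through s and through t, with prescribed values, form a product field that is tangent to G⁽²⁾ at
-- every composable pair, and its restriction extends `e`.
theorem hasRelatedFields_incl [T2Space M] [SigmaCompactSpace G] :
    HasRelatedFields 𝓘(ℝ, PairModel EM EG) (𝓘(ℝ, EG).prod 𝓘(ℝ, EG)) K.incl := by
  intro c e
  obtain ⟨Z, hZ, hZ1, -⟩ := exists_vField_jet (I := 𝓘(ℝ, EM)) (K.src c.fst)
    (D 𝓘(ℝ, EG) 𝓘(ℝ, EM) K.src c.fst
      (D 𝓘(ℝ, PairModel EM EG) 𝓘(ℝ, EG) SourceTarget.Composable.fst c e)) 0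
  obtain ⟨X₁, hX₁, h1, h1'⟩ := exists_lift K.contMDiff_src K.surjective_D_src hZ hZ1.symm
  obtain ⟨X₂, hX₂, h2, h2'⟩ := exists_lift K.contMDiff_tgt K.surjective_D_tgt hZ
    ((K.D_src_fst c e).symm.trans (hZ1.symm.trans (by rw [c.src_fst])))
  have h12 : ∀ d : K.Composable, D 𝓘(ℝ, EG) 𝓘(ℝ, EM) K.src d.fst (X₁.val d.fst) =
      D 𝓘(ℝ, EG) 𝓘(ℝ, EM) K.tgt d.snd (X₂.val d.snd) := fun d =>
    (h1 d.fst).trans ((congrArg Z.val d.src_fst).trans (h2 d.snd).symm)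
  choose X hXf hXs using fun d : K.Composable => K.exists_D_composable d (h12 d)
  refine ⟨X, X₁.prod X₂, fun d => K.contMDiffAt_vec_composable (b := id) (v := X) ?_ ?_,
    hX₁.prod hX₂, fun d => ?_, K.D_composable_inj ((hXf c).trans h1') ((hXs c).trans h2')⟩
  · refine ((hX₁ d.fst).comp d (K.contMDiff_composable_fst d)).congr_of_eventuallyEq
      (.of_forall fun q => ?_)
    exact congrArg (vec 𝓘(ℝ, EG) q.fst) (hXf q)
  · refine ((hX₂ d.snd).comp d (K.contMDiff_composable_snd d)).congr_of_eventuallyEq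
      (.of_forall fun q => ?_)
    exact congrArg (vec 𝓘(ℝ, EG) q.snd) (hXs q)
  · refine (K.D_incl d (X d)).trans ?_
    rw [hXf, hXs]
    rfl

theorem isMulChr_of_isMultiplicative [T2Space M] [SecondCountableTopology G]
    {cov : Conn 𝓘(ℝ, EG) G}
    (h : cov.IsMultiplicative 𝓘(ℝ, EM) 𝓘(ℝ, EG) 𝓘(ℝ, PairModel EM EG) K.maps) :
    K.IsMulChr cov.Γ := by
  -- Local compactness together with second countability makes G and G⁽²⁾ σ-compact, as the
  -- partitions of unity behind the lifts require.
  have : LocallyCompactSpace G := ChartedSpace.locallyCompactSpace EG G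
  have : LocallyCompactSpace K.Composable :=
    ChartedSpace.locallyCompactSpace (PairModel EM EG) K.Composable
  obtain ⟨-, ⟨covM, -, hs, ht⟩, cov2, covC, -, h1, h2, -, hi, hm⟩ := h
  have hi' := hi.relChr K.contMDiff_incl K.hasRelatedFields_incl
  refine ⟨covM.Γ, covC.Γ, hs.relChr K.contMDiff_src (.of_surjective K.contMDiff_src
    K.surjective_D_src), ht.relChr K.contMDiff_tgt (.of_surjective K.contMDiff_tgt
    K.surjective_D_tgt), ?_, ?_, hm.relChr K.contMDiff_mul (.of_surjective K.contMDiff_mul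
    K.surjective_D_mul)⟩
  · exact hi'.comp K.contMDiff_incl contMDiff_fst (h1.relChr contMDiff_fst .fst)
  · exact hi'.comp K.contMDiff_incl contMDiff_snd (h2.relChr contMDiff_snd .snd)

theorem tensor_incl_related {p : ℕ} {τ : Tensor 𝓘(ℝ, EG) p G}
    {τ2 : Tensor (𝓘(ℝ, EG).prod 𝓘(ℝ, EG)) p (G × G)}
    {τC : Tensor 𝓘(ℝ, PairModel EM EG) p K.Composable}
    (h1 : τ2.Related Prod.fst τ) (h2 : τ2.Related Prod.snd τ) (hi : τC.Related K.incl τ2) :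
    τC.Related SourceTarget.Composable.fst τ ∧ τC.Related SourceTarget.Composable.snd τ :=
  ⟨Tensor.Related.comp (I := 𝓘(ℝ, PairModel EM EG)) (J := 𝓘(ℝ, EG).prod 𝓘(ℝ, EG))
      (K := 𝓘(ℝ, EG)) K.contMDiff_incl contMDiff_fst hi h1,
    Tensor.Related.comp (I := 𝓘(ℝ, PairModel EM EG)) (J := 𝓘(ℝ, EG).prod 𝓘(ℝ, EG))
      (K := 𝓘(ℝ, EG)) K.contMDiff_incl contMDiff_snd hi h2⟩

theorem tensor_related_two {E H E' H' N Q : Type*} [NormedAddCommGroup E]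
    [NormedSpace ℝ E] [TopologicalSpace H] [NormedAddCommGroup E'] [NormedSpace ℝ E']
    [TopologicalSpace H'] {I : ModelWithCorners ℝ E H} {J : ModelWithCorners ℝ E' H'}
    [TopologicalSpace N] [ChartedSpace H N] [TopologicalSpace Q] [ChartedSpace H' Q]
    {F : N → Q} {τ : Tensor I 2 N} {τ' : Tensor J 2 Q} (h : τ.Related F τ') :
    RelTensor I J F (fun x e w => (τ x ![e, w] : E)) fun x e w => (τ' x ![e, w] : E') := by
  intro x e w
  refine (h x ![e, w]).trans (congrArg (τ' (F x)) ?_)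
  funext i
  fin_cases i <;> rfl

theorem isMulTensor_of_isMultiplicative {cov : Conn 𝓘(ℝ, EG) G}
    (h : cov.torsionTensor.IsMultiplicative 𝓘(ℝ, EM) 𝓘(ℝ, EG) 𝓘(ℝ, PairModel EM EG) K.maps) :
    K.IsMulTensor fun x e w => cov.tor x e w := by
  obtain ⟨-, ⟨τM, -, hs, ht⟩, τ2, τC, -, h1, h2, -, hi, hm⟩ := h
  obtain ⟨hf, hg⟩ := tensor_incl_related h1 h2 hi
  exact ⟨_, _, tensor_related_two hs, tensor_related_two ht, tensor_related_two hf,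
    tensor_related_two hg, tensor_related_two hm⟩

variable (K) in
theorem contMDiff_tangent_incl :
    ContMDiff 𝓘(ℝ, PairModel EM EG).tangent (𝓘(ℝ, EG).tangent.prod 𝓘(ℝ, EG).tangent) ∞
      K.tangentMaps.incl :=
  (contMDiff_tangentMap K.contMDiff_composable_fst).prodMk
    (contMDiff_tangentMap K.contMDiff_composable_snd)

theorem tensor_tangent_incl_related {p : ℕ} {τ : Tensor 𝓘(ℝ, EG).tangent p (TangentBundle 𝓘(ℝ, EG) G)}
    {τ2 : Tensor (𝓘(ℝ, EG).tangent.prod 𝓘(ℝ, EG).tangent) p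
      (TangentBundle 𝓘(ℝ, EG) G × TangentBundle 𝓘(ℝ, EG) G)}
    {τC : Tensor 𝓘(ℝ, PairModel EM EG).tangent p (TangentBundle 𝓘(ℝ, PairModel EM EG) K.Composable)}
    (h1 : τ2.Related Prod.fst τ) (h2 : τ2.Related Prod.snd τ)
    (hi : τC.Related K.tangentMaps.incl τ2) :
    τC.Related K.tangentMaps.fst τ ∧ τC.Related K.tangentMaps.snd τ :=
  ⟨Tensor.Related.comp (I := 𝓘(ℝ, PairModel EM EG).tangent)
      (J := 𝓘(ℝ, EG).tangent.prod 𝓘(ℝ, EG).tangent) (K := 𝓘(ℝ, EG).tangent)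
      K.contMDiff_tangent_incl contMDiff_fst hi h1,
    Tensor.Related.comp (I := 𝓘(ℝ, PairModel EM EG).tangent)
      (J := 𝓘(ℝ, EG).tangent.prod 𝓘(ℝ, EG).tangent) (K := 𝓘(ℝ, EG).tangent)
      K.contMDiff_tangent_incl contMDiff_snd hi h2⟩

variable (K) in
theorem D_tangent_fst (c : K.Composable) (e w η : PairModel EM EG) :
    D 𝓘(ℝ, PairModel EM EG).tangent 𝓘(ℝ, EG).tangent K.tangentMaps.fst
      (vec 𝓘(ℝ, PairModel EM EG) c e) (w, η) =
    (D 𝓘(ℝ, PairModel EM EG) 𝓘(ℝ, EG) SourceTarget.Composable.fst c w,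
      hess 𝓘(ℝ, PairModel EM EG) 𝓘(ℝ, EG) SourceTarget.Composable.fst c w e +
        D 𝓘(ℝ, PairModel EM EG) 𝓘(ℝ, EG) SourceTarget.Composable.fst c η) :=
  D_tangentMap (K.contMDiff_composable_fst c) e w η

variable (K) in
theorem D_tangent_snd (c : K.Composable) (e w η : PairModel EM EG) :
    D 𝓘(ℝ, PairModel EM EG).tangent 𝓘(ℝ, EG).tangent K.tangentMaps.snd
      (vec 𝓘(ℝ, PairModel EM EG) c e) (w, η) =
    (D 𝓘(ℝ, PairModel EM EG) 𝓘(ℝ, EG) SourceTarget.Composable.snd c w,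
      hess 𝓘(ℝ, PairModel EM EG) 𝓘(ℝ, EG) SourceTarget.Composable.snd c w e +
        D 𝓘(ℝ, PairModel EM EG) 𝓘(ℝ, EG) SourceTarget.Composable.snd c η) :=
  D_tangentMap (K.contMDiff_composable_snd c) e w η

/-- The field on T(G⁽²⁾) is an arbitrary witness, not assumed to be of second order. Both of its
images are sprays, so `D_composable_inj` forces its horizontal component at `e` to be `e`;
afterwards its vertical component satisfies the quadratic law. -/
theorem isMulQuad_of_spray {cov : Conn 𝓘(ℝ, EG) G} [T2Space M]
    (h : cov.spray.toTensor.IsMultiplicative 𝓘(ℝ, EM).tangent 𝓘(ℝ, EG).tangent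
      𝓘(ℝ, PairModel EM EG).tangent K.tangentMaps) :
    K.IsMulQuad fun x e => cov.Γ x e e := by
  obtain ⟨-, ⟨τM, -, hs, ht⟩, τ2, τC, -, h1, h2, -, hi, hm⟩ := h
  obtain ⟨hf, hg⟩ := tensor_tangent_incl_related h1 h2 hi
  let ZC : VField 𝓘(ℝ, PairModel EM EG).tangent (TangentBundle 𝓘(ℝ, PairModel EM EG) K.Composable) :=
    fun p => τC p ![]
  have key : ∀ {F : TangentBundle 𝓘(ℝ, PairModel EM EG) K.Composable → TangentBundle 𝓘(ℝ, EG) G},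
      τC.Related F cov.spray.toTensor → ZC.Related F cov.spray := fun h p => by
    refine (h p ![]).trans ?_
    rfl
  have hf' := key hf
  have hg' := key hg
  have hm' := key hm
  have hZ : ∀ c e, (ZC.val (vec 𝓘(ℝ, PairModel EM EG) c e)).1 = e := by
    intro c e
    have e1 := (K.D_tangent_fst c e _ _).symm.trans (hf' (vec 𝓘(ℝ, PairModel EM EG) c e))
    have e2 := (K.D_tangent_snd c e _ _).symm.trans (hg' (vec 𝓘(ℝ, PairModel EM EG) c e))
    exact K.D_composable_inj (congrArg Prod.fst e1) (congrArg Prod.fst e2)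
  have hq : ∀ {F : K.Composable → G}, ContMDiff 𝓘(ℝ, PairModel EM EG) 𝓘(ℝ, EG) ∞ F →
      ZC.Related (tangentMap 𝓘(ℝ, PairModel EM EG) 𝓘(ℝ, EG) F) cov.spray →
      RelQuad 𝓘(ℝ, PairModel EM EG) 𝓘(ℝ, EG) F
        (fun c e => -(ZC.val (vec 𝓘(ℝ, PairModel EM EG) c e)).2) fun x e => cov.Γ x e e := by
    intro F hF h c e
    have e1 := (D_tangentMap (hF c) e _ _).symm.trans (h (vec 𝓘(ℝ, PairModel EM EG) c e))
    have e2 : hess 𝓘(ℝ, PairModel EM EG) 𝓘(ℝ, EG) F c (ZC.val (vec _ c e)).1 e +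
      D 𝓘(ℝ, PairModel EM EG) 𝓘(ℝ, EG) F c (ZC.val (vec _ c e)).2 =
      -cov.Γ (F c) (D 𝓘(ℝ, PairModel EM EG) 𝓘(ℝ, EG) F c e)
        (D 𝓘(ℝ, PairModel EM EG) 𝓘(ℝ, EG) F c e) := congrArg Prod.snd e1
    rw [hZ] at e2
    change D 𝓘(ℝ, PairModel EM EG) 𝓘(ℝ, EG) F c (-(ZC.val (vec _ c e)).2) =
      hess 𝓘(ℝ, PairModel EM EG) 𝓘(ℝ, EG) F c e e +
        cov.Γ (F c) (D 𝓘(ℝ, PairModel EM EG) 𝓘(ℝ, EG) F c e)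
          (D 𝓘(ℝ, PairModel EM EG) 𝓘(ℝ, EG) F c e)
    rw [map_neg, neg_eq_iff_add_eq_zero]
    rw [eq_neg_iff_add_eq_zero] at e2
    rw [← e2]
    abel
  exact ⟨_, _, relQuad_of_related K.contMDiff_src (toTensor_related_iff.1 hs),
    relQuad_of_related K.contMDiff_tgt (toTensor_related_iff.1 ht),
    hq K.contMDiff_composable_fst hf', hq K.contMDiff_composable_snd hg', hq K.contMDiff_mul hm'⟩

/-- The symbols on M and on G⁽²⁾ are read off as the vertical component of the witnessing tensors at
the vector (b, 0). Those tensors are not assumed to be vertical projections. -/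
theorem isMulChr_of_vert {cov : Conn 𝓘(ℝ, EG) G} [T2Space M]
    (h : (endoToTensor cov.vertField).IsMultiplicative 𝓘(ℝ, EM).tangent 𝓘(ℝ, EG).tangent
      𝓘(ℝ, PairModel EM EG).tangent K.tangentMaps) : K.IsMulChr cov.Γ := by
  obtain ⟨-, ⟨τM, -, hs, ht⟩, τ2, τC, -, h1, h2, -, hi, hm⟩ := h
  obtain ⟨hf, hg⟩ := tensor_tangent_incl_related h1 h2 hi
  let θM : TangentBundle 𝓘(ℝ, EM) M → EM × EM → EM × EM := fun p ξ => τM p ![ξ]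
  let θC : TangentBundle 𝓘(ℝ, PairModel EM EG) K.Composable →
    PairModel EM EG × PairModel EM EG → PairModel EM EG × PairModel EM EG := fun p ξ => τC p ![ξ]
  refine ⟨fun y a b => (θM (vec 𝓘(ℝ, EM) y a) (b, 0)).2,
    fun c a b => (θC (vec 𝓘(ℝ, PairModel EM EG) c a) (b, 0)).2, ?_⟩
  have key : ∀ {F : G → M}, ContMDiff 𝓘(ℝ, EG) 𝓘(ℝ, EM) ∞ F →
      (∀ x, Function.Surjective (D 𝓘(ℝ, EG) 𝓘(ℝ, EM) F x)) →
      (endoToTensor cov.vertField).Related (tangentMap 𝓘(ℝ, EG) 𝓘(ℝ, EM) F) τM →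
      RelChr 𝓘(ℝ, EG) 𝓘(ℝ, EM) F cov.Γ fun y a b => (θM (vec 𝓘(ℝ, EM) y a) (b, 0)).2 := by
    intro F hF hsur h x e w
    -- This `η` cancels the Hessian, so that (w, η) is mapped to a vector with vertical component
    -- zero, at which the symbol on M was defined.
    obtain ⟨η, hη⟩ := hsur x (-hess 𝓘(ℝ, EG) 𝓘(ℝ, EM) F x w e)
    have e1 : D 𝓘(ℝ, EG).tangent 𝓘(ℝ, EM).tangent (tangentMap 𝓘(ℝ, EG) 𝓘(ℝ, EM) F)
        (vec 𝓘(ℝ, EG) x e) (0, η + cov.Γ x e w) = θM (vec 𝓘(ℝ, EM) (F x) (D 𝓘(ℝ, EG) 𝓘(ℝ, EM) F x e))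
        (D 𝓘(ℝ, EG).tangent 𝓘(ℝ, EM).tangent (tangentMap 𝓘(ℝ, EG) 𝓘(ℝ, EM) F)
          (vec 𝓘(ℝ, EG) x e) (w, η)) :=
      tensor_related_one_iff.1 h (vec 𝓘(ℝ, EG) x e) ((w, η) : EG × EG)
    rw [D_tangentMap (hF x), D_tangentMap (hF x), hη, add_neg_cancel, map_add, hη] at e1
    have e2 := congrArg Prod.snd e1
    dsimp only at e2 ⊢
    rw [← e2]
    simp
  have hθ : ∀ {F : K.Composable → G}, ContMDiff 𝓘(ℝ, PairModel EM EG) 𝓘(ℝ, EG) ∞ F →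
      τC.Related (tangentMap 𝓘(ℝ, PairModel EM EG) 𝓘(ℝ, EG) F) (endoToTensor cov.vertField) →
      ∀ c e w, D 𝓘(ℝ, PairModel EM EG) 𝓘(ℝ, EG) F c
          (θC (vec 𝓘(ℝ, PairModel EM EG) c e) (w, 0)).1 = 0 ∧
        hess 𝓘(ℝ, PairModel EM EG) 𝓘(ℝ, EG) F c (θC (vec 𝓘(ℝ, PairModel EM EG) c e) (w, 0)).1 e +
        D 𝓘(ℝ, PairModel EM EG) 𝓘(ℝ, EG) F c (θC (vec 𝓘(ℝ, PairModel EM EG) c e) (w, 0)).2 =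
        hess 𝓘(ℝ, PairModel EM EG) 𝓘(ℝ, EG) F c w e +
          cov.Γ (F c) (D 𝓘(ℝ, PairModel EM EG) 𝓘(ℝ, EG) F c e)
            (D 𝓘(ℝ, PairModel EM EG) 𝓘(ℝ, EG) F c w) := by
    intro F hF h c e w
    have e1 : D 𝓘(ℝ, PairModel EM EG).tangent 𝓘(ℝ, EG).tangent
        (tangentMap 𝓘(ℝ, PairModel EM EG) 𝓘(ℝ, EG) F) (vec 𝓘(ℝ, PairModel EM EG) c e)
        (θC (vec 𝓘(ℝ, PairModel EM EG) c e) (w, 0)) =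
        cov.vert (vec 𝓘(ℝ, EG) (F c) (D 𝓘(ℝ, PairModel EM EG) 𝓘(ℝ, EG) F c e))
          (D 𝓘(ℝ, PairModel EM EG).tangent 𝓘(ℝ, EG).tangent
            (tangentMap 𝓘(ℝ, PairModel EM EG) 𝓘(ℝ, EG) F) (vec 𝓘(ℝ, PairModel EM EG) c e) (w, 0)) :=
      tensor_related_one_iff.1 h (vec 𝓘(ℝ, PairModel EM EG) c e) (((w, 0) : PairModel EM EG × PairModel EM EG))
    rw [D_tangentMap (hF c), cov.vert_apply,
      ← Prod.mk.eta (p := θC (vec 𝓘(ℝ, PairModel EM EG) c e) (w, 0)), D_tangentMap (hF c)] at e1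
    simp only [map_zero, add_zero] at e1
    exact ⟨congrArg Prod.fst e1, congrArg Prod.snd e1⟩
  -- The images under both projections are vertical, hence the tensor on T(G⁽²⁾) takes vertical
  -- values on these vectors, and its Hessian contribution vanishes in all three laws.
  have h0 : ∀ c e w, (θC (vec 𝓘(ℝ, PairModel EM EG) c e) (w, 0)).1 = 0 := fun c e w =>
    K.D_composable_inj (by rw [(hθ K.contMDiff_composable_fst hf c e w).1, map_zero])
      (by rw [(hθ K.contMDiff_composable_snd hg c e w).1, map_zero])
  refine ⟨key K.contMDiff_src K.surjective_D_src hs, key K.contMDiff_tgt K.surjective_D_tgt ht,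
    fun c e w => ?_, fun c e w => ?_, fun c e w => ?_⟩
  · have := (hθ K.contMDiff_composable_fst hf c e w).2
    rw [h0] at this
    simpa using this
  · have := (hθ K.contMDiff_composable_snd hg c e w).2
    rw [h0] at this
    simpa using this
  · have := (hθ K.contMDiff_mul hm c e w).2
    rw [h0] at this
    simpa using this

end LieGroupoid

/-! ### Connections with prescribed Christoffel symbols -/

section connections

variable {E H E' H' : Type*}
  [NormedAddCommGroup E] [NormedSpace ℝ E] [TopologicalSpace H]
  [NormedAddCommGroup E'] [NormedSpace ℝ E'] [TopologicalSpace H']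
  {I : ModelWithCorners ℝ E H} {J : ModelWithCorners ℝ E' H'}
  {M N : Type*} [TopologicalSpace M] [ChartedSpace H M] [TopologicalSpace N] [ChartedSpace H' N]
  [IsManifold I ∞ M] [IsManifold J ∞ N] [FiniteDimensional ℝ E] [FiniteDimensional ℝ E']

theorem Conn.isBilinearMap (cov : Conn I M) (x : M) : IsBilinearMap ℝ (cov.Γ x) where
  add_left _ _ _ := by simp [Conn.Γ]
  smul_left _ _ _ := by simp [Conn.Γ]
  add_right _ _ _ := by simp [Conn.Γ]
  smul_right _ _ _ := by simp [Conn.Γ]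

/-- A connection with given Christoffel symbols. -/
theorem exists_conn [T2Space M] [I.Boundaryless] {γ : M → E → E → E}
    (h : ∀ x, IsBilinearMap ℝ (γ x)) : ∃ cov : Conn I M, cov.Γ = γ := by
  refine ⟨Conn.ofChr fun x => (h x).toContinuousBilinearMap, ?_⟩
  funext x e w
  rw [Conn.Γ, Conn.chr_ofChr]
  rfl

/-- The bilinearity of the left-hand side of a transformation law. -/
theorem RelChr.isBilinearMap {F : M → N} {γ : M → E → E → E} {γ' : N → E' → E' → E'}
    (h : RelChr I J F γ γ') {x : M} (hγ : IsBilinearMap ℝ (γ x))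
    (hs : Function.Surjective (D I J F x)) : IsBilinearMap ℝ (γ' (F x)) := by
  have key : ∀ e w, γ' (F x) (D I J F x e) (D I J F x w) =
      D I J F x (γ x e w) - hess I J F x w e := fun e w => by rw [h, add_sub_cancel_left]
  constructor
  · intro a b c
    obtain ⟨a, rfl⟩ := hs a
    obtain ⟨b, rfl⟩ := hs b
    obtain ⟨c, rfl⟩ := hs c
    rw [← map_add, key, key, key, hγ.add_left, map_add, map_add]
    abel
  · intro r a c
    obtain ⟨a, rfl⟩ := hs a
    obtain ⟨c, rfl⟩ := hs c
    rw [← map_smul, key, key, hγ.smul_left, map_smul, map_smul, smul_sub]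
  · intro a b c
    obtain ⟨a, rfl⟩ := hs a
    obtain ⟨b, rfl⟩ := hs b
    obtain ⟨c, rfl⟩ := hs c
    rw [← map_add, key, key, key, hγ.add_right, map_add, map_add, add_apply]
    abel
  · intro r a c
    obtain ⟨a, rfl⟩ := hs a
    obtain ⟨c, rfl⟩ := hs c
    rw [← map_smul, key, key, hγ.smul_right, map_smul, map_smul, smul_apply, smul_sub]

theorem exists_conn_prod [T2Space M] [T2Space N] [I.Boundaryless] [J.Boundaryless]
    {cov : Conn I M} {cov' : Conn J N} (h : cov.IsSmooth) (h' : cov'.IsSmooth) :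
    ∃ cov2 : Conn (I.prod J) (M × N), cov2.IsSmooth ∧
      ∀ q e w, cov2.Γ q e w = (cov.Γ q.1 e.1 w.1, cov'.Γ q.2 e.2 w.2) := by
  obtain ⟨cov2, h2⟩ := exists_conn (I := I.prod J) (M := M × N)
    (γ := fun q e w => (cov.Γ q.1 e.1 w.1, cov'.Γ q.2 e.2 w.2)) fun q => by
      constructor <;> intros <;> simp [Conn.Γ]
  have h1 : RelChr (I.prod J) I Prod.fst cov2.Γ cov.Γ := fun q e w => by
    rw [D_fst, D_fst, D_fst, hess_fst, zero_add, h2]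
  have h1' : RelChr (I.prod J) J Prod.snd cov2.Γ cov'.Γ := fun q e w => by
    rw [D_snd, D_snd, D_snd, hess_snd, zero_add, h2]
  refine ⟨cov2, Conn.isSmooth_iff.2 fun X Y hX hY q => contMDiffAt_vec_prod.2 ⟨?_, ?_⟩,
    fun q e w => by rw [h2]⟩
  · refine (h1.contMDiff_app contMDiff_fst h hX hY q).congr_of_eventuallyEq (.of_forall fun p => ?_)
    exact congrArg (vec I p.1) (D_fst p _).symm
  · refine (h1'.contMDiff_app contMDiff_snd h' hX hY q).congr_of_eventuallyEq
      (.of_forall fun p => ?_)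
    exact congrArg (vec J p.2) (D_snd p _).symm

end connections

/-! ### From compatible Christoffel symbols to multiplicative connections, torsions, sprays and
vertical projections -/

namespace LieGroupoid

variable {EM EG M G : Type*}
  [NormedAddCommGroup EM] [NormedSpace ℝ EM] [FiniteDimensional ℝ EM]
  [NormedAddCommGroup EG] [NormedSpace ℝ EG] [FiniteDimensional ℝ EG]
  [TopologicalSpace M] [ChartedSpace EM M] [IsManifold 𝓘(ℝ, EM) ∞ M]
  [TopologicalSpace G] [ChartedSpace EG G] [IsManifold 𝓘(ℝ, EG) ∞ G]
  (K : LieGroupoid EM EG M G)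

theorem hess_incl (c : K.Composable) (w e : PairModel EM EG) :
    hess 𝓘(ℝ, PairModel EM EG) (𝓘(ℝ, EG).prod 𝓘(ℝ, EG)) K.incl c w e =
      (hess 𝓘(ℝ, PairModel EM EG) 𝓘(ℝ, EG) SourceTarget.Composable.fst c w e,
        hess 𝓘(ℝ, PairModel EM EG) 𝓘(ℝ, EG) SourceTarget.Composable.snd c w e) := by
  have h1 := hess_comp (I := 𝓘(ℝ, PairModel EM EG)) (J := 𝓘(ℝ, EG).prod 𝓘(ℝ, EG)) (K := 𝓘(ℝ, EG))
    (F' := (Prod.fst : G × G → G)) contMDiffAt_fst (K.contMDiff_incl c) w e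
  have h2 := hess_comp (I := 𝓘(ℝ, PairModel EM EG)) (J := 𝓘(ℝ, EG).prod 𝓘(ℝ, EG)) (K := 𝓘(ℝ, EG))
    (F' := (Prod.snd : G × G → G)) contMDiffAt_snd (K.contMDiff_incl c) w e
  rw [hess_fst, zero_add, D_fst] at h1
  rw [hess_snd, zero_add, D_snd] at h2
  exact Prod.ext h1.symm h2.symm

variable {K}

/-- Additivity and homogeneity are checked in the two components, where they follow from the law,
because the Hessian and the symbols on G are bilinear. -/
theorem isBilinearMap_composable {γ : G → EG → EG → EG}
    {γC : K.Composable → PairModel EM EG → PairModel EM EG → PairModel EM EG}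
    (hγ : ∀ g, IsBilinearMap ℝ (γ g))
    (h1 : RelChr 𝓘(ℝ, PairModel EM EG) 𝓘(ℝ, EG) SourceTarget.Composable.fst γC γ)
    (h2 : RelChr 𝓘(ℝ, PairModel EM EG) 𝓘(ℝ, EG) SourceTarget.Composable.snd γC γ)
    (c : K.Composable) : IsBilinearMap ℝ (γC c) := by
  constructor
  · intro a b d
    apply K.D_composable_inj
    · rw [map_add, h1, h1, h1, map_add, map_add, (hγ _).add_left]
      abel
    · rw [map_add, h2, h2, h2, map_add, map_add, (hγ _).add_left]
      abel
  · intro r a d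
    apply K.D_composable_inj
    · rw [map_smul, h1, h1, map_smul, map_smul, (hγ _).smul_left, smul_add]
    · rw [map_smul, h2, h2, map_smul, map_smul, (hγ _).smul_left, smul_add]
  · intro a b d
    apply K.D_composable_inj
    · rw [map_add, h1, h1, h1, map_add, map_add, add_apply, (hγ _).add_right]
      abel
    · rw [map_add, h2, h2, h2, map_add, map_add, add_apply, (hγ _).add_right]
      abel
  · intro r a d
    apply K.D_composable_inj
    · rw [map_smul, h1, h1, map_smul, map_smul, smul_apply, (hγ _).smul_right, smul_add]
    · rw [map_smul, h2, h2, map_smul, map_smul, smul_apply, (hγ _).smul_right, smul_add]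

variable (K) in
theorem D_src_unit (y : M) (e : EM) :
    D 𝓘(ℝ, EG) 𝓘(ℝ, EM) K.src (K.unit y) (D 𝓘(ℝ, EM) 𝓘(ℝ, EG) K.unit y e) = e := by
  have h : K.src ∘ K.unit = id := funext K.src_unit
  have h1 := D_comp_apply (K.contMDiff_src (K.unit y)) (K.contMDiff_unit y) e
  rw [h, D_id] at h1
  exact h1.symm

variable [T2Space M] [T2Space G]

/-- Bilinearity descends along the surjective ds at the units. For smoothness, a pair of vectors on
M is moved to G by the unit map, lifted horizontally there, and sent back by the second tangent map
of s; the result is the horizontal lift on M. Only compatibility with s is used. -/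
theorem exists_conn_objects {cov : Conn 𝓘(ℝ, EG) G} (hc : cov.IsSmooth)
    {γM : M → EM → EM → EM} (h : RelChr 𝓘(ℝ, EG) 𝓘(ℝ, EM) K.src cov.Γ γM) :
    ∃ covM : Conn 𝓘(ℝ, EM) M, covM.IsSmooth ∧ covM.Γ = γM := by
  obtain ⟨covM, hM⟩ := exists_conn (I := 𝓘(ℝ, EM)) (γ := γM) fun y => by
    have := h.isBilinearMap (cov.isBilinearMap (K.unit y)) (K.surjective_D_src _)
    rwa [K.src_unit] at this
  refine ⟨covM, Conn.isSmooth_of_lift fun X Y hX hY y => ?_, hM⟩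
  rw [← hM] at h
  have h1 : ∀ {Z : VField 𝓘(ℝ, EM) M}, Z.IsSmooth → ContMDiffAt 𝓘(ℝ, EM) 𝓘(ℝ, EG).tangent ∞
      (fun z => vec 𝓘(ℝ, EG) (K.unit z) (D 𝓘(ℝ, EM) 𝓘(ℝ, EG) K.unit z (Z.val z))) y := fun hZ =>
    ContMDiffAt.vec_tangentMap (b := id) (K.contMDiff_unit y) (hZ y)
  have h2 := (hc.contMDiffAt_lift (b := K.unit) (h1 hX) (h1 hY))
  have h3 := (contMDiff_tangentMap (contMDiff_tangentMap K.contMDiff_src) _).comp y h2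
  refine h3.congr_of_eventuallyEq (.of_forall fun z => ?_)
  have h4 := h.tangentMap_lift (K.contMDiff_src (K.unit z))
    (D 𝓘(ℝ, EM) 𝓘(ℝ, EG) K.unit z (X.val z)) (D 𝓘(ℝ, EM) 𝓘(ℝ, EG) K.unit z (Y.val z))
  rw [K.D_src_unit, K.D_src_unit] at h4
  refine Eq.trans ?_ h4.symm
  rw [K.src_unit]

/-- The connections that witness the multiplicativity of a connection. -/
theorem IsMulChr.exists_conns {cov : Conn 𝓘(ℝ, EG) G} (hc : cov.IsSmooth) (h : K.IsMulChr cov.Γ) :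
    ∃ (covM : Conn 𝓘(ℝ, EM) M) (cov2 : Conn (𝓘(ℝ, EG).prod 𝓘(ℝ, EG)) (G × G))
      (covC : Conn 𝓘(ℝ, PairModel EM EG) K.Composable),
      covM.IsSmooth ∧ cov2.IsSmooth ∧ covC.IsSmooth ∧
      RelChr 𝓘(ℝ, EG) 𝓘(ℝ, EM) K.src cov.Γ covM.Γ ∧ RelChr 𝓘(ℝ, EG) 𝓘(ℝ, EM) K.tgt cov.Γ covM.Γ ∧
      RelChr (𝓘(ℝ, EG).prod 𝓘(ℝ, EG)) 𝓘(ℝ, EG) Prod.fst cov2.Γ cov.Γ ∧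
      RelChr (𝓘(ℝ, EG).prod 𝓘(ℝ, EG)) 𝓘(ℝ, EG) Prod.snd cov2.Γ cov.Γ ∧
      RelChr 𝓘(ℝ, PairModel EM EG) (𝓘(ℝ, EG).prod 𝓘(ℝ, EG)) K.incl covC.Γ cov2.Γ ∧
      RelChr 𝓘(ℝ, PairModel EM EG) 𝓘(ℝ, EG) SourceTarget.Composable.fst covC.Γ cov.Γ ∧
      RelChr 𝓘(ℝ, PairModel EM EG) 𝓘(ℝ, EG) SourceTarget.Composable.snd covC.Γ cov.Γ ∧
      RelChr 𝓘(ℝ, PairModel EM EG) 𝓘(ℝ, EG) K.mul covC.Γ cov.Γ := by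
  obtain ⟨γM, γC, hs, ht, h1, h2, hm⟩ := h
  obtain ⟨covM, hMs, rfl⟩ := exists_conn_objects hc hs
  obtain ⟨cov2, h2s, h2Γ⟩ := exists_conn_prod hc hc
  obtain ⟨covC, rfl⟩ := exists_conn (I := 𝓘(ℝ, PairModel EM EG))
    (isBilinearMap_composable cov.isBilinearMap h1 h2)
  refine ⟨covM, cov2, covC, hMs, h2s, ?_, hs, ht, ?_, ?_, ?_, h1, h2, hm⟩
  · refine Conn.isSmooth_iff.2 fun X Y hX hY c =>
      K.contMDiffAt_vec_composable (b := id) (v := fun d => covC.app X d (Y.val d)) ?_ ?_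
    · exact h1.contMDiff_app K.contMDiff_composable_fst hc hX hY c
    · exact h2.contMDiff_app K.contMDiff_composable_snd hc hX hY c
  · intro q e w
    rw [D_fst, D_fst, D_fst, hess_fst, zero_add, h2Γ]
  · intro q e w
    rw [D_snd, D_snd, D_snd, hess_snd, zero_add, h2Γ]
  · intro c e w
    rw [h2Γ, K.D_incl, K.D_incl, K.D_incl, K.hess_incl, h1, h2]
    rfl

theorem IsMulChr.isMultiplicative {cov : Conn 𝓘(ℝ, EG) G} (hc : cov.IsSmooth)
    (h : K.IsMulChr cov.Γ) :
    cov.IsMultiplicative 𝓘(ℝ, EM) 𝓘(ℝ, EG) 𝓘(ℝ, PairModel EM EG) K.maps := by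
  obtain ⟨covM, cov2, covC, hM, h2, hC, hs, ht, h1, h1', hi, -, -, hm⟩ := h.exists_conns hc
  exact ⟨hc, ⟨covM, hM, hs.related K.contMDiff_src, ht.related K.contMDiff_tgt⟩, cov2, covC, h2,
    h1.related contMDiff_fst, h1'.related contMDiff_snd, hC, hi.related K.contMDiff_incl,
    hm.related K.contMDiff_mul⟩

theorem RelChr.torsionTensor_related {E H E' H' M N : Type*}
    [NormedAddCommGroup E] [NormedSpace ℝ E] [TopologicalSpace H]
    [NormedAddCommGroup E'] [NormedSpace ℝ E'] [TopologicalSpace H']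
    {I : ModelWithCorners ℝ E H} {J : ModelWithCorners ℝ E' H'}
    [TopologicalSpace M] [ChartedSpace H M] [TopologicalSpace N] [ChartedSpace H' N]
    [IsManifold I ∞ M] [IsManifold J ∞ N] [FiniteDimensional ℝ E] [FiniteDimensional ℝ E']
    [T2Space M] [T2Space N] [I.Boundaryless] [J.Boundaryless] {F : M → N}
    {cov : Conn I M} {cov' : Conn J N} (hF : ContMDiff I J ∞ F) (h : RelChr I J F cov.Γ cov'.Γ) :
    cov.torsionTensor.Related F cov'.torsionTensor := by
  refine torsionTensor_related_iff.2 fun x e w => ?_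
  refine Eq.trans ?_ ((h.tensor hF x e w).trans (cov'.tor_eq (F x) _ _).symm)
  exact congrArg (D I J F x) (cov.tor_eq x e w)

theorem IsMulChr.isMultiplicative_torsionTensor {cov : Conn 𝓘(ℝ, EG) G} (hc : cov.IsSmooth)
    (h : K.IsMulChr cov.Γ) :
    cov.torsionTensor.IsMultiplicative 𝓘(ℝ, EM) 𝓘(ℝ, EG) 𝓘(ℝ, PairModel EM EG) K.maps := by
  obtain ⟨covM, cov2, covC, hM, h2, hC, hs, ht, h1, h1', hi, -, -, hm⟩ := h.exists_conns hc
  exact ⟨hc.torsionTensor, ⟨covM.torsionTensor, hM.torsionTensor,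
    RelChr.torsionTensor_related K.contMDiff_src hs,
    RelChr.torsionTensor_related K.contMDiff_tgt ht⟩, cov2.torsionTensor, covC.torsionTensor,
    h2.torsionTensor, RelChr.torsionTensor_related contMDiff_fst h1,
    RelChr.torsionTensor_related contMDiff_snd h1', hC.torsionTensor,
    RelChr.torsionTensor_related K.contMDiff_incl hi,
    RelChr.torsionTensor_related K.contMDiff_mul hm⟩

variable (K) in
theorem D_tangent_incl (p : TangentBundle 𝓘(ℝ, PairModel EM EG) K.Composable)
    (ξ : PairModel EM EG × PairModel EM EG) :
    D 𝓘(ℝ, PairModel EM EG).tangent (𝓘(ℝ, EG).tangent.prod 𝓘(ℝ, EG).tangent)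
      K.tangentMaps.incl p ξ =
    (D 𝓘(ℝ, PairModel EM EG).tangent 𝓘(ℝ, EG).tangent K.tangentMaps.fst p ξ,
      D 𝓘(ℝ, PairModel EM EG).tangent 𝓘(ℝ, EG).tangent K.tangentMaps.snd p ξ) :=
  D_prodMk (contMDiff_tangentMap K.contMDiff_composable_fst p)
    (contMDiff_tangentMap K.contMDiff_composable_snd p) ξ

theorem IsMulChr.isMultiplicative_spray {cov : Conn 𝓘(ℝ, EG) G} (hc : cov.IsSmooth)
    (h : K.IsMulChr cov.Γ) :
    cov.spray.toTensor.IsMultiplicative 𝓘(ℝ, EM).tangent 𝓘(ℝ, EG).tangent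
      𝓘(ℝ, PairModel EM EG).tangent K.tangentMaps := by
  obtain ⟨covM, cov2, covC, hM, h2, hC, hs, ht, -, -, -, h1, h1', hm⟩ := h.exists_conns hc
  refine ⟨fun _ _ => hc.spray, ⟨covM.spray.toTensor, fun _ _ => hM.spray,
    toTensor_related_iff.2 (hs.spray K.contMDiff_src),
    toTensor_related_iff.2 (ht.spray K.contMDiff_tgt)⟩,
    (cov.spray.prod cov.spray).toTensor, covC.spray.toTensor,
    fun _ _ => hc.spray.prod hc.spray, toTensor_related_iff.2 fun q =>
      D_fst (E := EG × EG) (E' := EG × EG) q _,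
    toTensor_related_iff.2 fun q =>
      D_snd (E := EG × EG) (E' := EG × EG) q _, fun _ _ => hC.spray,
    toTensor_related_iff.2 fun p => ?_, toTensor_related_iff.2 (hm.spray K.contMDiff_mul)⟩
  exact (K.D_tangent_incl p _).trans (Prod.ext (h1.spray K.contMDiff_composable_fst p)
    (h1'.spray K.contMDiff_composable_snd p))

/-- The product of two vertical projections. -/
def vertProd (cov : Conn 𝓘(ℝ, EG) G) (q : TangentBundle 𝓘(ℝ, EG) G × TangentBundle 𝓘(ℝ, EG) G) :
    TangentSpace (𝓘(ℝ, EG).tangent.prod 𝓘(ℝ, EG).tangent) q →ₗ[ℝ]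
      TangentSpace (𝓘(ℝ, EG).tangent.prod 𝓘(ℝ, EG).tangent) q :=
  let L : (EG × EG) × (EG × EG) →ₗ[ℝ] (EG × EG) × (EG × EG) :=
    LinearMap.prodMap (M := EG × EG) (M₂ := EG × EG) (M₃ := EG × EG) (M₄ := EG × EG)
      (cov.vert q.1) (cov.vert q.2)
  L

theorem IsMulChr.isMultiplicative_vert {cov : Conn 𝓘(ℝ, EG) G} (hc : cov.IsSmooth)
    (h : K.IsMulChr cov.Γ) :
    (endoToTensor cov.vertField).IsMultiplicative 𝓘(ℝ, EM).tangent 𝓘(ℝ, EG).tangent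
      𝓘(ℝ, PairModel EM EG).tangent K.tangentMaps := by
  obtain ⟨covM, cov2, covC, hM, h2, hC, hs, ht, -, -, -, h1, h1', hm⟩ := h.exists_conns hc
  refine ⟨hc.vert, ⟨endoToTensor covM.vertField, hM.vert,
    tensor_related_one_iff.2 (hs.vert_apply K.contMDiff_src),
    tensor_related_one_iff.2 (ht.vert_apply K.contMDiff_tgt)⟩,
    endoToTensor (vertProd cov), endoToTensor covC.vertField, fun X hX q => ?_,
    tensor_related_one_iff.2 fun q ξ => ?_, tensor_related_one_iff.2 fun q ξ => ?_, hC.vert,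
    tensor_related_one_iff.2 fun p ξ => ?_,
    tensor_related_one_iff.2 (hm.vert_apply K.contMDiff_mul)⟩
  · have hX0 := contMDiffAt_vec_prod.1 (hX 0 q)
    exact contMDiffAt_vec_prod.2 ⟨hc.contMDiffAt_vert hX0.1, hc.contMDiffAt_vert hX0.2⟩
  · refine (D_fst (E := EG × EG) (E' := EG × EG) q _).trans ?_
    exact congrArg (fun v : EG × EG => cov.vert q.1 v) (D_fst (E := EG × EG) (E' := EG × EG) q ξ).symm
  · refine (D_snd (E := EG × EG) (E' := EG × EG) q _).trans ?_
    exact congrArg (fun v : EG × EG => cov.vert q.2 v) (D_snd (E := EG × EG) (E' := EG × EG) q ξ).symm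
  · refine (K.D_tangent_incl p _).trans (Eq.trans ?_
      (congrArg (vertProd cov (K.tangentMaps.incl p)) (K.D_tangent_incl p ξ).symm))
    exact Prod.ext (h1.vert_apply K.contMDiff_composable_fst p ξ)
      (h1'.vert_apply K.contMDiff_composable_snd p ξ)

end LieGroupoid

theorem Conn.tt_mem_iff {E H M : Type*} [NormedAddCommGroup E] [NormedSpace ℝ E]
    [FiniteDimensional ℝ E] [TopologicalSpace H] {I : ModelWithCorners ℝ E H} [I.Boundaryless]
    [TopologicalSpace M] [ChartedSpace H M] [IsManifold I ∞ M] [T2Space M] {cov : Conn I M} {x : M}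
    {e w η : E} : tt I x e w η ∈ cov.horizontal ↔ η = -cov.Γ x e w :=
  cov.tt_mem_horizontal

theorem mem_of_coe_eq {X : Type*} {S : Set X} {a : X} (g : S) (h : (g : X) = a) : a ∈ S :=
  h ▸ g.2

/-! ### Compatible symbols from a subgroupoid of horizontal vectors -/

namespace LieGroupoid

variable {EM EG M G : Type*}
  [NormedAddCommGroup EM] [NormedSpace ℝ EM] [FiniteDimensional ℝ EM]
  [NormedAddCommGroup EG] [NormedSpace ℝ EG] [FiniteDimensional ℝ EG]
  [TopologicalSpace M] [ChartedSpace EM M] [IsManifold 𝓘(ℝ, EM) ∞ M]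
  [TopologicalSpace G] [ChartedSpace EG G] [IsManifold 𝓘(ℝ, EG) ∞ G]
  {K : LieGroupoid EM EG M G}

/-- Christoffel symbols that are projectable by the source and target maps restrict to the
composable pairs. -/
theorem exists_relChr_composable {γ : G → EG → EG → EG} {γM : M → EM → EM → EM}
    (hs : RelChr 𝓘(ℝ, EG) 𝓘(ℝ, EM) K.src γ γM) (ht : RelChr 𝓘(ℝ, EG) 𝓘(ℝ, EM) K.tgt γ γM) :
    ∃ γC : K.Composable → PairModel EM EG → PairModel EM EG → PairModel EM EG,
      RelChr 𝓘(ℝ, PairModel EM EG) 𝓘(ℝ, EG) SourceTarget.Composable.fst γC γ ∧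
      RelChr 𝓘(ℝ, PairModel EM EG) 𝓘(ℝ, EG) SourceTarget.Composable.snd γC γ := by
  have key : ∀ (c : K.Composable) (e w : PairModel EM EG), ∃ η : PairModel EM EG,
      D 𝓘(ℝ, PairModel EM EG) 𝓘(ℝ, EG) SourceTarget.Composable.fst c η =
        hess 𝓘(ℝ, PairModel EM EG) 𝓘(ℝ, EG) SourceTarget.Composable.fst c w e +
          γ c.fst (D 𝓘(ℝ, PairModel EM EG) 𝓘(ℝ, EG) SourceTarget.Composable.fst c e)
            (D 𝓘(ℝ, PairModel EM EG) 𝓘(ℝ, EG) SourceTarget.Composable.fst c w) ∧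
      D 𝓘(ℝ, PairModel EM EG) 𝓘(ℝ, EG) SourceTarget.Composable.snd c η =
        hess 𝓘(ℝ, PairModel EM EG) 𝓘(ℝ, EG) SourceTarget.Composable.snd c w e +
          γ c.snd (D 𝓘(ℝ, PairModel EM EG) 𝓘(ℝ, EG) SourceTarget.Composable.snd c e)
            (D 𝓘(ℝ, PairModel EM EG) 𝓘(ℝ, EG) SourceTarget.Composable.snd c w) := by
    intro c e w
    refine K.exists_D_composable c ?_
    -- The two prescribed components are composable: this is the second derivative of the identity s
    -- ∘ fst = t ∘ snd, combined with the laws for s and t.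
    have h1 := hess_comp (K.contMDiff_src c.fst) (K.contMDiff_composable_fst c) w e
    have h2 := hess_comp (K.contMDiff_tgt c.snd) (K.contMDiff_composable_snd c) w e
    rw [K.src_comp_fst] at h1
    rw [map_add, map_add, hs, ht, ← K.D_src_fst, ← K.D_src_fst, c.src_fst, ← add_assoc,
      ← add_assoc, add_right_cancel_iff, add_comm _ (hess _ _ K.src _ _ _),
      add_comm _ (hess _ _ K.tgt _ _ _)]
    exact h1.symm.trans h2
  choose γC h1 h2 using key
  exact ⟨γC, h1, h2⟩

variable [T2Space G]

/-- Only the algebra is used: H is closed under units and products, and its sources and targets lie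
in one common set of objects. The submanifold structures and embeddings play no role. -/
theorem isMulChr_of_isLieSubgroupoid {cov : Conn 𝓘(ℝ, EG) G}
    (h : IsLieSubgroupoid 𝓘(ℝ, EM).tangent.tangent 𝓘(ℝ, EG).tangent.tangent
      K.tangentTangentMaps cov.horizontal) : K.IsMulChr cov.Γ := by
  obtain ⟨S₀, k, n, _, _, _, _, L, -, -, hs, ht, hu, -, hm⟩ := h
  -- An object of the subgroupoid has a horizontal unit. Applying ds to that condition, with s ∘ u =
  -- id, determines its vertical component, which is how this formula arises.
  let γM : M → EM → EM → EM := fun y e w => D 𝓘(ℝ, EG) 𝓘(ℝ, EM) K.src (K.unit y)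
    (hess 𝓘(ℝ, EM) 𝓘(ℝ, EG) K.unit y w e + cov.Γ (K.unit y)
      (D 𝓘(ℝ, EM) 𝓘(ℝ, EG) K.unit y e) (D 𝓘(ℝ, EM) 𝓘(ℝ, EG) K.unit y w))
  have hS₀ : ∀ {y : M} {e w η : EM}, tt 𝓘(ℝ, EM) y e w η ∈ S₀ → η = -γM y e w := by
    intro y e w η h
    have h1 : tangentMap 𝓘(ℝ, EM).tangent 𝓘(ℝ, EG).tangent (tangentMap 𝓘(ℝ, EM) 𝓘(ℝ, EG) K.unit)
        (tt 𝓘(ℝ, EM) y e w η) ∈ cov.horizontal := mem_of_coe_eq _ (hu ⟨_, h⟩)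
    rw [tangentMap_tt (K.contMDiff_unit y), Conn.tt_mem_iff] at h1
    have h2 : D 𝓘(ℝ, EM) 𝓘(ℝ, EG) K.unit y η = -(hess 𝓘(ℝ, EM) 𝓘(ℝ, EG) K.unit y w e +
        cov.Γ (K.unit y) (D 𝓘(ℝ, EM) 𝓘(ℝ, EG) K.unit y e)
          (D 𝓘(ℝ, EM) 𝓘(ℝ, EG) K.unit y w)) := by
      rw [neg_add, ← h1]
      abel
    rw [← K.D_src_unit y η, h2, map_neg]
  have key : ∀ {F : G → M}, ContMDiff 𝓘(ℝ, EG) 𝓘(ℝ, EM) ∞ F →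
      (∀ ξ ∈ cov.horizontal, tangentMap 𝓘(ℝ, EG).tangent 𝓘(ℝ, EM).tangent
        (tangentMap 𝓘(ℝ, EG) 𝓘(ℝ, EM) F) ξ ∈ S₀) → RelChr 𝓘(ℝ, EG) 𝓘(ℝ, EM) F cov.Γ γM := by
    intro F hF h x e w
    have h1 := h _ ((Conn.tt_mem_iff (cov := cov) (x := x) (e := e) (w := w)).2 rfl)
    rw [tangentMap_tt (hF x)] at h1
    rw [← neg_eq_iff_eq_neg.2 (hS₀ h1), map_neg]
    abel
  have hs' := key K.contMDiff_src fun ξ hξ => mem_of_coe_eq _ (hs ⟨ξ, hξ⟩)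
  have ht' := key K.contMDiff_tgt fun ξ hξ => mem_of_coe_eq _ (ht ⟨ξ, hξ⟩)
  obtain ⟨γC, h1, h2⟩ := exists_relChr_composable hs' ht'
  refine ⟨γM, γC, hs', ht', h1, h2, fun c e w => ?_⟩
  -- Its two components are the horizontal lifts `A` and `B`. They are composable in the
  -- subgroupoid, so the image of ξ under the second tangent map of m is horizontal, which is the
  -- law for m.
  let ξ := tt 𝓘(ℝ, PairModel EM EG) c e w (-γC c e w)
  have hξ1 := h1.tangentMap_lift (K.contMDiff_composable_fst c) e w
  have hξ2 := h2.tangentMap_lift (K.contMDiff_composable_snd c) e w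
  let A : cov.horizontal := ⟨_, (Conn.tt_mem_iff (cov := cov) (x := c.fst)
    (e := D 𝓘(ℝ, PairModel EM EG) 𝓘(ℝ, EG) SourceTarget.Composable.fst c e)
    (w := D 𝓘(ℝ, PairModel EM EG) 𝓘(ℝ, EG) SourceTarget.Composable.fst c w)).2 rfl⟩
  let B : cov.horizontal := ⟨_, (Conn.tt_mem_iff (cov := cov) (x := c.snd)
    (e := D 𝓘(ℝ, PairModel EM EG) 𝓘(ℝ, EG) SourceTarget.Composable.snd c e)
    (w := D 𝓘(ℝ, PairModel EM EG) 𝓘(ℝ, EG) SourceTarget.Composable.snd c w)).2 rfl⟩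
  have hAB : L.src A = L.tgt B := by
    refine Subtype.ext ((hs A).trans (Eq.trans ?_ (ht B).symm))
    refine (hs'.tangentMap_lift (K.contMDiff_src c.fst) _ _).trans
      (Eq.trans ?_ (ht'.tangentMap_lift (K.contMDiff_tgt c.snd) _ _).symm)
    rw [K.D_src_fst, K.D_src_fst, c.src_fst]
  have h3 := hm ξ ⟨A, B, hAB⟩ hξ1 hξ2
  have h4 : tangentMap 𝓘(ℝ, PairModel EM EG).tangent 𝓘(ℝ, EG).tangent
      (tangentMap 𝓘(ℝ, PairModel EM EG) 𝓘(ℝ, EG) K.mul) ξ ∈ cov.horizontal :=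
    mem_of_coe_eq _ h3
  rw [tangentMap_tt (K.contMDiff_mul c), Conn.tt_mem_iff] at h4
  rw [← neg_eq_iff_eq_neg.2 h4, map_neg]
  abel

end LieGroupoid

/-! ### Submersions and immersions from the inverse function theorem -/

section normalForms

variable {E H E' H' : Type*}
  [NormedAddCommGroup E] [NormedSpace ℝ E] [TopologicalSpace H]
  [NormedAddCommGroup E'] [NormedSpace ℝ E'] [TopologicalSpace H']
  {I : ModelWithCorners ℝ E H} {J : ModelWithCorners ℝ E' H'}
  {M N : Type*} [TopologicalSpace M] [ChartedSpace H M] [TopologicalSpace N] [ChartedSpace H' N]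
  [IsManifold I ∞ M] [IsManifold J ∞ N] [I.Boundaryless] [J.Boundaryless]

/-- The local inverse is restricted to the points where `f` is smooth with invertible derivative;
near `a` this loses nothing, and it makes the inverse smooth on the whole target and not only at the
image of `a`. -/
theorem exists_smooth_openPartialHomeomorph [CompleteSpace E] {f : E → E} {a : E}
    (hf : ∀ᶠ z in 𝓝 a, ContDiffAt ℝ ∞ f z) (L : E ≃L[ℝ] E) (hL : fderiv ℝ f a = L) :
    ∃ Θ : OpenPartialHomeomorph E E, a ∈ Θ.source ∧ (Θ : E → E) = f ∧ ContDiffOn ℝ ∞ Θ Θ.source ∧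
      ContDiffOn ℝ ∞ Θ.symm Θ.target := by
  have ha := hf.self_of_nhds
  have hd : HasFDerivAt f (L : E →L[ℝ] E) a := by
    rw [← hL]; exact (ha.differentiableAt (by simp)).hasFDerivAt
  have hc : ContinuousAt (fderiv ℝ f) a := (ha.fderiv_right (m := 0) (by simp)).continuousAt
  have hinv : ∀ᶠ z in 𝓝 a, ∃ L' : E ≃L[ℝ] E, (L' : E →L[ℝ] E) = fderiv ℝ f z :=
    hc.eventually (by rw [hL]; exact ContinuousLinearEquiv.nhds L)
  obtain ⟨W, hW, hWo, haW⟩ := mem_nhds_iff.1 (hf.and hinv)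
  let Θ₀ := ha.toOpenPartialHomeomorph f hd (by simp)
  refine ⟨Θ₀.restrOpen W hWo, ⟨ha.mem_toOpenPartialHomeomorph_source hd (by simp), haW⟩, rfl,
    fun z hz => (hW hz.2).1.contDiffWithinAt, fun y hy => ?_⟩
  have hy' := (Θ₀.restrOpen W hWo).map_target hy
  obtain ⟨h1, L', h2⟩ := hW hy'.2
  refine (OpenPartialHomeomorph.contDiffAt_symm (Θ₀.restrOpen W hWo) (f₀' := L') hy ?_
    h1).contDiffWithinAt
  rw [h2]
  exact (h1.differentiableAt (by simp)).hasFDerivAt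

/-- Functions with an invertible derivative are coordinates. -/
theorem exists_chart [FiniteDimensional ℝ E] {f : M → E} {p : M}
    (hf : ∀ᶠ q in 𝓝 p, ContMDiffAt I 𝓘(ℝ, E) ∞ f q)
    (hD : Function.Injective (D I 𝓘(ℝ, E) f p)) :
    ∃ c ∈ IsManifold.maximalAtlas I ∞ M, p ∈ c.source ∧ ∀ q ∈ c.source, I (c q) = f q := by
  have : CompleteSpace E := FiniteDimensional.complete ℝ E
  let ψ := extChartAt I p
  have hψ : ∀ z ∈ ψ.target, ContMDiffAt 𝓘(ℝ, E) I ∞ ψ.symm z := fun z hz =>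
    (contMDiffOn_extChartAt_symm p).contMDiffAt ((isOpen_extChartAt_target p).mem_nhds hz)
  have hzt : ψ p ∈ ψ.target := mem_extChartAt_target p
  have hψp : ψ.symm (ψ p) = p := extChartAt_to_inv p
  have h1 : ∀ᶠ z in 𝓝 (ψ p), ContDiffAt ℝ ∞ (f ∘ ψ.symm) z := by
    have h2 : ContinuousAt ψ.symm (ψ p) := (hψ _ hzt).continuousAt
    have h3 : ∀ᶠ z in 𝓝 (ψ p), ContMDiffAt I 𝓘(ℝ, E) ∞ f (ψ.symm z) :=
      h2.eventually (by rw [hψp]; exact hf)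
    filter_upwards [h3, (isOpen_extChartAt_target p).mem_nhds hzt] with z hz hz'
    exact (hz.comp z (hψ z hz')).contDiffAt
  let L : E ≃L[ℝ] E := (LinearEquiv.ofInjectiveEndo (D I 𝓘(ℝ, E) f p).toLinearMap
    hD).toContinuousLinearEquiv
  have hL : fderiv ℝ (f ∘ ψ.symm) (ψ p) = L := by
    ext v
    rw [← D_eq_fderiv, D_comp_apply (J := I) (by rw [hψp]; exact hf.self_of_nhds) (hψ _ hzt)]
    have h4 : D 𝓘(ℝ, E) I ψ.symm (ψ p) = ContinuousLinearMap.id ℝ E := D_extChartAt_symm_self p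
    rw [h4, hψp]
    rfl
  obtain ⟨Θ, hΘ, hΘf, hΘs, hΘt⟩ := exists_smooth_openPartialHomeomorph h1 L hL
  -- Without boundary the model is a homeomorphism from `H` to `E`, so the coordinate change of `E`
  -- can be carried back to `H`.
  let e := I.toHomeomorph.toOpenPartialHomeomorph
  let c := ((chartAt H p).trans e).trans (Θ.trans e.symm)
  have hc : ∀ q ∈ c.source, q ∈ (chartAt H p).source ∧ I (chartAt H p q) ∈ Θ.source := by
    intro q hq
    simp only [c, e, OpenPartialHomeomorph.trans_source, Set.mem_inter_iff, Set.mem_preimage] at hq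
    exact ⟨hq.1.1, hq.2.1⟩
  have hval : ∀ q ∈ c.source, I (c q) = f q := by
    intro q hq
    obtain ⟨hq1, hq2⟩ := hc q hq
    have h5 : I (c q) = Θ (I (chartAt H p q)) := e.right_inv (by simp [e])
    rw [h5, hΘf]
    refine congrArg f ?_
    exact (extChartAt I p).left_inv (by rwa [extChartAt_source])
  refine ⟨c, c.mem_maximalAtlas_of_contMDiffOn ?_ ?_, ?_, hval⟩
  · have h6 : ContMDiffOn I 𝓘(ℝ, E) ∞ (fun q => Θ (extChartAt I p q)) c.source :=
      hΘs.contMDiffOn.comp ((contMDiffOn_extChartAt (x := p)).mono fun q hq => (hc q hq).1)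
        fun q hq => (hc q hq).2
    exact (I.contMDiffOn_symm.comp h6 fun q _ => by rw [I.range_eq_univ]; trivial)
  · have hct : ∀ z ∈ c.target, I z ∈ Θ.target ∧ Θ.symm (I z) ∈ ψ.target := by
      intro z hz
      have hz' := hc _ (c.map_target hz)
      have h7 := hval _ (c.map_target hz)
      simp only [c, e, OpenPartialHomeomorph.trans_target, OpenPartialHomeomorph.symm_target,
        Set.mem_inter_iff, Set.mem_preimage] at hz
      refine ⟨hz.1.2, ?_⟩
      rw [extChartAt_target, I.range_eq_univ, Set.inter_univ]
      exact hz.2.2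
    exact (contMDiffOn_extChartAt_symm p).comp (hΘt.contMDiffOn.comp I.contMDiff.contMDiffOn
      fun z hz => (hct z hz).1) fun z hz => (hct z hz).2
  · simp only [c, e, OpenPartialHomeomorph.trans_source, Set.mem_inter_iff, Set.mem_preimage]
    exact ⟨⟨mem_chart_source H p, trivial⟩, hΘ, trivial⟩

/-- A surjective linear map is, up to an isomorphism, a projection. -/
theorem exists_complement {V W : Type*} [NormedAddCommGroup V] [NormedSpace ℝ V]
    [FiniteDimensional ℝ V] [NormedAddCommGroup W] [NormedSpace ℝ W] [FiniteDimensional ℝ W]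
    {L : V →L[ℝ] W} (hL : Function.Surjective L) :
    ∃ P : V →L[ℝ] FibreModel W V,
      ∀ v, L v = 0 → P v = 0 → v = 0 := by
  have h1 : Module.finrank ℝ (LinearMap.ker L.toLinearMap) =
      Module.finrank ℝ V - Module.finrank ℝ W := by
    have := L.toLinearMap.finrank_range_add_finrank_ker
    rw [LinearMap.range_eq_top.2 hL, finrank_top] at this
    omega
  let e : LinearMap.ker L.toLinearMap ≃ₗ[ℝ]
      FibreModel W V :=
    LinearEquiv.ofFinrankEq _ _ (by rw [h1, finrank_euclideanSpace_fin])
  -- An isomorphism from the kernel of `L`, extended to all of `V`, is injective on that kernel;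
  -- together with `L` it separates vectors.
  obtain ⟨P, hP⟩ := LinearMap.exists_extend e.toLinearMap
  refine ⟨P.toContinuousLinearMap, fun v hv hPv => ?_⟩
  have h2 : e ⟨v, hv⟩ = 0 := by
    rw [← hPv]
    exact (congrArg (fun A : _ →ₗ[ℝ] _ => A ⟨v, hv⟩) hP).symm
  exact congrArg Subtype.val (e.map_eq_zero_iff.1 h2)

theorem finrank_le_of_surjective {V W : Type*} [NormedAddCommGroup V] [NormedSpace ℝ V]
    [FiniteDimensional ℝ V] [NormedAddCommGroup W] [NormedSpace ℝ W]
    {L : V →L[ℝ] W} (hL : Function.Surjective L) : Module.finrank ℝ W ≤ Module.finrank ℝ V :=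
  L.toLinearMap.finrank_le_finrank_of_surjective hL

/-- A smooth map with surjective derivative is a submersion. -/
theorem isSubmersionAt_of_surjective [FiniteDimensional ℝ E] [FiniteDimensional ℝ E'] {F : M → N}
    (hF : ContMDiff I J ∞ F) {p : M} (hs : Function.Surjective (D I J F p)) :
    IsSubmersionAtOfComplement
      (FibreModel E' E) I J ∞ F p := by
  obtain ⟨P, hP⟩ := exists_complement hs
  have hdim := finrank_le_of_surjective hs
  let e : E ≃L[ℝ] E' × FibreModel E' E :=
    ContinuousLinearEquiv.ofFinrankEq (by
      rw [Module.finrank_prod, finrank_euclideanSpace_fin]; omega)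
  -- The coordinates of `F q`, completed by linear coordinates that are injective on the kernel of
  -- dF. In the chart `Φ` the map is a projection by construction.
  let Φ : M → E := fun q => e.symm (extChartAt J (F p) (F q), P (extChartAt I p q))
  have h1 : ∀ᶠ q in 𝓝 p, ContMDiffAt I 𝓘(ℝ, E') ∞ (fun q => extChartAt J (F p) (F q)) q := by
    filter_upwards [(hF p).continuousAt.eventually (chart_source_mem_nhds H' (F p))] with q hq
    exact (contMDiffAt_extChartAt' hq).comp q (hF q)
  have h2 : ∀ᶠ q in 𝓝 p, ContMDiffAt I 𝓘(ℝ, FibreModel E' E) ∞ (fun q => P (extChartAt I p q)) q := by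
    filter_upwards [chart_source_mem_nhds H p] with q hq
    exact P.contMDiff.contMDiffAt.comp q (contMDiffAt_extChartAt' hq)
  have h3 : ∀ᶠ q in 𝓝 p, ContMDiffAt I 𝓘(ℝ, E) ∞ Φ q := by
    filter_upwards [h1, h2] with q hq hq'
    exact (e.symm : E' × FibreModel E' E →L[ℝ] E).contMDiff.contMDiffAt.comp q (hq.prodMk_space hq')
  have hD : ∀ v, D I 𝓘(ℝ, E) Φ p v = e.symm (D I J F p v, P v) := by
    intro v
    have h4 : D I 𝓘(ℝ, E) Φ p v = (e.symm : E' × FibreModel E' E →L[ℝ] E) (D I 𝓘(ℝ, E' × FibreModel E' E)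
        (fun q => (extChartAt J (F p) (F q), P (extChartAt I p q))) p v) :=
      (D_comp_apply (J := 𝓘(ℝ, E' × FibreModel E' E)) (F' := (e.symm : E' × FibreModel E' E →L[ℝ] E))
        (e.symm : E' × FibreModel E' E →L[ℝ] E).contMDiff.contMDiffAt
        (h1.self_of_nhds.prodMk_space h2.self_of_nhds) v).trans (by rw [D_clm])
    have h5 : D I 𝓘(ℝ, E') (fun q => extChartAt J (F p) (F q)) p v = D I J F p v :=
      (D_comp_apply (J := J) (contMDiffAt_extChartAt (x := F p)) (hF p) v).trans (by
        rw [D_extChartAt_self]; rfl)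
    have h6 : D I 𝓘(ℝ, FibreModel E' E) (fun q => P (extChartAt I p q)) p v = P v :=
      (D_comp_apply (J := 𝓘(ℝ, E)) (F' := P) P.contMDiff.contMDiffAt
        (contMDiffAt_extChartAt (x := p)) v).trans (by rw [D_clm, D_extChartAt_self]; rfl)
    rw [h4, D_prodMk_space h1.self_of_nhds h2.self_of_nhds, h5, h6]
    rfl
  have hinj : Function.Injective (D I 𝓘(ℝ, E) Φ p) := by
    refine (injective_iff_map_eq_zero _).2 fun v hv => ?_
    rw [hD, e.symm.map_eq_zero_iff] at hv
    exact hP v (congrArg Prod.fst hv) (congrArg Prod.snd hv)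
  obtain ⟨c, hc, hpc, hval⟩ := exists_chart h3 hinj
  refine .mk_of_continuousAt (hF p).continuousAt e c (chartAt H' (F p)) hpc
    (mem_chart_source _ _) hc (IsManifold.chart_mem_maximalAtlas _) fun z hz => ?_
  have hz' : I.symm z ∈ c.target := by
    rw [OpenPartialHomeomorph.extend_target] at hz
    exact hz.1
  have h7 := hval _ (c.map_target hz')
  rw [c.right_inv hz', I.right_inv (by rw [I.range_eq_univ]; trivial)] at h7
  change extChartAt J (F p) (F (c.symm (I.symm z))) = (e z).1
  conv_rhs => rw [h7]
  simp only [Φ, ContinuousLinearEquiv.apply_symm_apply]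

/-- A smooth map with a smooth left inverse is an immersion. -/
theorem isImmersionAt_of_leftInverse [FiniteDimensional ℝ E] [FiniteDimensional ℝ E'] {F : M → N}
    (hF : ContMDiff I J ∞ F) {p : M} {ρ : N → M} (hρ : ∀ᶠ q in 𝓝 (F p), ContMDiffAt J I ∞ ρ q)
    (h : ∀ᶠ q in 𝓝 p, ρ (F q) = q) :
    IsImmersionAtOfComplement
      (FibreModel E E') I J ∞ F p := by
  have hρp : ρ (F p) = p := h.self_of_nhds
  have hDρ : ∀ v, D J I ρ (F p) (D I J F p v) = v := fun v => by
    rw [← D_comp_apply hρ.self_of_nhds (hF p), D_congr (F := ρ ∘ F) (F' := id) h, D_id]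
    rfl
  obtain ⟨P, hP⟩ := exists_complement (L := D J I ρ (F p)) fun v => ⟨_, hDρ v⟩
  have hdim := finrank_le_of_surjective (L := D J I ρ (F p)) fun v => ⟨_, hDρ v⟩
  let e : (E × FibreModel E E') ≃L[ℝ] E' :=
    ContinuousLinearEquiv.ofFinrankEq (by
      rw [Module.finrank_prod, finrank_euclideanSpace_fin]; omega)
  let ψ := extChartAt J (F p)
  -- The first component is the coordinate of the retracted point, the second measures the deviation
  -- from the image of `F` and vanishes on it. Hence `F` becomes z ↦ (z, 0).
  let Φ : N → E' := fun q => e (extChartAt I p (ρ q), P (ψ q - ψ (F (ρ q))))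
  have hc : ∀ᶠ q in 𝓝 (F p), ρ q ∈ (chartAt H p).source := by
    refine hρ.self_of_nhds.continuousAt.eventually ?_
    rw [hρp]
    exact chart_source_mem_nhds H p
  have hc' : ∀ᶠ q in 𝓝 (F p), F (ρ q) ∈ (chartAt H' (F p)).source := by
    refine ((hF _).continuousAt.comp hρ.self_of_nhds.continuousAt).eventually ?_
    rw [Function.comp_apply, hρp]
    exact chart_source_mem_nhds H' (F p)
  have h1 : ∀ᶠ q in 𝓝 (F p), ContMDiffAt J 𝓘(ℝ, E) ∞ (fun q => extChartAt I p (ρ q)) q := by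
    filter_upwards [hρ, hc] with q hq hq'
    exact (contMDiffAt_extChartAt' hq').comp q hq
  have h2 : ∀ᶠ q in 𝓝 (F p), ContMDiffAt J 𝓘(ℝ, E') ∞ (fun q => ψ (F (ρ q))) q := by
    filter_upwards [hρ, hc'] with q hq hq'
    exact (contMDiffAt_extChartAt' hq').comp q ((hF _).comp q hq)
  have h3 : ∀ᶠ q in 𝓝 (F p), ContMDiffAt J 𝓘(ℝ, E') ∞ (fun q => ψ q - ψ (F (ρ q))) q := by
    filter_upwards [h2, chart_source_mem_nhds H' (F p)] with q hq hq'
    exact (contMDiffAt_extChartAt' hq').sub hq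
  have h4 : ∀ᶠ q in 𝓝 (F p), ContMDiffAt J 𝓘(ℝ, FibreModel E E') ∞ (fun q => P (ψ q - ψ (F (ρ q)))) q :=
    h3.mono fun q hq => P.contMDiff.contMDiffAt.comp q hq
  have h5 : ∀ᶠ q in 𝓝 (F p), ContMDiffAt J 𝓘(ℝ, E') ∞ Φ q := by
    filter_upwards [h1, h4] with q hq hq'
    exact (e : E × FibreModel E E' →L[ℝ] E').contMDiff.contMDiffAt.comp q (hq.prodMk_space hq')
  have hD : ∀ v, D J 𝓘(ℝ, E') Φ (F p) v =
      e (D J I ρ (F p) v, P (v - D I J F p (D J I ρ (F p) v))) := by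
    intro v
    have h6 : D J 𝓘(ℝ, E') Φ (F p) v = (e : E × FibreModel E E' →L[ℝ] E') (D J 𝓘(ℝ, E × FibreModel E E')
        (fun q => (extChartAt I p (ρ q), P (ψ q - ψ (F (ρ q))))) (F p) v) :=
      (D_comp_apply (J := 𝓘(ℝ, E × FibreModel E E')) (F' := (e : E × FibreModel E E' →L[ℝ] E'))
        (e : E × FibreModel E E' →L[ℝ] E').contMDiff.contMDiffAt
        (h1.self_of_nhds.prodMk_space h4.self_of_nhds) v).trans (by rw [D_clm])
    have h7 : D J 𝓘(ℝ, E) (fun q => extChartAt I p (ρ q)) (F p) v = D J I ρ (F p) v :=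
      (D_comp_apply (J := I) (F' := extChartAt I p)
        (by rw [hρp]; exact contMDiffAt_extChartAt) hρ.self_of_nhds v).trans (by
        rw [hρp, D_extChartAt_self]; rfl)
    have h8 : D J 𝓘(ℝ, E') (fun q => ψ (F (ρ q))) (F p) v = D I J F p (D J I ρ (F p) v) :=
      (D_comp_apply (J := J) (F := F ∘ ρ) (F' := ψ)
        (by rw [Function.comp_apply, hρp]; exact contMDiffAt_extChartAt)
        ((hF _).comp _ hρ.self_of_nhds) v).trans (by
        rw [D_comp_apply (hF _) hρ.self_of_nhds, Function.comp_apply, hρp, D_extChartAt_self]; rfl)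
    have h9 : D J 𝓘(ℝ, E') (fun q => ψ q - ψ (F (ρ q))) (F p) v =
        v - D I J F p (D J I ρ (F p) v) := by
      rw [← h8]
      have h10 := congrArg (fun L : E' →L[ℝ] E' => L v)
        (mfderiv_sub ((contMDiffAt_extChartAt (I := J) (n := ∞) (x := F p)).mdifferentiableAt
          (by simp)) (h2.self_of_nhds.mdifferentiableAt (by simp)))
      refine h10.trans ?_
      have h11 := congrArg (fun L : E' →L[ℝ] E' => L v) (D_extChartAt_self (I := J) (F p))
      exact congrArg (fun u : E' => u - _) h11
    have h12 : D J 𝓘(ℝ, FibreModel E E') (fun q => P (ψ q - ψ (F (ρ q)))) (F p) v =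
        P (v - D I J F p (D J I ρ (F p) v)) :=
      (D_comp_apply (J := 𝓘(ℝ, E')) (F' := P) P.contMDiff.contMDiffAt h3.self_of_nhds v).trans (by
        rw [D_clm, h9])
    rw [h6, D_prodMk_space h1.self_of_nhds h4.self_of_nhds, h7, h12]
    rfl
  have hinj : Function.Injective (D J 𝓘(ℝ, E') Φ (F p)) := by
    refine (injective_iff_map_eq_zero _).2 fun v hv => ?_
    rw [hD, e.map_eq_zero_iff] at hv
    have h13 : D J I ρ (F p) v = 0 := congrArg Prod.fst hv
    have h14 := congrArg Prod.snd hv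
    simp only [h13, map_zero, sub_zero] at h14
    exact hP v h13 h14
  obtain ⟨c, hcm, hpc, hval⟩ := exists_chart h5 hinj
  -- The domain chart is shrunk to the set where ρ ∘ F is the identity and `F` stays in the new
  -- chart of the target.
  obtain ⟨W, hW, hWo, hpW⟩ := mem_nhds_iff.1
    (h.and ((hF p).continuousAt.eventually (c.open_source.mem_nhds hpc)))
  refine .mk_of_continuousAt (hF p).continuousAt e ((chartAt H p).restr W) c
    ⟨mem_chart_source H p, by rwa [hWo.interior_eq]⟩ hpc
    (restr_mem_maximalAtlas _ (IsManifold.chart_mem_maximalAtlas p) hWo) hcm fun z hz => ?_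
  rw [OpenPartialHomeomorph.extend_target] at hz
  obtain ⟨h15, h16⟩ : I.symm z ∈ (chartAt H p).target ∧ (chartAt H p).symm (I.symm z) ∈ W := by
    have h1' : I.symm z ∈ (chartAt H p).target ∧ (chartAt H p).symm (I.symm z) ∈ interior W := hz.1
    rwa [hWo.interior_eq] at h1'
  obtain ⟨h17, h18⟩ := hW h16
  change J (c (F ((chartAt H p).symm (I.symm z)))) = e (z, 0)
  rw [hval _ h18]
  simp only [Φ]
  rw [h17, sub_self, map_zero]
  refine congrArg (fun u => e (u, 0)) ?_
  change I (chartAt H p ((chartAt H p).symm (I.symm z))) = z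
  rw [(chartAt H p).right_inv h15, I.right_inv (by rw [I.range_eq_univ]; trivial)]

end normalForms

/-! ### Subsets with smooth local coordinates as submanifolds -/

section submanifolds

variable {E H : Type*}
  [NormedAddCommGroup E] [NormedSpace ℝ E] [TopologicalSpace H] {I : ModelWithCorners ℝ E H}
  {V : Type*} [NormedAddCommGroup V] [NormedSpace ℝ V]
  {N : Type*} [TopologicalSpace N] [ChartedSpace H N]

variable (I V) in
/-- Coordinates on a part of a subset of a manifold. -/
structure SubmanifoldChart (S : Set N) where
  coord : N → V
  param : V → N
  source : Set N
  target : Set V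
  isOpen_source : IsOpen source
  isOpen_target : IsOpen target
  coord_mem : ∀ q ∈ source, coord q ∈ target
  param_mem : ∀ z ∈ target, param z ∈ source
  param_mem_set : ∀ z ∈ target, param z ∈ S
  param_coord : ∀ q ∈ source, q ∈ S → param (coord q) = q
  coord_param : ∀ z ∈ target, coord (param z) = z
  contMDiffOn_coord : ContMDiffOn I 𝓘(ℝ, V) ∞ coord source
  contMDiffOn_param : ContMDiffOn 𝓘(ℝ, V) I ∞ param target

open Classical in
/-- The chart defined by coordinates on a subset. -/
def SubmanifoldChart.toChart {S : Set N} (χ : SubmanifoldChart I V S) (p : S) :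
    OpenPartialHomeomorph S V where
  toFun q := χ.coord q
  -- The point `p` is a default value, taken only outside the target.
  invFun z := if h : χ.param z ∈ S then ⟨χ.param z, h⟩ else p
  source := Subtype.val ⁻¹' χ.source
  target := χ.target
  map_source' q hq := χ.coord_mem q hq
  map_target' z hz := by
    rw [dif_pos (χ.param_mem_set z hz)]
    exact χ.param_mem z hz
  left_inv' q hq := by
    have h := χ.param_coord q hq q.2
    rw [dif_pos (by rw [h]; exact q.2)]
    exact Subtype.ext h
  right_inv' z hz := by
    rw [dif_pos (χ.param_mem_set z hz)]
    exact χ.coord_param z hz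
  open_source := χ.isOpen_source.preimage continuous_subtype_val
  open_target := χ.isOpen_target
  continuousOn_toFun := χ.contMDiffOn_coord.continuousOn.comp continuous_subtype_val.continuousOn
    fun _ h => h
  continuousOn_invFun := by
    rw [Topology.IsInducing.subtypeVal.continuousOn_iff]
    refine χ.contMDiffOn_param.continuousOn.congr fun z hz => ?_
    simp only [Function.comp]
    rw [dif_pos (χ.param_mem_set z hz)]

theorem SubmanifoldChart.toChart_symm {S : Set N} (χ : SubmanifoldChart I V S) (p : S) {z : V}
    (hz : z ∈ χ.target) : ((χ.toChart p).symm z : N) = χ.param z := by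
  simp only [toChart, OpenPartialHomeomorph.coe_mk_symm, PartialEquiv.coe_symm_mk]
  rw [dif_pos (χ.param_mem_set z hz)]

variable (I V) in
/-- A manifold structure on a subset is that of a submanifold. -/
structure IsSubmanifold (S : Set N) [ChartedSpace V S] : Prop where
  contMDiff_val : ContMDiff 𝓘(ℝ, V) I ∞ (Subtype.val : S → N)
  exists_retraction : ∀ p : S, ∃ ρ : N → S,
    (∀ᶠ q in 𝓝 (p : N), ContMDiffAt I 𝓘(ℝ, V) ∞ ρ q) ∧ ∀ᶠ q : S in 𝓝 p, ρ q = q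

/-- The coordinates live on open sets of the ambient manifold. A transition map is therefore a
composite of smooth ambient maps, and an inverse chart after the coordinates is a retraction defined
on an ambient neighbourhood. -/
theorem exists_isSubmanifold {S : Set N}
    (h : ∀ p : S, ∃ χ : SubmanifoldChart I V S, (p : N) ∈ χ.source) :
    ∃ _ : ChartedSpace V S, IsManifold 𝓘(ℝ, V) ∞ S ∧ IsSubmanifold I V S := by
  choose χ hχ using h
  let inst : ChartedSpace V S :=
    { atlas := Set.range fun p => (χ p).toChart p
      chartAt := fun p => (χ p).toChart p
      mem_chart_source := hχ
      chart_mem_atlas := fun p => ⟨p, rfl⟩ }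
  have hM : IsManifold 𝓘(ℝ, V) ∞ S := by
    refine isManifold_of_contDiffOn _ _ _ ?_
    rintro _ _ ⟨p, rfl⟩ ⟨p', rfl⟩
    simp only [modelWithCornersSelf_coe, modelWithCornersSelf_coe_symm, Function.id_comp,
      Function.comp_id, Set.preimage_id, Set.range_id, Set.inter_univ]
    refine ContMDiffOn.contDiffOn (((χ p').contMDiffOn_coord.comp
      ((χ p).contMDiffOn_param.mono ?_) ?_).congr ?_)
    · exact fun q hq => hq.1
    · intro q hq
      rw [Set.mem_preimage, ← (χ p).toChart_symm p hq.1]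
      exact hq.2
    · intro q hq
      exact congrArg (χ p').coord ((χ p).toChart_symm p hq.1)
  have hc : ∀ p, ContMDiffOn 𝓘(ℝ, V) 𝓘(ℝ, V) ∞ ((χ p).toChart p).symm (χ p).target := fun p =>
    contMDiffOn_symm_of_mem_maximalAtlas (IsManifold.chart_mem_maximalAtlas p)
  refine ⟨inst, hM, fun p => ?_, fun p => ⟨fun q => ((χ p).toChart p).symm ((χ p).coord q), ?_, ?_⟩⟩
  · have h1 : ContMDiffAt 𝓘(ℝ, V) I ∞ ((χ p).param ∘ (χ p).toChart p) p :=
      ((χ p).contMDiffOn_param.contMDiffAt ((χ p).isOpen_target.mem_nhds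
        ((χ p).coord_mem p (hχ p)))).comp p
        (contMDiffAt_of_mem_maximalAtlas (IsManifold.chart_mem_maximalAtlas p) (hχ p))
    refine h1.congr_of_eventuallyEq ?_
    filter_upwards [((χ p).toChart p).open_source.mem_nhds (hχ p)] with q hq
    exact ((χ p).param_coord q hq q.2).symm
  · filter_upwards [(χ p).isOpen_source.mem_nhds (hχ p)] with q hq
    exact ((hc p).contMDiffAt ((χ p).isOpen_target.mem_nhds ((χ p).coord_mem q hq))).comp q
      ((χ p).contMDiffOn_coord.contMDiffAt ((χ p).isOpen_source.mem_nhds hq))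
  · filter_upwards [((χ p).toChart p).open_source.mem_nhds (hχ p)] with q hq
    exact ((χ p).toChart p).left_inv hq

variable {S : Set N} [ChartedSpace V S]

/-- The subspace topology gives continuity, and composing with a smooth ambient retraction gives
smoothness into the subset. -/
theorem IsSubmanifold.contMDiffAt_iff (h : IsSubmanifold I V S) {EP HP P : Type*}
    [NormedAddCommGroup EP] [NormedSpace ℝ EP] [TopologicalSpace HP]
    {IP : ModelWithCorners ℝ EP HP} [TopologicalSpace P] [ChartedSpace HP P] {f : P → S} {p : P} :
    ContMDiffAt IP 𝓘(ℝ, V) ∞ f p ↔ ContMDiffAt IP I ∞ (fun q => (f q : N)) p := by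
  refine ⟨fun hf => (h.contMDiff_val _).comp p hf, fun hf => ?_⟩
  obtain ⟨ρ, h1, h2⟩ := h.exists_retraction (f p)
  have hc : ContinuousAt f p := Topology.IsInducing.subtypeVal.continuousAt_iff.2 hf.continuousAt
  refine (h1.self_of_nhds.comp p hf).congr_of_eventuallyEq ?_
  filter_upwards [hc.eventually h2] with q hq
  exact hq.symm

theorem IsSubmanifold.isSmoothEmbedding (h : IsSubmanifold I V S) [FiniteDimensional ℝ E]
    [FiniteDimensional ℝ V] [IsManifold I ∞ N] [IsManifold 𝓘(ℝ, V) ∞ S] [I.Boundaryless] :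
    IsSmoothEmbedding 𝓘(ℝ, V) I ∞ (Subtype.val : S → N) := by
  refine ⟨IsImmersionOfComplement.isImmersion (F := FibreModel V E) fun p => ?_,
    Topology.IsEmbedding.subtypeVal⟩
  obtain ⟨ρ, h1, h2⟩ := h.exists_retraction p
  exact isImmersionAt_of_leftInverse h.contMDiff_val h1 h2

end submanifolds

/-! ### Horizontal vectors as pairs of tangent vectors -/

section horizontal

variable {E H E' H' : Type*}
  [NormedAddCommGroup E] [NormedSpace ℝ E] [TopologicalSpace H]
  [NormedAddCommGroup E'] [NormedSpace ℝ E'] [TopologicalSpace H']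
  {I : ModelWithCorners ℝ E H} {J : ModelWithCorners ℝ E' H'}
  {M N : Type*} [TopologicalSpace M] [ChartedSpace H M] [IsManifold I ∞ M]
  [TopologicalSpace N] [ChartedSpace H' N] [IsManifold J ∞ N]

variable (I) in
/-- The tangent map of the bundle projection. -/
def tproj (ξ : TangentBundle I.tangent (TangentBundle I M)) : TangentBundle I M :=
  tangentMap I.tangent I (Bundle.TotalSpace.proj : TangentBundle I M → M) ξ

theorem tproj_tt (x : M) (e w η : E) : tproj I (tt I x e w η) = vec I x w :=
  vec_inj.2 (D_proj (vec I x e) (w, η))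

theorem contMDiff_tproj : ContMDiff I.tangent.tangent I.tangent ∞ (tproj I (M := M)) :=
  contMDiff_tangentMap fun _ => contMDiffAt_proj

theorem contMDiff_proj : ContMDiff I.tangent I ∞
    (Bundle.TotalSpace.proj : TangentBundle I M → M) := fun _ => contMDiffAt_proj

/-- The tangent functor applied to the naturality of the bundle projection. Under this second
projection the groupoid maps of TTG become those of TG. -/
theorem tproj_tangentMap {F : M → N} (hF : ContMDiff I J ∞ F)
    (ξ : TangentBundle I.tangent (TangentBundle I M)) :
    tproj J (tangentMap I.tangent J.tangent (tangentMap I J F) ξ) = tangentMap I J F (tproj I ξ) := by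
  have h1 := tangentMap_comp_at (I := I.tangent) (I' := J.tangent) (I'' := J) ξ
    (contMDiffAt_proj.mdifferentiableAt (by simp))
    ((contMDiff_tangentMap hF ξ.proj).mdifferentiableAt (by simp))
  have h2 := tangentMap_comp_at (I := I.tangent) (I' := I) (I'' := J) ξ
    ((hF _).mdifferentiableAt (by simp)) (contMDiffAt_proj.mdifferentiableAt (by simp))
  exact h1.symm.trans h2

variable [FiniteDimensional ℝ E] [T2Space M] [I.Boundaryless]

/-- The horizontal lift. -/
def Conn.lift (cov : Conn I M) (x : M) (e w : E) : TangentBundle I.tangent (TangentBundle I M) :=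
  tt I x e w (-cov.Γ x e w)

theorem Conn.lift_mem (cov : Conn I M) (x : M) (e w : E) : cov.lift x e w ∈ cov.horizontal :=
  Conn.tt_mem_iff.2 rfl

theorem Conn.eq_lift {cov : Conn I M} {ξ : TangentBundle I.tangent (TangentBundle I M)}
    (h : ξ ∈ cov.horizontal) : ξ = cov.lift ξ.proj.proj (fib ξ.proj) (fib (tproj I ξ)) := by
  obtain ⟨x, e, w, η, rfl⟩ : ∃ (x : M) (e w η : E), ξ = tt I x e w η := ⟨_, _, _, _, tt_surj ξ⟩
  rw [tproj_tt, Conn.tt_mem_iff.1 h]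
  rfl

/-- A horizontal vector is the lift of its two projections to TM, so identities between horizontal
vectors reduce to two identities in TM. -/
theorem Conn.horizontal_ext {cov : Conn I M} {ξ ζ : TangentBundle I.tangent (TangentBundle I M)}
    (hξ : ξ ∈ cov.horizontal) (hζ : ζ ∈ cov.horizontal) (h1 : ξ.proj = ζ.proj)
    (h2 : tproj I ξ = tproj I ζ) : ξ = ζ := by
  rw [Conn.eq_lift hξ, Conn.eq_lift hζ, h1, h2]

theorem Conn.tproj_lift (cov : Conn I M) (x : M) (e w : E) : tproj I (cov.lift x e w) = vec I x w :=
  tproj_tt x e w _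

end horizontal

/-! ### Charts on the horizontal distribution -/

section charts

variable {E M : Type*} [NormedAddCommGroup E] [NormedSpace ℝ E] [TopologicalSpace M]
  [ChartedSpace E M] [IsManifold 𝓘(ℝ, E) ∞ M]

/-- The tangent vector at `y` with given components in the chart at `x`. -/
def ofCrd (x y : M) (v : E) : E :=
  (trivializationAt E (TangentSpace 𝓘(ℝ, E) : M → Type _) x).symm y v

theorem crd_ofCrd {x y : M} (hy : y ∈ (chartAt E x).source) (v : E) :
    crd 𝓘(ℝ, E) x (vec 𝓘(ℝ, E) y (ofCrd x y v)) = v :=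
  congrArg Prod.snd
    ((trivializationAt E (TangentSpace 𝓘(ℝ, E) : M → Type _) x).apply_mk_symm hy v)

theorem ofCrd_crd {x y : M} (hy : y ∈ (chartAt E x).source) (v : E) :
    ofCrd x y (crd 𝓘(ℝ, E) x (vec 𝓘(ℝ, E) y v)) = v :=
  (crd_inj x hy).1 (crd_ofCrd hy _)

theorem contMDiffOn_ofCrd (x : M) {X : Type*} [NormedAddCommGroup X] [NormedSpace ℝ X]
    (f : X →L[ℝ] E) (g : X →L[ℝ] E) : ContMDiffOn 𝓘(ℝ, X) 𝓘(ℝ, E).tangent ∞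
      (fun z => vec 𝓘(ℝ, E) ((chartAt E x).symm (f z)) (ofCrd x ((chartAt E x).symm (f z)) (g z)))
      (f ⁻¹' (chartAt E x).target) := by
  have ho : IsOpen (f ⁻¹' (chartAt E x).target) := (chartAt E x).open_target.preimage f.continuous
  intro z hz
  have hs : ∀ z, f z ∈ (chartAt E x).target → (chartAt E x).symm (f z) ∈ (chartAt E x).source :=
    fun z h => (chartAt E x).map_target h
  refine ((contMDiffAt_vec_iff' (b := fun z => (chartAt E x).symm (f z)) x (hs z hz)).2
    ⟨?_, ?_⟩).contMDiffWithinAt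
  · exact ((contMDiffOn_chart_symm (I := 𝓘(ℝ, E)) (x := x)).contMDiffAt
      ((chartAt E x).open_target.mem_nhds hz)).comp z f.contMDiff.contMDiffAt
  · refine (g.contMDiff.contMDiffAt (x := z)).congr_of_eventuallyEq ?_
    filter_upwards [ho.mem_nhds hz] with z' hz'
    exact crd_ofCrd (hs z' hz') _

variable [FiniteDimensional ℝ E] [T2Space M]

/-- The coordinates on the horizontal distribution given by the chart at `x`. -/
def horizontalChart {cov : Conn 𝓘(ℝ, E) M} (hc : cov.IsSmooth) (x : M) :
    SubmanifoldChart 𝓘(ℝ, E).tangent.tangent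
      (EuclideanSpace ℝ (Fin (Module.finrank ℝ (E × E × E)))) cov.horizontal where
  -- The coordinates of the two projections to TM, over their common base point, which exhibits the
  -- distribution as TM ⊕ TM. The passage to Euclidean space matches the models required in
  -- `IsLieSubgroupoid`.
  coord ξ := toEuclidean (chartAt E x ξ.proj.proj, crd 𝓘(ℝ, E) x ξ.proj,
    crd 𝓘(ℝ, E) x (tproj 𝓘(ℝ, E) ξ))
  param z :=
    let p : E × E × E := toEuclidean.symm z
    let y := (chartAt E x).symm p.1
    cov.lift y (ofCrd x y p.2.1) (ofCrd x y p.2.2)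
  source := {ξ | ξ.proj.proj ∈ (chartAt E x).source}
  target := {z | ((toEuclidean.symm z : E × E × E)).1 ∈ (chartAt E x).target}
  isOpen_source := (chartAt E x).open_source.preimage
    ((contMDiff_proj (I := 𝓘(ℝ, E))).continuous.comp
      (contMDiff_proj (I := 𝓘(ℝ, E).tangent)).continuous)
  isOpen_target := (chartAt E x).open_target.preimage
    (continuous_fst.comp toEuclidean.symm.continuous)
  coord_mem ξ hξ := by
    simp only [Set.mem_ofPred_eq, ContinuousLinearEquiv.symm_apply_apply]
    exact (chartAt E x).map_source hξ
  param_mem z hz := (chartAt E x).map_target hz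
  param_mem_set z _ := cov.lift_mem _ _ _
  param_coord ξ hξ hξ' := by
    have h1 : (chartAt E x).symm (chartAt E x ξ.proj.proj) = ξ.proj.proj :=
      (chartAt E x).left_inv hξ
    simp only [ContinuousLinearEquiv.symm_apply_apply]
    rw [h1]
    refine Eq.trans ?_ (Conn.eq_lift hξ').symm
    exact congrArg₂ (cov.lift ξ.proj.proj) (ofCrd_crd hξ (fib ξ.proj))
      (ofCrd_crd hξ (fib (tproj 𝓘(ℝ, E) ξ)))
  coord_param z hz := by
    have h1 := (chartAt E x).map_target hz
    rw [← ContinuousLinearEquiv.eq_symm_apply]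
    refine Prod.ext ((chartAt E x).right_inv hz) (Prod.ext (crd_ofCrd h1 _) ?_)
    simp only [cov.tproj_lift]
    exact crd_ofCrd h1 _
  contMDiffOn_coord := by
    have h0 : ContMDiff 𝓘(ℝ, E).tangent.tangent 𝓘(ℝ, E) ∞
        fun ξ : TangentBundle 𝓘(ℝ, E).tangent (TangentBundle 𝓘(ℝ, E) M) => ξ.proj.proj :=
      (contMDiff_proj (I := 𝓘(ℝ, E))).comp (contMDiff_proj (I := 𝓘(ℝ, E).tangent))
    intro ξ hξ
    have h1 : ContMDiffAt 𝓘(ℝ, E).tangent.tangent 𝓘(ℝ, E) ∞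
        (fun ξ : TangentBundle 𝓘(ℝ, E).tangent (TangentBundle 𝓘(ℝ, E) M) =>
          chartAt E x ξ.proj.proj) ξ :=
      (contMDiffAt_of_mem_maximalAtlas (IsManifold.chart_mem_maximalAtlas x) hξ).comp ξ (h0 ξ)
    have h2 := (contMDiffAt_crd (I := 𝓘(ℝ, E)) (x := x) (p := ξ.proj) hξ).comp ξ
      (contMDiff_proj (I := 𝓘(ℝ, E).tangent) ξ)
    have h3 := (contMDiffAt_crd (I := 𝓘(ℝ, E)) (x := x) (p := tproj 𝓘(ℝ, E) ξ) hξ).comp ξ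
      (contMDiff_tproj ξ)
    exact ((toEuclidean (E := E × E × E)).contDiff.contMDiff.contMDiffAt.comp ξ
      (h1.prodMk_space (h2.prodMk_space h3))).contMDiffWithinAt
  contMDiffOn_param := by
    let L : EuclideanSpace ℝ (Fin (Module.finrank ℝ (E × E × E))) →L[ℝ] E × E × E :=
      (toEuclidean (E := E × E × E)).symm
    have h1 := contMDiffOn_ofCrd x ((ContinuousLinearMap.fst ℝ E (E × E)).comp L)
      ((ContinuousLinearMap.fst ℝ E E).comp ((ContinuousLinearMap.snd ℝ E (E × E)).comp L))
    have h2 := contMDiffOn_ofCrd x ((ContinuousLinearMap.fst ℝ E (E × E)).comp L)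
      ((ContinuousLinearMap.snd ℝ E E).comp ((ContinuousLinearMap.snd ℝ E (E × E)).comp L))
    have ho : IsOpen (((ContinuousLinearMap.fst ℝ E (E × E)).comp L) ⁻¹' (chartAt E x).target) :=
      (chartAt E x).open_target.preimage (ContinuousLinearMap.continuous _)
    intro z hz
    exact (hc.contMDiffAt_lift (h1.contMDiffAt (ho.mem_nhds hz))
      (h2.contMDiffAt (ho.mem_nhds hz))).contMDiffWithinAt

theorem exists_isSubmanifold_horizontal {cov : Conn 𝓘(ℝ, E) M} (hc : cov.IsSmooth) :
    ∃ _ : ChartedSpace (EuclideanSpace ℝ (Fin (Module.finrank ℝ (E × E × E)))) cov.horizontal,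
      IsManifold 𝓘(ℝ, EuclideanSpace ℝ (Fin (Module.finrank ℝ (E × E × E)))) ∞ cov.horizontal ∧
      IsSubmanifold 𝓘(ℝ, E).tangent.tangent
        (EuclideanSpace ℝ (Fin (Module.finrank ℝ (E × E × E)))) cov.horizontal :=
  exists_isSubmanifold fun p => ⟨horizontalChart hc p.1.proj.proj, mem_chart_source E _⟩

end charts

/-! ### The defect of the transformation law -/

section obstruction

variable {E H E' H' E'' H'' : Type*}
  [NormedAddCommGroup E] [NormedSpace ℝ E] [TopologicalSpace H]
  [NormedAddCommGroup E'] [NormedSpace ℝ E'] [TopologicalSpace H']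
  [NormedAddCommGroup E''] [NormedSpace ℝ E''] [TopologicalSpace H'']
  {I : ModelWithCorners ℝ E H} {J : ModelWithCorners ℝ E' H'} {K : ModelWithCorners ℝ E'' H''}
  {M N Q : Type*} [TopologicalSpace M] [ChartedSpace H M] [TopologicalSpace N] [ChartedSpace H' N]
  [TopologicalSpace Q] [ChartedSpace H'' Q] [IsManifold I ∞ M] [IsManifold J ∞ N]
  [IsManifold K ∞ Q] [I.Boundaryless] [J.Boundaryless]

variable (I J) in
/-- The failure of the transformation law of Christoffel symbols. -/
def obstruction (F : M → N) (γ : M → E → E → E) (γ' : N → E' → E' → E') (x : M) (e w : E) : E' :=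
  hess I J F x w e + γ' (F x) (D I J F x e) (D I J F x w) - D I J F x (γ x e w)

theorem relChr_iff_obstruction {F : M → N} {γ : M → E → E → E} {γ' : N → E' → E' → E'} :
    RelChr I J F γ γ' ↔ ∀ x e w, obstruction I J F γ γ' x e w = 0 :=
  forall_congr' fun _ => forall_congr' fun _ => forall_congr' fun _ => by
    rw [obstruction, sub_eq_zero, eq_comm]

/-- If the second map obeys the law, its Hessian contributions cancel and the defect of the
composite is the image of the defect of the first map. Defects can thus be treated as tangent
vectors and compared by means of groupoid identities. -/
theorem RelChr.obstruction_comp {F : M → N} {F' : N → Q} (hF : ContMDiff I J ∞ F)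
    (hF' : ContMDiff J K ∞ F') {γ : M → E → E → E} {γ' : N → E' → E' → E'}
    {γ'' : Q → E'' → E'' → E''} (h : RelChr J K F' γ' γ'') (x : M) (e w : E) :
    obstruction I K (F' ∘ F) γ γ'' x e w = D J K F' (F x) (obstruction I J F γ γ' x e w) := by
  rw [obstruction, obstruction, hess_comp (hF' _) (hF x), D_comp_apply (hF' _) (hF x),
    D_comp_apply (hF' _) (hF x), D_comp_apply (hF' _) (hF x), map_sub, map_add, h]
  simp only [Function.comp_apply]
  abel

theorem RelChr.refl (γ : M → E → E → E) : RelChr I I id γ γ := by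
  intro x e w
  have h := hess_comp (I := I) (J := I) (K := I) (F := id) (F' := id) (x := x) contMDiffAt_id
    contMDiffAt_id w e
  simp only [D_id, Function.comp_id, ContinuousLinearMap.id_apply, id_eq] at h
  -- The chain rule for id ∘ id says that the Hessian of the identity is twice itself, hence zero.
  rw [left_eq_add] at h
  rw [D_id, ContinuousLinearMap.id_apply, ContinuousLinearMap.id_apply,
    ContinuousLinearMap.id_apply, h, zero_add, id_eq]

end obstruction

/-! ### The tangent groupoid: units, inverses, associativity -/

namespace LieGroupoid

variable {EM EG M G : Type*}
  [NormedAddCommGroup EM] [NormedSpace ℝ EM] [FiniteDimensional ℝ EM]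
  [NormedAddCommGroup EG] [NormedSpace ℝ EG] [FiniteDimensional ℝ EG]
  [TopologicalSpace M] [ChartedSpace EM M] [IsManifold 𝓘(ℝ, EM) ∞ M]
  [TopologicalSpace G] [ChartedSpace EG G] [IsManifold 𝓘(ℝ, EG) ∞ G]
  (K : LieGroupoid EM EG M G)

/-- A map to the composable pairs. -/
def pairMap {P : Type*} (f₁ f₂ : P → G) (h : ∀ q, K.src (f₁ q) = K.tgt (f₂ q)) (q : P) :
    K.Composable := ⟨f₁ q, f₂ q, h q⟩

section pairMap

variable {EP HP P : Type*} [NormedAddCommGroup EP] [NormedSpace ℝ EP] [TopologicalSpace HP]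
  {IP : ModelWithCorners ℝ EP HP} [TopologicalSpace P] [ChartedSpace HP P]

variable {K} in
theorem contMDiff_pairMap {f₁ f₂ : P → G} (h : ∀ q, K.src (f₁ q) = K.tgt (f₂ q))
    (h₁ : ContMDiff IP 𝓘(ℝ, EG) ∞ f₁) (h₂ : ContMDiff IP 𝓘(ℝ, EG) ∞ f₂) :
    ContMDiff IP 𝓘(ℝ, PairModel EM EG) ∞ (K.pairMap f₁ f₂ h) := fun q =>
  contMDiffAt_composable.2 ⟨h₁ q, h₂ q⟩

variable {K} in
theorem D_fst_of_eventuallyEq {f : P → K.Composable} {f₁ : P → G} {q : P}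
    (hf : ContMDiffAt IP 𝓘(ℝ, PairModel EM EG) ∞ f q) (h : ∀ᶠ p in 𝓝 q, (f p).fst = f₁ p)
    (v : EP) : D 𝓘(ℝ, PairModel EM EG) 𝓘(ℝ, EG) SourceTarget.Composable.fst (f q)
      (D IP 𝓘(ℝ, PairModel EM EG) f q v) = D IP 𝓘(ℝ, EG) f₁ q v := by
  rw [← D_comp_apply (K.contMDiff_composable_fst _) hf]
  exact congrArg (fun L : EP →L[ℝ] EG => L v) (D_congr h)

variable {K} in
theorem D_snd_of_eventuallyEq {f : P → K.Composable} {f₂ : P → G} {q : P}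
    (hf : ContMDiffAt IP 𝓘(ℝ, PairModel EM EG) ∞ f q) (h : ∀ᶠ p in 𝓝 q, (f p).snd = f₂ p)
    (v : EP) : D 𝓘(ℝ, PairModel EM EG) 𝓘(ℝ, EG) SourceTarget.Composable.snd (f q)
      (D IP 𝓘(ℝ, PairModel EM EG) f q v) = D IP 𝓘(ℝ, EG) f₂ q v := by
  rw [← D_comp_apply (K.contMDiff_composable_snd _) hf]
  exact congrArg (fun L : EP →L[ℝ] EG => L v) (D_congr h)

end pairMap

/-- The derivative of the multiplication by a unit from the right. -/
theorem D_mul_unit {c : K.Composable} (hc : c.snd = K.unit (K.src c.fst)) {d : PairModel EM EG}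
    (h : D 𝓘(ℝ, PairModel EM EG) 𝓘(ℝ, EG) SourceTarget.Composable.snd c d =
      D 𝓘(ℝ, EM) 𝓘(ℝ, EG) K.unit (K.src c.fst) (D 𝓘(ℝ, EG) 𝓘(ℝ, EM) K.src c.fst
        (D 𝓘(ℝ, PairModel EM EG) 𝓘(ℝ, EG) SourceTarget.Composable.fst c d))) :
    D 𝓘(ℝ, PairModel EM EG) 𝓘(ℝ, EG) K.mul c d =
      D 𝓘(ℝ, PairModel EM EG) 𝓘(ℝ, EG) SourceTarget.Composable.fst c d := by
  obtain ⟨g, k, H⟩ := c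
  dsimp only at hc h ⊢
  subst hc
  -- The vector `d` is tangent to the map g ↦ (g, u(s g)), along which the multiplication is the
  -- identity.
  let f := K.pairMap id (K.unit ∘ K.src) fun q => (K.tgt_unit _).symm
  have hf : ContMDiff 𝓘(ℝ, EG) 𝓘(ℝ, PairModel EM EG) ∞ f :=
    contMDiff_pairMap _ contMDiff_id (K.contMDiff_unit.comp K.contMDiff_src)
  set v := D 𝓘(ℝ, PairModel EM EG) 𝓘(ℝ, EG) SourceTarget.Composable.fst (⟨g, _, H⟩ : K.Composable) d
  have h1 : D 𝓘(ℝ, EG) 𝓘(ℝ, PairModel EM EG) f g v = d := by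
    refine K.D_composable_inj (c := f g) ?_ ?_
    · refine (D_fst_of_eventuallyEq (f₁ := id) (hf g) (.of_forall fun _ => rfl) v).trans ?_
      rw [D_id]
      rfl
    · refine (D_snd_of_eventuallyEq (f₂ := K.unit ∘ K.src) (hf g) (.of_forall fun _ => rfl)
        v).trans ?_
      rw [D_comp_apply (K.contMDiff_unit _) (K.contMDiff_src g)]
      exact h.symm
  rw [← h1]
  refine (D_comp_apply (K.contMDiff_mul (f g)) (hf g) v).symm.trans ?_
  have h2 : K.mul ∘ f = id := funext K.mul_unit
  rw [h2, D_id]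
  rfl

/-- The derivative of the multiplication by a unit from the left. -/
theorem D_unit_mul {c : K.Composable} (hc : c.fst = K.unit (K.tgt c.snd)) {d : PairModel EM EG}
    (h : D 𝓘(ℝ, PairModel EM EG) 𝓘(ℝ, EG) SourceTarget.Composable.fst c d =
      D 𝓘(ℝ, EM) 𝓘(ℝ, EG) K.unit (K.tgt c.snd) (D 𝓘(ℝ, EG) 𝓘(ℝ, EM) K.tgt c.snd
        (D 𝓘(ℝ, PairModel EM EG) 𝓘(ℝ, EG) SourceTarget.Composable.snd c d))) :
    D 𝓘(ℝ, PairModel EM EG) 𝓘(ℝ, EG) K.mul c d =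
      D 𝓘(ℝ, PairModel EM EG) 𝓘(ℝ, EG) SourceTarget.Composable.snd c d := by
  obtain ⟨k, g, H⟩ := c
  dsimp only at hc h ⊢
  subst hc
  let f := K.pairMap (K.unit ∘ K.tgt) id fun q => K.src_unit _
  have hf : ContMDiff 𝓘(ℝ, EG) 𝓘(ℝ, PairModel EM EG) ∞ f :=
    contMDiff_pairMap _ (K.contMDiff_unit.comp K.contMDiff_tgt) contMDiff_id
  set v := D 𝓘(ℝ, PairModel EM EG) 𝓘(ℝ, EG) SourceTarget.Composable.snd (⟨_, g, H⟩ : K.Composable) d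
  have h1 : D 𝓘(ℝ, EG) 𝓘(ℝ, PairModel EM EG) f g v = d := by
    refine K.D_composable_inj (c := f g) ?_ ?_
    · refine (D_fst_of_eventuallyEq (f₁ := K.unit ∘ K.tgt) (hf g) (.of_forall fun _ => rfl)
        v).trans ?_
      rw [D_comp_apply (K.contMDiff_unit _) (K.contMDiff_tgt g)]
      exact h.symm
    · refine (D_snd_of_eventuallyEq (f₂ := id) (hf g) (.of_forall fun _ => rfl) v).trans ?_
      rw [D_id]
      rfl
  rw [← h1]
  refine (D_comp_apply (K.contMDiff_mul (f g)) (hf g) v).symm.trans ?_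
  have h2 : K.mul ∘ f = id := funext K.unit_mul
  rw [h2, D_id]
  rfl

/-- The right translations are immersions. -/
theorem D_fst_eq_zero {c : K.Composable} {d : PairModel EM EG}
    (hm : D 𝓘(ℝ, PairModel EM EG) 𝓘(ℝ, EG) K.mul c d = 0)
    (hd : D 𝓘(ℝ, PairModel EM EG) 𝓘(ℝ, EG) SourceTarget.Composable.snd c d = 0) :
    D 𝓘(ℝ, PairModel EM EG) 𝓘(ℝ, EG) SourceTarget.Composable.fst c d = 0 := by
  -- The map (g, h) ↦ (g h, h⁻¹), followed by the multiplication, gives g back; the hypotheses say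
  -- that its tangent map kills `d`.
  let f := K.pairMap (P := K.Composable) K.mul (K.inv ∘ SourceTarget.Composable.snd) fun q =>
    (K.src_mul q).trans (K.tgt_inv _).symm
  have hf : ContMDiff 𝓘(ℝ, PairModel EM EG) 𝓘(ℝ, PairModel EM EG) ∞ f :=
    contMDiff_pairMap _ K.contMDiff_mul (K.contMDiff_inv.comp K.contMDiff_composable_snd)
  have h1 : D 𝓘(ℝ, PairModel EM EG) 𝓘(ℝ, PairModel EM EG) f c d = 0 := by
    refine K.D_composable_inj (c := f c) ?_ ?_
    · refine (D_fst_of_eventuallyEq (f₁ := K.mul) (hf c) (.of_forall fun _ => rfl) d).trans ?_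
      rw [hm, map_zero]
    · refine (D_snd_of_eventuallyEq (f₂ := K.inv ∘ SourceTarget.Composable.snd) (hf c)
        (.of_forall fun _ => rfl) d).trans ?_
      rw [D_comp_apply (K.contMDiff_inv _) (K.contMDiff_composable_snd c), hd, map_zero, map_zero]
  have h2 : K.mul ∘ f = SourceTarget.Composable.fst := funext fun c =>
    K.mul_mul_inv_cancel c.fst c.snd c.src_fst
  rw [← h2, D_comp_apply (K.contMDiff_mul _) (hf c), h1, map_zero]

section relChr

variable {K} {γ : G → EG → EG → EG} {γM : M → EM → EM → EM}
  {γC : K.Composable → PairModel EM EG → PairModel EM EG → PairModel EM EG}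

/-- Let δ be the defect of u. From s ∘ u = t ∘ u = id, both ds and dt kill δ. The defect of y ↦
(u(y), u(y)) has components (δ, δ) and is mapped to δ by dm. But (δ, δ) = (δ, 0) + (0, δ), and dm
sends each summand to δ by the unit laws. So δ + δ = δ. -/
theorem relChr_unit (hs : RelChr 𝓘(ℝ, EG) 𝓘(ℝ, EM) K.src γ γM)
    (ht : RelChr 𝓘(ℝ, EG) 𝓘(ℝ, EM) K.tgt γ γM)
    (h1 : RelChr 𝓘(ℝ, PairModel EM EG) 𝓘(ℝ, EG) SourceTarget.Composable.fst γC γ)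
    (h2 : RelChr 𝓘(ℝ, PairModel EM EG) 𝓘(ℝ, EG) SourceTarget.Composable.snd γC γ)
    (hm : RelChr 𝓘(ℝ, PairModel EM EG) 𝓘(ℝ, EG) K.mul γC γ) :
    RelChr 𝓘(ℝ, EM) 𝓘(ℝ, EG) K.unit γM γ := by
  refine relChr_iff_obstruction.2 fun y e w => ?_
  let f := K.pairMap K.unit K.unit fun q => (K.src_unit q).trans (K.tgt_unit q).symm
  have hf : ContMDiff 𝓘(ℝ, EM) 𝓘(ℝ, PairModel EM EG) ∞ f :=
    contMDiff_pairMap _ K.contMDiff_unit K.contMDiff_unit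
  set δ := obstruction 𝓘(ℝ, EM) 𝓘(ℝ, EG) K.unit γM γ y e w with hδ
  set d := obstruction 𝓘(ℝ, EM) 𝓘(ℝ, PairModel EM EG) f γM γC y e w
  have hsδ : D 𝓘(ℝ, EG) 𝓘(ℝ, EM) K.src (K.unit y) δ = 0 := by
    rw [hδ, ← hs.obstruction_comp K.contMDiff_unit K.contMDiff_src]
    have h : K.src ∘ K.unit = id := funext K.src_unit
    rw [h]
    exact relChr_iff_obstruction.1 (RelChr.refl γM) y e w
  have htδ : D 𝓘(ℝ, EG) 𝓘(ℝ, EM) K.tgt (K.unit y) δ = 0 := by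
    rw [hδ, ← ht.obstruction_comp K.contMDiff_unit K.contMDiff_tgt]
    have h : K.tgt ∘ K.unit = id := funext K.tgt_unit
    rw [h]
    exact relChr_iff_obstruction.1 (RelChr.refl γM) y e w
  have hd1 : D 𝓘(ℝ, PairModel EM EG) 𝓘(ℝ, EG) SourceTarget.Composable.fst (f y) d = δ :=
    (h1.obstruction_comp hf K.contMDiff_composable_fst y e w).symm
  have hd2 : D 𝓘(ℝ, PairModel EM EG) 𝓘(ℝ, EG) SourceTarget.Composable.snd (f y) d = δ :=
    (h2.obstruction_comp hf K.contMDiff_composable_snd y e w).symm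
  have hdm : D 𝓘(ℝ, PairModel EM EG) 𝓘(ℝ, EG) K.mul (f y) d = δ := by
    refine (hm.obstruction_comp hf K.contMDiff_mul y e w).symm.trans ?_
    have h : K.mul ∘ f = K.unit := funext fun z =>
      (K.mul_congr (congrArg K.unit (K.tgt_unit z)).symm rfl _).trans (K.unit_mul (K.unit z))
    rw [h]
  obtain ⟨d₁, h11, h12⟩ := K.exists_D_composable (f y) (v₁ := δ) (v₂ := 0)
    (by rw [map_zero]; exact hsδ)
  obtain ⟨d₂, h21, h22⟩ := K.exists_D_composable (f y) (v₁ := 0) (v₂ := δ)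
    (by rw [map_zero]; exact htδ.symm)
  have hdd : d = d₁ + d₂ := K.D_composable_inj (c := f y)
    (by rw [map_add, hd1, h11, h21, add_zero]) (by rw [map_add, hd2, h12, h22, zero_add])
  have hm1 := K.D_mul_unit (c := f y) (d := d₁) (congrArg K.unit (K.src_unit y).symm) (by
    rw [h12, h11]
    change 0 = D 𝓘(ℝ, EM) 𝓘(ℝ, EG) K.unit _ (D 𝓘(ℝ, EG) 𝓘(ℝ, EM) K.src (K.unit y) δ)
    rw [hsδ, map_zero])
  have hm2 := K.D_unit_mul (c := f y) (d := d₂) (congrArg K.unit (K.tgt_unit y).symm) (by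
    rw [h21, h22]
    change 0 = D 𝓘(ℝ, EM) 𝓘(ℝ, EG) K.unit _ (D 𝓘(ℝ, EG) 𝓘(ℝ, EM) K.tgt (K.unit y) δ)
    rw [htδ, map_zero])
  rw [hdd, map_add, hm1, hm2, h11, h22] at hdm
  exact add_eq_left.1 hdm

/-- The defect of g ↦ (g⁻¹, g) has second component zero, and dm kills it because m of this map is u
∘ s, which obeys the law. Right translations are immersions, so the first component, the defect of
the inversion, vanishes. -/
theorem relChr_inv (hs : RelChr 𝓘(ℝ, EG) 𝓘(ℝ, EM) K.src γ γM)
    (ht : RelChr 𝓘(ℝ, EG) 𝓘(ℝ, EM) K.tgt γ γM)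
    (h1 : RelChr 𝓘(ℝ, PairModel EM EG) 𝓘(ℝ, EG) SourceTarget.Composable.fst γC γ)
    (h2 : RelChr 𝓘(ℝ, PairModel EM EG) 𝓘(ℝ, EG) SourceTarget.Composable.snd γC γ)
    (hm : RelChr 𝓘(ℝ, PairModel EM EG) 𝓘(ℝ, EG) K.mul γC γ) :
    RelChr 𝓘(ℝ, EG) 𝓘(ℝ, EG) K.inv γ γ := by
  refine relChr_iff_obstruction.2 fun g e w => ?_
  let f := K.pairMap K.inv id K.src_inv
  have hf : ContMDiff 𝓘(ℝ, EG) 𝓘(ℝ, PairModel EM EG) ∞ f :=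
    contMDiff_pairMap _ K.contMDiff_inv contMDiff_id
  refine (h1.obstruction_comp hf K.contMDiff_composable_fst g e w).trans ?_
  refine K.D_fst_eq_zero ?_ ?_
  · refine (hm.obstruction_comp hf K.contMDiff_mul g e w).symm.trans ?_
    have h : K.mul ∘ f = K.unit ∘ K.src := funext K.inv_mul
    rw [h]
    exact relChr_iff_obstruction.1 (hs.comp K.contMDiff_src K.contMDiff_unit
      (relChr_unit hs ht h1 h2 hm)) g e w
  · refine (h2.obstruction_comp hf K.contMDiff_composable_snd g e w).symm.trans ?_
    exact relChr_iff_obstruction.1 (RelChr.refl γ) g e w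

end relChr

/-- A local product structure adapted to the target map. -/
theorem exists_local_product_tgt (k₀ : G) : ∃ r : M × G → G,
    ContMDiffAt (𝓘(ℝ, EM).prod 𝓘(ℝ, EG)) 𝓘(ℝ, EG) ∞ r (K.tgt k₀, k₀) ∧
    (∀ᶠ q in 𝓝 (K.tgt k₀, k₀), K.tgt (r q) = q.1) ∧ ∀ᶠ k in 𝓝 k₀, r (K.tgt k, k) = k := by
  obtain ⟨r, h1, h2, h3⟩ := K.exists_local_product (K.inv k₀)
  have h0 : (K.src (K.inv k₀), K.inv k₀) = (K.tgt k₀, K.inv k₀) := by rw [K.src_inv]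
  rw [h0] at h1 h2
  have hi : ContMDiff (𝓘(ℝ, EM).prod 𝓘(ℝ, EG)) (𝓘(ℝ, EM).prod 𝓘(ℝ, EG)) ∞
      fun q : M × G => (q.1, K.inv q.2) :=
    contMDiff_fst.prodMk (K.contMDiff_inv.comp contMDiff_snd)
  refine ⟨fun q => K.inv (r (q.1, K.inv q.2)), ?_, ?_, ?_⟩
  · exact (K.contMDiff_inv _).comp _ (ContMDiffAt.comp (K.tgt k₀, k₀) h1 (hi _))
  · have hc : ContinuousAt (fun q : M × G => (q.1, K.inv q.2)) (K.tgt k₀, k₀) := (hi _).continuousAt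
    filter_upwards [hc.eventually h2] with q hq
    rw [K.tgt_inv]
    exact hq
  · filter_upwards [(K.contMDiff_inv k₀).continuousAt.eventually h3] with k hk
    rw [K.src_inv] at hk
    rw [hk, K.inv_inv]

variable {K} in
/-- The associativity of the tangent prolongation. -/
theorem D_mul_assoc {c₁ c₂ c₃ c₄ : K.Composable} {a₁ a₂ a₃ a₄ : PairModel EM EG}
    (b₁ : c₂.fst = K.mul c₁) (b₂ : c₁.snd = c₃.fst) (b₃ : c₃.snd = c₂.snd) (b₄ : c₄.fst = c₁.fst)
    (b₅ : c₄.snd = K.mul c₃)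
    (h₁ : D 𝓘(ℝ, PairModel EM EG) 𝓘(ℝ, EG) SourceTarget.Composable.fst c₂ a₂ =
      D 𝓘(ℝ, PairModel EM EG) 𝓘(ℝ, EG) K.mul c₁ a₁)
    (h₂ : D 𝓘(ℝ, PairModel EM EG) 𝓘(ℝ, EG) SourceTarget.Composable.snd c₁ a₁ =
      D 𝓘(ℝ, PairModel EM EG) 𝓘(ℝ, EG) SourceTarget.Composable.fst c₃ a₃)
    (h₃ : D 𝓘(ℝ, PairModel EM EG) 𝓘(ℝ, EG) SourceTarget.Composable.snd c₃ a₃ =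
      D 𝓘(ℝ, PairModel EM EG) 𝓘(ℝ, EG) SourceTarget.Composable.snd c₂ a₂)
    (h₄ : D 𝓘(ℝ, PairModel EM EG) 𝓘(ℝ, EG) SourceTarget.Composable.fst c₄ a₄ =
      D 𝓘(ℝ, PairModel EM EG) 𝓘(ℝ, EG) SourceTarget.Composable.fst c₁ a₁)
    (h₅ : D 𝓘(ℝ, PairModel EM EG) 𝓘(ℝ, EG) SourceTarget.Composable.snd c₄ a₄ =
      D 𝓘(ℝ, PairModel EM EG) 𝓘(ℝ, EG) K.mul c₃ a₃) :
    D 𝓘(ℝ, PairModel EM EG) 𝓘(ℝ, EG) K.mul c₂ a₂ =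
      D 𝓘(ℝ, PairModel EM EG) 𝓘(ℝ, EG) K.mul c₄ a₄ := by
  let IP := 𝓘(ℝ, PairModel EM EG).prod 𝓘(ℝ, EG)
  set k := c₂.snd with hk
  set v := D 𝓘(ℝ, PairModel EM EG) 𝓘(ℝ, EG) SourceTarget.Composable.snd c₂ a₂ with hv
  let p₀ : K.Composable × G := (c₁, k)
  let ξ : PairModel EM EG × EG := (a₁, v)
  obtain ⟨r, hr, hr1, hr2⟩ := K.exists_local_product_tgt k
  have hsk : K.src c₁.snd = K.tgt k := by rw [b₂, c₃.src_fst, b₃]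
  let ι : K.Composable × G → M × G := fun q => (K.src q.1.snd, q.2)
  have hι₀ : ι p₀ = (K.tgt k, k) := Prod.ext hsk rfl
  have hι1 : ContMDiff IP 𝓘(ℝ, EM) ∞ fun q : K.Composable × G => K.src q.1.snd :=
    K.contMDiff_src.comp (K.contMDiff_composable_snd.comp contMDiff_fst)
  have hι2 : ContMDiff IP 𝓘(ℝ, EG) ∞ fun q : K.Composable × G => q.2 := contMDiff_snd
  have hι : ContMDiff IP (𝓘(ℝ, EM).prod 𝓘(ℝ, EG)) ∞ ι := hι1.prodMk hι2
  rw [← hι₀] at hr hr1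
  -- Composable triples near the given one are parametrized by G⁽²⁾ × G: the third arrow is moved by
  -- `r` until its target is the source of the second. No manifold of triples is needed.
  let f : K.Composable × G → G := r ∘ ι
  have hf : ContMDiffAt IP 𝓘(ℝ, EG) ∞ f p₀ := hr.comp p₀ (hι p₀)
  have hfk : f p₀ = k := (congrArg r hι₀).trans hr2.self_of_nhds
  have hft : ∀ᶠ q in 𝓝 p₀, K.src q.1.snd = K.tgt (f q) := by
    filter_upwards [(hι p₀).continuousAt.eventually hr1] with q hq
    exact hq.symm
  have hDs : D 𝓘(ℝ, EG) 𝓘(ℝ, EM) K.src c₁.snd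
      (D 𝓘(ℝ, PairModel EM EG) 𝓘(ℝ, EG) SourceTarget.Composable.snd c₁ a₁) =
      D 𝓘(ℝ, EG) 𝓘(ℝ, EM) K.tgt k v := by
    rw [h₂, b₂, K.D_src_fst, h₃, b₃]
  -- The given tangent vectors are composable, so to first order the correction by `r` leaves `v`
  -- unchanged: `r` is the identity along k ↦ (t k, k).
  have hDf : D IP 𝓘(ℝ, EG) f p₀ ξ = v := by
    have h1 : D IP (𝓘(ℝ, EM).prod 𝓘(ℝ, EG)) ι p₀ ξ = (D 𝓘(ℝ, EG) 𝓘(ℝ, EM) K.tgt k v, v) := by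
      refine (D_prodMk (hι1 p₀) (hι2 p₀) ξ).trans (Prod.ext ?_ (D_snd p₀ ξ))
      refine (D_comp_apply (J := 𝓘(ℝ, EG)) (K.contMDiff_src _)
        ((K.contMDiff_composable_snd.comp contMDiff_fst) p₀) ξ).trans ?_
      refine Eq.trans ?_ hDs
      refine congrArg (D 𝓘(ℝ, EG) 𝓘(ℝ, EM) K.src c₁.snd) ?_
      refine (D_comp_apply (J := 𝓘(ℝ, PairModel EM EG)) (K.contMDiff_composable_snd _)
        (contMDiffAt_fst (p := p₀)) ξ).trans ?_
      exact congrArg _ (D_fst p₀ ξ)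
    let κ : G → M × G := fun g => (K.tgt g, g)
    have hκ : ContMDiff 𝓘(ℝ, EG) (𝓘(ℝ, EM).prod 𝓘(ℝ, EG)) ∞ κ := K.contMDiff_tgt.prodMk contMDiff_id
    have h2 : D 𝓘(ℝ, EG) (𝓘(ℝ, EM).prod 𝓘(ℝ, EG)) κ k v = (D 𝓘(ℝ, EG) 𝓘(ℝ, EM) K.tgt k v, v) := by
      refine (D_prodMk (K.contMDiff_tgt k) (contMDiffAt_id (x := k)) v).trans (Prod.ext rfl ?_)
      exact congrArg (fun L : EG →L[ℝ] EG => L v) (D_id k)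
    have h3 : D 𝓘(ℝ, EG) 𝓘(ℝ, EG) (r ∘ κ) k v = v := by
      exact (congrArg (fun L : EG →L[ℝ] EG => L v)
        ((D_congr (F := r ∘ κ) (F' := id) hr2).trans (D_id k)))
    rw [D_comp_apply (J := 𝓘(ℝ, EM).prod 𝓘(ℝ, EG)) (by rw [hι₀] at hr; exact hr) (hκ k), h2] at h3
    refine (D_comp_apply (J := 𝓘(ℝ, EM).prod 𝓘(ℝ, EG)) hr (hι p₀) ξ).trans ?_
    rw [h1, hι₀]
    exact h3
  have hm1 : ContMDiff IP 𝓘(ℝ, EG) ∞ fun q : K.Composable × G => K.mul q.1 :=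
    K.contMDiff_mul.comp contMDiff_fst
  have hg1 : ContMDiff IP 𝓘(ℝ, EG) ∞ fun q : K.Composable × G => q.1.fst :=
    K.contMDiff_composable_fst.comp contMDiff_fst
  have hg2 : ContMDiff IP 𝓘(ℝ, EG) ∞ fun q : K.Composable × G => q.1.snd :=
    K.contMDiff_composable_snd.comp contMDiff_fst
  obtain ⟨Φ₂, hΦ₂, hΦ₂'⟩ := K.exists_composable_map (hm1 p₀) hf
    (hft.mono fun q hq => (K.src_mul q.1).trans hq)
  obtain ⟨Φ₃, hΦ₃, hΦ₃'⟩ := K.exists_composable_map (hg2 p₀) hf hft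
  have hm3 : ContMDiffAt IP 𝓘(ℝ, EG) ∞ (fun q => K.mul (Φ₃ q)) p₀ :=
    (K.contMDiff_mul _).comp p₀ hΦ₃
  have ht3 : ∀ q : K.Composable × G, K.src q.1.snd = K.tgt (f q) →
      K.src q.1.fst = K.tgt (K.mul (Φ₃ q)) := fun q hq => by
    rw [K.tgt_mul, (hΦ₃' q hq).1]
    exact q.1.src_fst
  obtain ⟨Φ₄, hΦ₄, hΦ₄'⟩ := K.exists_composable_map (hg1 p₀) hm3 (hft.mono ht3)
  have e₂ : ∀ᶠ q in 𝓝 p₀, (Φ₂ q).fst = K.mul q.1 ∧ (Φ₂ q).snd = f q :=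
    hft.mono fun q hq => hΦ₂' q ((K.src_mul q.1).trans hq)
  have e₃ : ∀ᶠ q in 𝓝 p₀, (Φ₃ q).fst = q.1.snd ∧ (Φ₃ q).snd = f q := hft.mono fun q hq => hΦ₃' q hq
  have e₄ : ∀ᶠ q in 𝓝 p₀, (Φ₄ q).fst = q.1.fst ∧ (Φ₄ q).snd = K.mul (Φ₃ q) :=
    hft.mono fun q hq => hΦ₄' q (ht3 q hq)
  have z₂ : Φ₂ p₀ = c₂ :=
    K.composable_ext (e₂.self_of_nhds.1.trans b₁.symm) (e₂.self_of_nhds.2.trans hfk)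
  have z₃ : Φ₃ p₀ = c₃ :=
    K.composable_ext (e₃.self_of_nhds.1.trans b₂) ((e₃.self_of_nhds.2.trans hfk).trans b₃.symm)
  have z₄ : Φ₄ p₀ = c₄ := K.composable_ext (e₄.self_of_nhds.1.trans b₄.symm)
    ((e₄.self_of_nhds.2.trans (congrArg K.mul z₃)).trans b₅.symm)
  have d₂ : D IP 𝓘(ℝ, PairModel EM EG) Φ₂ p₀ ξ = a₂ := by
    have k1 := D_fst_of_eventuallyEq hΦ₂ (e₂.mono fun _ h => h.1) ξ
    have k2 := D_snd_of_eventuallyEq hΦ₂ (e₂.mono fun _ h => h.2) ξ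
    rw [z₂] at k1 k2
    refine K.D_composable_inj (k1.trans ?_) (k2.trans hDf)
    refine (D_comp_apply (J := 𝓘(ℝ, PairModel EM EG)) (K.contMDiff_mul _)
      (contMDiffAt_fst (p := p₀)) ξ).trans ?_
    exact (congrArg _ (D_fst p₀ ξ)).trans h₁.symm
  have d₃ : D IP 𝓘(ℝ, PairModel EM EG) Φ₃ p₀ ξ = a₃ := by
    have k1 := D_fst_of_eventuallyEq hΦ₃ (e₃.mono fun _ h => h.1) ξ
    have k2 := D_snd_of_eventuallyEq hΦ₃ (e₃.mono fun _ h => h.2) ξ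
    rw [z₃] at k1 k2
    refine K.D_composable_inj (k1.trans ?_) (k2.trans (hDf.trans h₃.symm))
    refine (D_comp_apply (J := 𝓘(ℝ, PairModel EM EG)) (K.contMDiff_composable_snd _)
      (contMDiffAt_fst (p := p₀)) ξ).trans ?_
    exact (congrArg _ (D_fst p₀ ξ)).trans h₂
  have d₄ : D IP 𝓘(ℝ, PairModel EM EG) Φ₄ p₀ ξ = a₄ := by
    have k1 := D_fst_of_eventuallyEq hΦ₄ (e₄.mono fun _ h => h.1) ξ
    have k2 := D_snd_of_eventuallyEq hΦ₄ (e₄.mono fun _ h => h.2) ξ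
    rw [z₄] at k1 k2
    refine K.D_composable_inj (k1.trans ?_) (k2.trans ?_)
    · refine (D_comp_apply (J := 𝓘(ℝ, PairModel EM EG)) (K.contMDiff_composable_fst _)
        (contMDiffAt_fst (p := p₀)) ξ).trans ?_
      exact (congrArg _ (D_fst p₀ ξ)).trans h₄.symm
    · refine (D_comp_apply (J := 𝓘(ℝ, PairModel EM EG)) (K.contMDiff_mul _) hΦ₃ ξ).trans ?_
      rw [d₃, z₃]
      exact h₅.symm
  -- Associativity holds as an identity of maps near `p₀`, and its derivative along `ξ` is the
  -- claim.
  have hassoc : K.mul ∘ Φ₂ =ᶠ[𝓝 p₀] K.mul ∘ Φ₄ := by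
    filter_upwards [hft, e₂, e₃, e₄] with q hq h2 h3 h4
    have y₂ : Φ₂ q = ⟨K.mul ⟨q.1.fst, q.1.snd, q.1.src_fst⟩, f q, (K.src_mul _).trans hq⟩ :=
      K.composable_ext h2.1 h2.2
    have y₃ : Φ₃ q = ⟨q.1.snd, f q, hq⟩ := K.composable_ext h3.1 h3.2
    have y₄ : Φ₄ q = ⟨q.1.fst, K.mul ⟨q.1.snd, f q, hq⟩,
        q.1.src_fst.trans (K.tgt_mul ⟨q.1.snd, f q, hq⟩).symm⟩ :=
      K.composable_ext h4.1 (h4.2.trans (congrArg K.mul y₃))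
    rw [Function.comp_apply, Function.comp_apply, y₂, y₄]
    exact K.mul_assoc _ _ _ q.1.src_fst hq
  have h := congrArg (fun L : PairModel EM EG × EG →L[ℝ] EG => L ξ)
    (D_congr (I := IP) (J := 𝓘(ℝ, EG)) hassoc)
  rwa [D_comp_apply (K.contMDiff_mul _) hΦ₂, D_comp_apply (K.contMDiff_mul _) hΦ₄, d₂, d₄, z₂,
    z₄] at h

end LieGroupoid

/-! ### The second tangent map on horizontal distributions -/

section secondTangent

variable {E H E' H' E'' H'' : Type*}
  [NormedAddCommGroup E] [NormedSpace ℝ E] [TopologicalSpace H]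
  [NormedAddCommGroup E'] [NormedSpace ℝ E'] [TopologicalSpace H']
  [NormedAddCommGroup E''] [NormedSpace ℝ E''] [TopologicalSpace H'']
  {I : ModelWithCorners ℝ E H} {J : ModelWithCorners ℝ E' H'} {K : ModelWithCorners ℝ E'' H''}
  {M N Q : Type*} [TopologicalSpace M] [ChartedSpace H M] [IsManifold I ∞ M]
  [TopologicalSpace N] [ChartedSpace H' N] [IsManifold J ∞ N]
  [TopologicalSpace Q] [ChartedSpace H'' Q] [IsManifold K ∞ Q]

variable (I J) in
/-- The tangent map of the tangent map. -/
def tangentMap₂ (F : M → N) : TangentBundle I.tangent (TangentBundle I M) →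
    TangentBundle J.tangent (TangentBundle J N) :=
  tangentMap I.tangent J.tangent (tangentMap I J F)

theorem contMDiff_tangentMap₂ {F : M → N} (hF : ContMDiff I J ∞ F) :
    ContMDiff I.tangent.tangent J.tangent.tangent ∞ (tangentMap₂ I J F) :=
  contMDiff_tangentMap (contMDiff_tangentMap hF)

theorem tangentMap₂_id (ξ : TangentBundle I.tangent (TangentBundle I M)) :
    tangentMap₂ I I id ξ = ξ := by
  rw [tangentMap₂, tangentMap_id, tangentMap_id, id]

theorem tangentMap₂_tangentMap₂ {F : M → N} {F' : N → Q} {F'' : M → Q} (hF' : ContMDiff J K ∞ F')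
    (hF : ContMDiff I J ∞ F) (h : ∀ x, F' (F x) = F'' x)
    (ξ : TangentBundle I.tangent (TangentBundle I M)) :
    tangentMap₂ J K F' (tangentMap₂ I J F ξ) = tangentMap₂ I K F'' ξ := by
  have h0 : F'' = F' ∘ F := funext fun x => (h x).symm
  rw [tangentMap₂, tangentMap₂, tangentMap₂, h0,
    tangentMap_comp (hF'.mdifferentiable (by simp)) (hF.mdifferentiable (by simp)),
    tangentMap_comp ((contMDiff_tangentMap hF').mdifferentiable (by simp))
      ((contMDiff_tangentMap hF).mdifferentiable (by simp))]
  rfl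

variable [FiniteDimensional ℝ E] [T2Space M] [I.Boundaryless]
  [FiniteDimensional ℝ E'] [T2Space N] [J.Boundaryless]

theorem Conn.mem_horizontal_iff {cov : Conn I M}
    {ξ : TangentBundle I.tangent (TangentBundle I M)} :
    ξ ∈ cov.horizontal ↔ ∃ x e w, ξ = cov.lift x e w :=
  ⟨fun h => ⟨_, _, _, Conn.eq_lift h⟩, by rintro ⟨x, e, w, rfl⟩; exact cov.lift_mem x e w⟩

theorem Conn.lift_inj {cov : Conn I M} {x x' : M} {e e' w w' : E}
    (h : cov.lift x e w = cov.lift x' e' w') : x = x' ∧ e = e' ∧ w = w' := by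
  refine ⟨congrArg (fun ξ : TangentBundle I.tangent (TangentBundle I M) => ξ.proj.proj) h,
    congrArg (fun ξ : TangentBundle I.tangent (TangentBundle I M) => fib ξ.proj) h, ?_⟩
  have h1 := congrArg (fun ξ : TangentBundle I.tangent (TangentBundle I M) => fib (tproj I ξ)) h
  simp only [Conn.tproj_lift] at h1
  exact h1

theorem RelChr.tangentMap₂_lift {F : M → N} (hF : ContMDiff I J ∞ F) {cov : Conn I M}
    {cov' : Conn J N} (h : RelChr I J F cov.Γ cov'.Γ) (x : M) (e w : E) :
    tangentMap₂ I J F (cov.lift x e w) = cov'.lift (F x) (D I J F x e) (D I J F x w) :=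
  h.tangentMap_lift (hF x) e w

theorem RelChr.tangentMap₂_mem {F : M → N} (hF : ContMDiff I J ∞ F) {cov : Conn I M}
    {cov' : Conn J N} (h : RelChr I J F cov.Γ cov'.Γ)
    {ξ : TangentBundle I.tangent (TangentBundle I M)} (hξ : ξ ∈ cov.horizontal) :
    tangentMap₂ I J F ξ ∈ cov'.horizontal := by
  rw [Conn.eq_lift hξ, h.tangentMap₂_lift hF]
  exact cov'.lift_mem _ _ _

/-- The restriction of the second tangent map to the horizontal distributions of related
connections. -/
def horizontalMap {F : M → N} (hF : ContMDiff I J ∞ F) {cov : Conn I M}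
    {cov' : Conn J N} (h : RelChr I J F cov.Γ cov'.Γ) (ξ : cov.horizontal) : cov'.horizontal :=
  ⟨tangentMap₂ I J F ξ, h.tangentMap₂_mem hF ξ.2⟩

theorem contMDiff_horizontalMap {V V' : Type*} [NormedAddCommGroup V] [NormedSpace ℝ V]
    [NormedAddCommGroup V'] [NormedSpace ℝ V'] {F : M → N} (hF : ContMDiff I J ∞ F)
    {cov : Conn I M} {cov' : Conn J N} (h : RelChr I J F cov.Γ cov'.Γ)
    [ChartedSpace V cov.horizontal] [ChartedSpace V' cov'.horizontal]
    (hS : IsSubmanifold I.tangent.tangent V cov.horizontal)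
    (hS' : IsSubmanifold J.tangent.tangent V' cov'.horizontal) :
    ContMDiff 𝓘(ℝ, V) 𝓘(ℝ, V') ∞ (horizontalMap hF h) := fun _ =>
  hS'.contMDiffAt_iff.2 (((contMDiff_tangentMap₂ hF).comp hS.contMDiff_val) _)

end secondTangent

/-! ### The Lie groupoid of horizontal vectors -/

namespace LieGroupoid

variable {EM EG M G : Type*}
  [NormedAddCommGroup EM] [NormedSpace ℝ EM] [FiniteDimensional ℝ EM]
  [NormedAddCommGroup EG] [NormedSpace ℝ EG] [FiniteDimensional ℝ EG]
  [TopologicalSpace M] [ChartedSpace EM M] [IsManifold 𝓘(ℝ, EM) ∞ M]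
  [TopologicalSpace G] [ChartedSpace EG G] [IsManifold 𝓘(ℝ, EG) ∞ G]
  {K : LieGroupoid EM EG M G}

/-- `D_composable_inj` is used for `e`, then for `w`, and finally for `η`, once the Hessian terms
coincide and can be cancelled. -/
theorem tangentMap₂_composable_ext {ξ ζ : TangentBundle 𝓘(ℝ, PairModel EM EG).tangent
      (TangentBundle 𝓘(ℝ, PairModel EM EG) K.Composable)}
    (h1 : tangentMap₂ 𝓘(ℝ, PairModel EM EG) 𝓘(ℝ, EG) SourceTarget.Composable.fst ξ =
      tangentMap₂ 𝓘(ℝ, PairModel EM EG) 𝓘(ℝ, EG) SourceTarget.Composable.fst ζ)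
    (h2 : tangentMap₂ 𝓘(ℝ, PairModel EM EG) 𝓘(ℝ, EG) SourceTarget.Composable.snd ξ =
      tangentMap₂ 𝓘(ℝ, PairModel EM EG) 𝓘(ℝ, EG) SourceTarget.Composable.snd ζ) : ξ = ζ := by
  obtain ⟨c, e, w, η, rfl⟩ : ∃ c e w η, ξ = tt 𝓘(ℝ, PairModel EM EG) c e w η :=
    ⟨_, _, _, _, tt_surj ξ⟩
  obtain ⟨c', e', w', η', rfl⟩ : ∃ c e w η, ζ = tt 𝓘(ℝ, PairModel EM EG) c e w η :=
    ⟨_, _, _, _, tt_surj ζ⟩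
  obtain rfl : c = c' := K.composable_ext (congrArg (fun ξ => ξ.proj.proj) h1)
    (congrArg (fun ξ => ξ.proj.proj) h2)
  rw [tangentMap₂, tangentMap_tt (K.contMDiff_composable_fst c),
    tangentMap_tt (K.contMDiff_composable_fst c), tt_inj] at h1
  rw [tangentMap₂, tangentMap_tt (K.contMDiff_composable_snd c),
    tangentMap_tt (K.contMDiff_composable_snd c), tt_inj] at h2
  obtain rfl := K.D_composable_inj h1.1 h2.1
  obtain rfl := K.D_composable_inj h1.2.1 h2.2.1
  rw [K.D_composable_inj (add_left_cancel h1.2.2) (add_left_cancel h2.2.2)]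

variable [T2Space M] [T2Space G]

/-- Connections on the objects and the composable pairs that are related to a multiplicative
connection by the structure maps. -/
structure RelatedConns (K : LieGroupoid EM EG M G) (cov : Conn 𝓘(ℝ, EG) G)
    (covM : Conn 𝓘(ℝ, EM) M) (covC : Conn 𝓘(ℝ, PairModel EM EG) K.Composable) : Prop where
  smooth : cov.IsSmooth
  smooth_pairs : covC.IsSmooth
  src : RelChr 𝓘(ℝ, EG) 𝓘(ℝ, EM) K.src cov.Γ covM.Γ
  tgt : RelChr 𝓘(ℝ, EG) 𝓘(ℝ, EM) K.tgt cov.Γ covM.Γ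
  fst : RelChr 𝓘(ℝ, PairModel EM EG) 𝓘(ℝ, EG) SourceTarget.Composable.fst covC.Γ cov.Γ
  snd : RelChr 𝓘(ℝ, PairModel EM EG) 𝓘(ℝ, EG) SourceTarget.Composable.snd covC.Γ cov.Γ
  mul : RelChr 𝓘(ℝ, PairModel EM EG) 𝓘(ℝ, EG) K.mul covC.Γ cov.Γ

namespace RelatedConns

variable {cov : Conn 𝓘(ℝ, EG) G} {covM : Conn 𝓘(ℝ, EM) M}
  {covC : Conn 𝓘(ℝ, PairModel EM EG) K.Composable} (h : K.RelatedConns cov covM covC)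

include h

theorem unit : RelChr 𝓘(ℝ, EM) 𝓘(ℝ, EG) K.unit covM.Γ cov.Γ :=
  relChr_unit h.src h.tgt h.fst h.snd h.mul

theorem inv : RelChr 𝓘(ℝ, EG) 𝓘(ℝ, EG) K.inv cov.Γ cov.Γ :=
  relChr_inv h.src h.tgt h.fst h.snd h.mul

/-- The sources and targets of horizontal vectors are horizontal lifts on M, so composability of `A`
and `B` amounts to composability of both projections in TG. These give two vectors tangent to G⁽²⁾,
whose horizontal lift has the components `A` and `B`. -/
theorem exists_pair {A B : TangentBundle 𝓘(ℝ, EG).tangent (TangentBundle 𝓘(ℝ, EG) G)}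
    (hA : A ∈ cov.horizontal) (hB : B ∈ cov.horizontal)
    (hAB : tangentMap₂ 𝓘(ℝ, EG) 𝓘(ℝ, EM) K.src A = tangentMap₂ 𝓘(ℝ, EG) 𝓘(ℝ, EM) K.tgt B) :
    ∃ ξ ∈ covC.horizontal,
      tangentMap₂ 𝓘(ℝ, PairModel EM EG) 𝓘(ℝ, EG) SourceTarget.Composable.fst ξ = A ∧
      tangentMap₂ 𝓘(ℝ, PairModel EM EG) 𝓘(ℝ, EG) SourceTarget.Composable.snd ξ = B := by
  obtain ⟨g, e, w, rfl⟩ := Conn.mem_horizontal_iff.1 hA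
  obtain ⟨g', e', w', rfl⟩ := Conn.mem_horizontal_iff.1 hB
  rw [h.src.tangentMap₂_lift K.contMDiff_src, h.tgt.tangentMap₂_lift K.contMDiff_tgt] at hAB
  obtain ⟨hg, he, hw⟩ := Conn.lift_inj hAB
  obtain ⟨a, ha1, ha2⟩ := K.exists_D_composable ⟨g, g', hg⟩ he
  obtain ⟨b, hb1, hb2⟩ := K.exists_D_composable ⟨g, g', hg⟩ hw
  refine ⟨covC.lift ⟨g, g', hg⟩ a b, covC.lift_mem _ _ _, ?_, ?_⟩
  · rw [h.fst.tangentMap₂_lift K.contMDiff_composable_fst, ha1, hb1]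
  · rw [h.snd.tangentMap₂_lift K.contMDiff_composable_snd, ha2, hb2]

variable {V₀ V : Type*} [NormedAddCommGroup V₀] [NormedSpace ℝ V₀] [FiniteDimensional ℝ V₀]
  [NormedAddCommGroup V] [NormedSpace ℝ V] [FiniteDimensional ℝ V]
  [ChartedSpace V₀ covM.horizontal] [ChartedSpace V cov.horizontal]
  [IsManifold 𝓘(ℝ, V₀) ∞ covM.horizontal] [IsManifold 𝓘(ℝ, V) ∞ cov.horizontal]
  (hS₀ : IsSubmanifold 𝓘(ℝ, EM).tangent.tangent V₀ covM.horizontal)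
  (hS : IsSubmanifold 𝓘(ℝ, EG).tangent.tangent V cov.horizontal)

include hS₀ hS

/-- A local section of the source through the given horizontal vector is built from the local
product `r` of G: the two tangent vectors are moved by dr, and the horizontal lift of the results is
taken. -/
theorem surjective_D_src (A : cov.horizontal) :
    Function.Surjective (D 𝓘(ℝ, V) 𝓘(ℝ, V₀) (horizontalMap K.contMDiff_src h.src) A) := by
  obtain ⟨A, hA⟩ := A
  obtain ⟨g₀, e₀, w₀, rfl⟩ := Conn.mem_horizontal_iff.1 hA
  obtain ⟨r, hr, hr1, hr2⟩ := K.exists_local_product g₀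
  let IP := 𝓘(ℝ, EM).prod 𝓘(ℝ, EG)
  -- The base component varies with `a`, while the fibre data `g₀`, `e₀`, `w₀` stay fixed. The
  -- section passes through the given vector because r(s g, g) = g, and it is a section because s ∘
  -- r is the first projection.
  let σ : covM.horizontal → cov.horizontal := fun a => ⟨cov.lift (r (a.1.proj.proj, g₀))
    (D IP 𝓘(ℝ, EG) r (a.1.proj.proj, g₀) (fib a.1.proj, e₀))
    (D IP 𝓘(ℝ, EG) r (a.1.proj.proj, g₀) (fib (tproj 𝓘(ℝ, EM) a.1), w₀)), cov.lift_mem _ _ _⟩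
  have key : ∀ e : EG, D IP 𝓘(ℝ, EG) r (K.src g₀, g₀) (D 𝓘(ℝ, EG) 𝓘(ℝ, EM) K.src g₀ e, e) = e := by
    intro e
    let κ : G → M × G := fun g => (K.src g, g)
    have hκ : ContMDiff 𝓘(ℝ, EG) IP ∞ κ := K.contMDiff_src.prodMk contMDiff_id
    have h2 : D 𝓘(ℝ, EG) IP κ g₀ e = (D 𝓘(ℝ, EG) 𝓘(ℝ, EM) K.src g₀ e, e) :=
      (D_prodMk (K.contMDiff_src g₀) (contMDiffAt_id (x := g₀)) e).trans (Prod.ext rfl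
        (congrArg (fun L : EG →L[ℝ] EG => L e) (D_id g₀)))
    have h3 : D 𝓘(ℝ, EG) 𝓘(ℝ, EG) (r ∘ κ) g₀ e = e :=
      congrArg (fun L : EG →L[ℝ] EG => L e)
        ((D_congr (F := r ∘ κ) (F' := id) hr2).trans (D_id g₀))
    rwa [D_comp_apply (J := IP) (F := κ) hr (hκ g₀), h2] at h3
  have hsrc : horizontalMap K.contMDiff_src h.src ⟨cov.lift g₀ e₀ w₀, hA⟩ =
      ⟨covM.lift (K.src g₀) (D 𝓘(ℝ, EG) 𝓘(ℝ, EM) K.src g₀ e₀)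
        (D 𝓘(ℝ, EG) 𝓘(ℝ, EM) K.src g₀ w₀), covM.lift_mem _ _ _⟩ :=
    Subtype.ext (h.src.tangentMap₂_lift K.contMDiff_src g₀ e₀ w₀)
  have hr2' : r (K.src g₀, g₀) = g₀ := hr2.self_of_nhds
  have hb : ContMDiff 𝓘(ℝ, V₀) 𝓘(ℝ, EM) ∞ fun a : covM.horizontal => a.1.proj.proj :=
    (contMDiff_proj (I := 𝓘(ℝ, EM))).comp
      ((contMDiff_proj (I := 𝓘(ℝ, EM).tangent)).comp hS₀.contMDiff_val)
  have hb1 : ContMDiff 𝓘(ℝ, V₀) 𝓘(ℝ, EM).tangent ∞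
      fun a : covM.horizontal => vec 𝓘(ℝ, EM) a.1.proj.proj (fib a.1.proj) :=
    (contMDiff_proj (I := 𝓘(ℝ, EM).tangent)).comp hS₀.contMDiff_val
  have hb2 : ContMDiff 𝓘(ℝ, V₀) 𝓘(ℝ, EM).tangent ∞
      fun a : covM.horizontal => vec 𝓘(ℝ, EM) a.1.proj.proj (fib (tproj 𝓘(ℝ, EM) a.1)) :=
    contMDiff_tproj.comp hS₀.contMDiff_val
  have hconst : ∀ (e : EG) a, ContMDiffAt 𝓘(ℝ, V₀) 𝓘(ℝ, EG).tangent ∞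
      (fun _ : covM.horizontal => vec 𝓘(ℝ, EG) g₀ e) a := fun e a => contMDiffAt_const
  refine surjective_of_local_section (σ := σ)
    (contMDiff_horizontalMap K.contMDiff_src h.src hS hS₀ _) ?_ ?_ ?_
  · rw [hsrc]
    refine hS.contMDiffAt_iff.2 (h.smooth.contMDiffAt_lift
      (ContMDiffAt.vec_tangentMap (I := IP) (b := fun a : covM.horizontal => (a.1.proj.proj, g₀)) hr
        (contMDiffAt_vec_prod.2 ⟨hb1 _, hconst e₀ _⟩))
      (ContMDiffAt.vec_tangentMap (I := IP) (b := fun a : covM.horizontal => (a.1.proj.proj, g₀)) hr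
        (contMDiffAt_vec_prod.2 ⟨hb2 _, hconst w₀ _⟩)))
  · rw [hsrc]
    refine Subtype.ext ?_
    change cov.lift (r (K.src g₀, g₀)) (D IP 𝓘(ℝ, EG) r (K.src g₀, g₀) _)
      (D IP 𝓘(ℝ, EG) r (K.src g₀, g₀) (fib (tproj 𝓘(ℝ, EM) (covM.lift _ _ _)), w₀)) = _
    rw [covM.tproj_lift]
    exact (congrArg₂ (cov.lift _) (key e₀) (key w₀)).trans (by rw [hr2'])
  · rw [hsrc]
    have hc : ContinuousAt (fun a : covM.horizontal => (a.1.proj.proj, g₀))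
        ⟨covM.lift (K.src g₀) (D 𝓘(ℝ, EG) 𝓘(ℝ, EM) K.src g₀ e₀)
        (D 𝓘(ℝ, EG) 𝓘(ℝ, EM) K.src g₀ w₀), covM.lift_mem _ _ _⟩ :=
      hb.continuous.continuousAt.prodMk continuousAt_const
    have hr' : ∀ᶠ q in 𝓝 (K.src g₀, g₀), MDifferentiableAt IP 𝓘(ℝ, EG) r q :=
      eventually_mdifferentiableAt hr
    -- The identity s ∘ r = pr₁ is differentiated at points near the base point, so it has to hold
    -- on a neighbourhood of each of them.
    filter_upwards [hc.eventually hr1.eventually_nhds, hc.eventually hr'] with a ha hra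
    refine Subtype.ext ?_
    have hD : ∀ v : EM × EG, D 𝓘(ℝ, EG) 𝓘(ℝ, EM) K.src (r (a.1.proj.proj, g₀))
        (D IP 𝓘(ℝ, EG) r (a.1.proj.proj, g₀) v) = v.1 := fun v => by
      rw [← D_comp_apply' ((K.contMDiff_src _).mdifferentiableAt (by simp)) hra]
      exact (congrArg (fun L : EM × EG →L[ℝ] EM => L v)
        (D_congr (F := K.src ∘ r) (F' := Prod.fst) ha)).trans (D_fst _ v)
    refine (h.src.tangentMap₂_lift K.contMDiff_src _ _ _).trans ?_
    rw [hD, hD, ha.self_of_nhds]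
    exact (Conn.eq_lift a.2).symm

end RelatedConns

end LieGroupoid

namespace LieGroupoid

variable {EM EG M G : Type*}
  [NormedAddCommGroup EM] [NormedSpace ℝ EM] [FiniteDimensional ℝ EM]
  [NormedAddCommGroup EG] [NormedSpace ℝ EG] [FiniteDimensional ℝ EG]
  [TopologicalSpace M] [ChartedSpace EM M] [IsManifold 𝓘(ℝ, EM) ∞ M]
  [TopologicalSpace G] [ChartedSpace EG G] [IsManifold 𝓘(ℝ, EG) ∞ G]
  {K : LieGroupoid EM EG M G} [T2Space M] [T2Space G]
  {cov : Conn 𝓘(ℝ, EG) G} {covM : Conn 𝓘(ℝ, EM) M}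
  {covC : Conn 𝓘(ℝ, PairModel EM EG) K.Composable}

theorem mul_assoc_of_eq {c₁ c₂ c₃ c₄ : K.Composable} (b₁ : c₂.fst = K.mul c₁)
    (b₂ : c₁.snd = c₃.fst) (b₃ : c₃.snd = c₂.snd) (b₄ : c₄.fst = c₁.fst)
    (b₅ : c₄.snd = K.mul c₃) : K.mul c₂ = K.mul c₄ := by
  have H : K.src c₁.snd = K.tgt c₂.snd := by rw [b₂, c₃.src_fst, b₃]
  have y₂ : c₂ = ⟨K.mul ⟨c₁.fst, c₁.snd, c₁.src_fst⟩, c₂.snd, (K.src_mul _).trans H⟩ :=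
    K.composable_ext b₁ rfl
  have y₃ : c₃ = ⟨c₁.snd, c₂.snd, H⟩ := K.composable_ext b₂.symm b₃
  have y₄ : c₄ = ⟨c₁.fst, K.mul ⟨c₁.snd, c₂.snd, H⟩,
      c₁.src_fst.trans (K.tgt_mul ⟨c₁.snd, c₂.snd, H⟩).symm⟩ :=
    K.composable_ext b₄ (b₅.trans (congrArg K.mul y₃))
  rw [y₂, y₄]
  exact K.mul_assoc _ _ _ c₁.src_fst H

namespace RelatedConns

variable (h : K.RelatedConns cov covM covC)
  {V₀ V : Type*} [NormedAddCommGroup V₀] [NormedSpace ℝ V₀] [FiniteDimensional ℝ V₀]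
  [NormedAddCommGroup V] [NormedSpace ℝ V] [FiniteDimensional ℝ V]
  [ChartedSpace V₀ covM.horizontal] [ChartedSpace V cov.horizontal]
  [IsManifold 𝓘(ℝ, V₀) ∞ covM.horizontal] [IsManifold 𝓘(ℝ, V) ∞ cov.horizontal]
  (hS₀ : IsSubmanifold 𝓘(ℝ, EM).tangent.tangent V₀ covM.horizontal)
  (hS : IsSubmanifold 𝓘(ℝ, EG).tangent.tangent V cov.horizontal)

/-- The source and target maps of the groupoid of horizontal vectors. -/
def sourceTarget : SourceTarget V₀ V covM.horizontal cov.horizontal where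
  src := horizontalMap K.contMDiff_src h.src
  tgt := horizontalMap K.contMDiff_tgt h.tgt
  isSubmersion_src := IsSubmersionOfComplement.isSubmersion (F := FibreModel V₀ V) fun A =>
    isSubmersionAt_of_surjective (contMDiff_horizontalMap K.contMDiff_src h.src hS hS₀)
      (h.surjective_D_src hS₀ hS A)
  contMDiff_tgt := contMDiff_horizontalMap K.contMDiff_tgt h.tgt hS hS₀

theorem exists_pair_composable (d : (h.sourceTarget hS₀ hS).Composable) :
    ∃ ξ : covC.horizontal,
      tangentMap₂ 𝓘(ℝ, PairModel EM EG) 𝓘(ℝ, EG) SourceTarget.Composable.fst ξ.1 = d.fst ∧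
      tangentMap₂ 𝓘(ℝ, PairModel EM EG) 𝓘(ℝ, EG) SourceTarget.Composable.snd ξ.1 = d.snd := by
  obtain ⟨ξ, hξ, h1⟩ := h.exists_pair d.fst.2 d.snd.2 (congrArg Subtype.val d.src_fst)
  exact ⟨⟨ξ, hξ⟩, h1⟩

/-- The horizontal vector tangent to the composable pairs that represents a composable pair of
horizontal vectors. -/
def pair (d : (h.sourceTarget hS₀ hS).Composable) : covC.horizontal :=
  (h.exists_pair_composable hS₀ hS d).choose

theorem fst_pair (d : (h.sourceTarget hS₀ hS).Composable) :
    tangentMap₂ 𝓘(ℝ, PairModel EM EG) 𝓘(ℝ, EG) SourceTarget.Composable.fst (h.pair hS₀ hS d).1 =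
      d.fst := (h.exists_pair_composable hS₀ hS d).choose_spec.1

theorem snd_pair (d : (h.sourceTarget hS₀ hS).Composable) :
    tangentMap₂ 𝓘(ℝ, PairModel EM EG) 𝓘(ℝ, EG) SourceTarget.Composable.snd (h.pair hS₀ hS d).1 =
      d.snd := (h.exists_pair_composable hS₀ hS d).choose_spec.2

/-- The representing vector was obtained by choice, but it is the horizontal lift of its two
projections. Their components are projections of the two given horizontal vectors and so depend
smoothly on them. -/
theorem contMDiff_pair : ContMDiff 𝓘(ℝ, PairModel V₀ V) 𝓘(ℝ, PairModel EM EG).tangent.tangent ∞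
    fun d => (h.pair hS₀ hS d).1 := by
  intro d
  have hi := (h.sourceTarget hS₀ hS).contMDiff_incl
  have h1 : ContMDiff 𝓘(ℝ, PairModel V₀ V) 𝓘(ℝ, EG).tangent.tangent ∞
      fun d : (h.sourceTarget hS₀ hS).Composable => d.fst.1 :=
    hS.contMDiff_val.comp (contMDiff_fst.comp hi)
  have h2 : ContMDiff 𝓘(ℝ, PairModel V₀ V) 𝓘(ℝ, EG).tangent.tangent ∞
      fun d : (h.sourceTarget hS₀ hS).Composable => d.snd.1 :=
    hS.contMDiff_val.comp (contMDiff_snd.comp hi)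
  have he : ContMDiffAt 𝓘(ℝ, PairModel V₀ V) 𝓘(ℝ, PairModel EM EG).tangent ∞
      (fun d => vec 𝓘(ℝ, PairModel EM EG) (h.pair hS₀ hS d).1.proj.proj
        (fib (h.pair hS₀ hS d).1.proj)) d := by
    refine K.contMDiffAt_vec_composable (b := fun d => (h.pair hS₀ hS d).1.proj.proj)
      (v := fun d => fib (h.pair hS₀ hS d).1.proj) ?_ ?_
    · refine (((contMDiff_proj (I := 𝓘(ℝ, EG).tangent)).comp h1) d).congr_of_eventuallyEq
        (Filter.Eventually.of_forall fun d => ?_)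
      exact congrArg TotalSpace.proj (h.fst_pair hS₀ hS d)
    · refine (((contMDiff_proj (I := 𝓘(ℝ, EG).tangent)).comp h2) d).congr_of_eventuallyEq
        (Filter.Eventually.of_forall fun d => ?_)
      exact congrArg TotalSpace.proj (h.snd_pair hS₀ hS d)
  have hw : ContMDiffAt 𝓘(ℝ, PairModel V₀ V) 𝓘(ℝ, PairModel EM EG).tangent ∞
      (fun d => vec 𝓘(ℝ, PairModel EM EG) (h.pair hS₀ hS d).1.proj.proj
        (fib (tproj 𝓘(ℝ, PairModel EM EG) (h.pair hS₀ hS d).1))) d := by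
    refine K.contMDiffAt_vec_composable (b := fun d => (h.pair hS₀ hS d).1.proj.proj)
      (v := fun d => fib (tproj 𝓘(ℝ, PairModel EM EG) (h.pair hS₀ hS d).1)) ?_ ?_
    · refine ((contMDiff_tproj.comp h1) d).congr_of_eventuallyEq
        (Filter.Eventually.of_forall fun d => ?_)
      exact (tproj_tangentMap K.contMDiff_composable_fst (h.pair hS₀ hS d).1).symm.trans
        (congrArg (tproj 𝓘(ℝ, EG)) (h.fst_pair hS₀ hS d))
    · refine ((contMDiff_tproj.comp h2) d).congr_of_eventuallyEq
        (Filter.Eventually.of_forall fun d => ?_)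
      exact (tproj_tangentMap K.contMDiff_composable_snd (h.pair hS₀ hS d).1).symm.trans
        (congrArg (tproj 𝓘(ℝ, EG)) (h.snd_pair hS₀ hS d))
  refine (h.smooth_pairs.contMDiffAt_lift he hw).congr_of_eventuallyEq
    (Filter.Eventually.of_forall fun d => ?_)
  exact Conn.eq_lift (h.pair hS₀ hS d).2

/-- The product of composable horizontal vectors. -/
def prod (d : (h.sourceTarget hS₀ hS).Composable) : cov.horizontal :=
  horizontalMap K.contMDiff_mul h.mul (h.pair hS₀ hS d)

theorem contMDiff_prod : ContMDiff 𝓘(ℝ, PairModel V₀ V) 𝓘(ℝ, V) ∞ (h.prod hS₀ hS) := fun _ =>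
  hS.contMDiffAt_iff.2
    (((contMDiff_tangentMap₂ K.contMDiff_mul).comp (h.contMDiff_pair hS₀ hS)) _)

/-- By `tangentMap₂_composable_ext` the representing vector is unique, so any ξ with the right
components computes the product, without first checking that it is horizontal. -/
theorem prod_eq {d : (h.sourceTarget hS₀ hS).Composable}
    {ξ : TangentBundle 𝓘(ℝ, PairModel EM EG).tangent
      (TangentBundle 𝓘(ℝ, PairModel EM EG) K.Composable)}
    (h1 : tangentMap₂ 𝓘(ℝ, PairModel EM EG) 𝓘(ℝ, EG) SourceTarget.Composable.fst ξ = d.fst)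
    (h2 : tangentMap₂ 𝓘(ℝ, PairModel EM EG) 𝓘(ℝ, EG) SourceTarget.Composable.snd ξ = d.snd) :
    (h.prod hS₀ hS d : TangentBundle 𝓘(ℝ, EG).tangent (TangentBundle 𝓘(ℝ, EG) G)) =
      tangentMap₂ 𝓘(ℝ, PairModel EM EG) 𝓘(ℝ, EG) K.mul ξ :=
  congrArg (tangentMap₂ 𝓘(ℝ, PairModel EM EG) 𝓘(ℝ, EG) K.mul) (tangentMap₂_composable_ext
    ((h.fst_pair hS₀ hS d).trans h1.symm) ((h.snd_pair hS₀ hS d).trans h2.symm))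

/-- A groupoid identity in one arrow is an identity between maps G → G obtained by composing G →
G⁽²⁾ with the multiplication. Applying the second tangent functor transfers it to H; all unit and
inverse laws are instances. -/
theorem prod_eq_of_pairMap {f₁ f₂ f₃ : G → G} (hf₁ : ContMDiff 𝓘(ℝ, EG) 𝓘(ℝ, EG) ∞ f₁)
    (hf₂ : ContMDiff 𝓘(ℝ, EG) 𝓘(ℝ, EG) ∞ f₂) (H : ∀ g, K.src (f₁ g) = K.tgt (f₂ g))
    (hm : ∀ g, K.mul (K.pairMap f₁ f₂ H g) = f₃ g)
    {d : (h.sourceTarget hS₀ hS).Composable}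
    {A : TangentBundle 𝓘(ℝ, EG).tangent (TangentBundle 𝓘(ℝ, EG) G)}
    (h1 : (d.fst : TangentBundle 𝓘(ℝ, EG).tangent (TangentBundle 𝓘(ℝ, EG) G)) =
      tangentMap₂ 𝓘(ℝ, EG) 𝓘(ℝ, EG) f₁ A)
    (h2 : (d.snd : TangentBundle 𝓘(ℝ, EG).tangent (TangentBundle 𝓘(ℝ, EG) G)) =
      tangentMap₂ 𝓘(ℝ, EG) 𝓘(ℝ, EG) f₂ A) :
    (h.prod hS₀ hS d : TangentBundle 𝓘(ℝ, EG).tangent (TangentBundle 𝓘(ℝ, EG) G)) =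
      tangentMap₂ 𝓘(ℝ, EG) 𝓘(ℝ, EG) f₃ A := by
  have hp := contMDiff_pairMap H hf₁ hf₂
  rw [h.prod_eq hS₀ hS (ξ := tangentMap₂ 𝓘(ℝ, EG) 𝓘(ℝ, PairModel EM EG) (K.pairMap f₁ f₂ H) A)]
  · exact tangentMap₂_tangentMap₂ K.contMDiff_mul hp hm A
  · exact (tangentMap₂_tangentMap₂ K.contMDiff_composable_fst hp (fun _ => rfl) A).trans h1.symm
  · exact (tangentMap₂_tangentMap₂ K.contMDiff_composable_snd hp (fun _ => rfl) A).trans h2.symm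

/-- Both products are horizontal, so it suffices to compare their two projections to TG. Each
projection commutes with the structure maps, and the identity becomes associativity in TG, used once
for the base vectors and once for the directions. -/
theorem prod_assoc {d₁ d₂ d₃ d₄ : (h.sourceTarget hS₀ hS).Composable}
    (h₁ : d₂.fst = h.prod hS₀ hS d₁) (h₂ : d₁.snd = d₃.fst) (h₃ : d₃.snd = d₂.snd)
    (h₄ : d₄.fst = d₁.fst) (h₅ : d₄.snd = h.prod hS₀ hS d₃) :
    h.prod hS₀ hS d₂ = h.prod hS₀ hS d₄ := by
  let fst₁ := tangentMap 𝓘(ℝ, PairModel EM EG) 𝓘(ℝ, EG)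
    (SourceTarget.Composable.fst : K.Composable → G)
  let snd₁ := tangentMap 𝓘(ℝ, PairModel EM EG) 𝓘(ℝ, EG)
    (SourceTarget.Composable.snd : K.Composable → G)
  let mul₁ := tangentMap 𝓘(ℝ, PairModel EM EG) 𝓘(ℝ, EG) K.mul
  have assoc : ∀ ξ₁ ξ₂ ξ₃ ξ₄ : TangentBundle 𝓘(ℝ, PairModel EM EG) K.Composable,
      fst₁ ξ₂ = mul₁ ξ₁ → snd₁ ξ₁ = fst₁ ξ₃ → snd₁ ξ₃ = snd₁ ξ₂ → fst₁ ξ₄ = fst₁ ξ₁ →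
      snd₁ ξ₄ = mul₁ ξ₃ → mul₁ ξ₂ = mul₁ ξ₄ := by
    intro ξ₁ ξ₂ ξ₃ ξ₄ k₁ k₂ k₃ k₄ k₅
    have hD := D_mul_assoc (congrArg TotalSpace.proj k₁) (congrArg TotalSpace.proj k₂)
      (congrArg TotalSpace.proj k₃) (congrArg TotalSpace.proj k₄) (congrArg TotalSpace.proj k₅)
      (congrArg fib k₁) (congrArg fib k₂) (congrArg fib k₃) (congrArg fib k₄) (congrArg fib k₅)
    have hm := mul_assoc_of_eq (congrArg TotalSpace.proj k₁) (congrArg TotalSpace.proj k₂)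
      (congrArg TotalSpace.proj k₃) (congrArg TotalSpace.proj k₄) (congrArg TotalSpace.proj k₅)
    exact (congrArg (fun g => vec 𝓘(ℝ, EG) g _) hm).trans (congrArg (vec 𝓘(ℝ, EG) _) hD)
  let fst₂ := tangentMap₂ 𝓘(ℝ, PairModel EM EG) 𝓘(ℝ, EG)
    (SourceTarget.Composable.fst : K.Composable → G)
  let snd₂ := tangentMap₂ 𝓘(ℝ, PairModel EM EG) 𝓘(ℝ, EG)
    (SourceTarget.Composable.snd : K.Composable → G)
  let mul₂ := tangentMap₂ 𝓘(ℝ, PairModel EM EG) 𝓘(ℝ, EG) K.mul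
  have k₁ : fst₂ (h.pair hS₀ hS d₂).1 = mul₂ (h.pair hS₀ hS d₁).1 :=
    (h.fst_pair hS₀ hS d₂).trans (congrArg Subtype.val h₁)
  have k₂ : snd₂ (h.pair hS₀ hS d₁).1 = fst₂ (h.pair hS₀ hS d₃).1 :=
    (h.snd_pair hS₀ hS d₁).trans ((congrArg Subtype.val h₂).trans (h.fst_pair hS₀ hS d₃).symm)
  have k₃ : snd₂ (h.pair hS₀ hS d₃).1 = snd₂ (h.pair hS₀ hS d₂).1 :=
    (h.snd_pair hS₀ hS d₃).trans ((congrArg Subtype.val h₃).trans (h.snd_pair hS₀ hS d₂).symm)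
  have k₄ : fst₂ (h.pair hS₀ hS d₄).1 = fst₂ (h.pair hS₀ hS d₁).1 :=
    (h.fst_pair hS₀ hS d₄).trans ((congrArg Subtype.val h₄).trans (h.fst_pair hS₀ hS d₁).symm)
  have k₅ : snd₂ (h.pair hS₀ hS d₄).1 = mul₂ (h.pair hS₀ hS d₃).1 :=
    (h.snd_pair hS₀ hS d₄).trans (congrArg Subtype.val h₅)
  refine Subtype.ext (Conn.horizontal_ext (h.prod hS₀ hS d₂).2 (h.prod hS₀ hS d₄).2 ?_ ?_)
  · exact assoc _ _ _ _ (congrArg TotalSpace.proj k₁) (congrArg TotalSpace.proj k₂)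
      (congrArg TotalSpace.proj k₃) (congrArg TotalSpace.proj k₄) (congrArg TotalSpace.proj k₅)
  · have f := tproj_tangentMap (I := 𝓘(ℝ, PairModel EM EG)) K.contMDiff_composable_fst
    have s := tproj_tangentMap (I := 𝓘(ℝ, PairModel EM EG)) K.contMDiff_composable_snd
    have m := tproj_tangentMap (I := 𝓘(ℝ, PairModel EM EG)) K.contMDiff_mul
    refine (m _).trans (Eq.trans ?_ (m _).symm)
    let p := fun d => tproj 𝓘(ℝ, PairModel EM EG) (h.pair hS₀ hS d).1
    refine assoc (p d₁) (p d₂) (p d₃) (p d₄) ?_ ?_ ?_ ?_ ?_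
    · exact (f _).symm.trans ((congrArg (tproj 𝓘(ℝ, EG)) k₁).trans (m _))
    · exact (s _).symm.trans ((congrArg (tproj 𝓘(ℝ, EG)) k₂).trans (f _))
    · exact (s _).symm.trans ((congrArg (tproj 𝓘(ℝ, EG)) k₃).trans (s _))
    · exact (f _).symm.trans ((congrArg (tproj 𝓘(ℝ, EG)) k₄).trans (f _))
    · exact (s _).symm.trans ((congrArg (tproj 𝓘(ℝ, EG)) k₅).trans (m _))

/-- The Lie groupoid of horizontal vectors of a multiplicative connection. -/
def groupoid : LieGroupoid V₀ V covM.horizontal cov.horizontal where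
  toSourceTarget := h.sourceTarget hS₀ hS
  unit := horizontalMap K.contMDiff_unit h.unit
  inv := horizontalMap K.contMDiff_inv h.inv
  mul := h.prod hS₀ hS
  contMDiff_unit := contMDiff_horizontalMap K.contMDiff_unit h.unit hS₀ hS
  contMDiff_inv := contMDiff_horizontalMap K.contMDiff_inv h.inv hS hS
  contMDiff_mul := h.contMDiff_prod hS₀ hS
  src_unit _ := Subtype.ext <| (tangentMap₂_tangentMap₂ K.contMDiff_src K.contMDiff_unit
    (F'' := id) K.src_unit _).trans (tangentMap₂_id _)
  tgt_unit _ := Subtype.ext <| (tangentMap₂_tangentMap₂ K.contMDiff_tgt K.contMDiff_unit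
    (F'' := id) K.tgt_unit _).trans (tangentMap₂_id _)
  src_inv _ := Subtype.ext <| tangentMap₂_tangentMap₂ K.contMDiff_src K.contMDiff_inv K.src_inv _
  tgt_inv _ := Subtype.ext <| tangentMap₂_tangentMap₂ K.contMDiff_tgt K.contMDiff_inv K.tgt_inv _
  src_mul d := Subtype.ext <| (tangentMap₂_tangentMap₂ K.contMDiff_src K.contMDiff_mul
    K.src_mul _).trans <| (tangentMap₂_tangentMap₂ K.contMDiff_src K.contMDiff_composable_snd
      (fun _ => rfl) _).symm.trans
      (congrArg (tangentMap₂ 𝓘(ℝ, EG) 𝓘(ℝ, EM) K.src) (h.snd_pair hS₀ hS d))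
  tgt_mul d := Subtype.ext <| (tangentMap₂_tangentMap₂ K.contMDiff_tgt K.contMDiff_mul
    K.tgt_mul _).trans <| (tangentMap₂_tangentMap₂ K.contMDiff_tgt K.contMDiff_composable_fst
      (fun _ => rfl) _).symm.trans
      (congrArg (tangentMap₂ 𝓘(ℝ, EG) 𝓘(ℝ, EM) K.tgt) (h.fst_pair hS₀ hS d))
  unit_mul A := Subtype.ext <| (h.prod_eq_of_pairMap hS₀ hS (K.contMDiff_unit.comp K.contMDiff_tgt)
    contMDiff_id (fun _ => K.src_unit _) K.unit_mul (A := A)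
    (tangentMap₂_tangentMap₂ K.contMDiff_unit K.contMDiff_tgt (fun _ => rfl) _)
    (tangentMap₂_id _).symm).trans (tangentMap₂_id _)
  mul_unit A := Subtype.ext <| (h.prod_eq_of_pairMap hS₀ hS contMDiff_id
    (K.contMDiff_unit.comp K.contMDiff_src) (fun _ => (K.tgt_unit _).symm) K.mul_unit (A := A)
    (tangentMap₂_id _).symm
    (tangentMap₂_tangentMap₂ K.contMDiff_unit K.contMDiff_src (fun _ => rfl) _)).trans
      (tangentMap₂_id _)
  inv_mul A := Subtype.ext <| (h.prod_eq_of_pairMap hS₀ hS K.contMDiff_inv contMDiff_id K.src_inv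
    K.inv_mul (A := A) rfl (tangentMap₂_id _).symm).trans
      (tangentMap₂_tangentMap₂ K.contMDiff_unit K.contMDiff_src (fun _ => rfl) _).symm
  mul_inv A := Subtype.ext <| (h.prod_eq_of_pairMap hS₀ hS contMDiff_id K.contMDiff_inv
    (fun g => (K.tgt_inv g).symm) K.mul_inv (A := A) (tangentMap₂_id _).symm rfl).trans
      (tangentMap₂_tangentMap₂ K.contMDiff_unit K.contMDiff_tgt (fun _ => rfl) _).symm
  mul_assoc A B C hAB hBC := h.prod_assoc hS₀ hS (d₁ := ⟨A, B, hAB⟩) (d₃ := ⟨B, C, hBC⟩)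
    rfl rfl rfl rfl rfl

end RelatedConns

theorem IsMulChr.isLieSubgroupoid [SecondCountableTopology G] (hc : cov.IsSmooth)
    (h : K.IsMulChr cov.Γ) :
    IsLieSubgroupoid 𝓘(ℝ, EM).tangent.tangent 𝓘(ℝ, EG).tangent.tangent
      K.tangentTangentMaps cov.horizontal := by
  obtain ⟨covM, cov2, covC, hM, -, hC, hs, ht, -, -, -, h1, h2, hm⟩ := h.exists_conns hc
  have H : K.RelatedConns cov covM covC := ⟨hc, hC, hs, ht, h1, h2, hm⟩
  obtain ⟨i₀, j₀, hS₀⟩ := exists_isSubmanifold_horizontal hM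
  obtain ⟨i, j, hS⟩ := exists_isSubmanifold_horizontal hc
  exact ⟨covM.horizontal, _, _, i₀, j₀, i, j, H.groupoid hS₀ hS, hS₀.isSmoothEmbedding,
    hS.isSmoothEmbedding, fun _ => rfl, fun _ => rfl, fun _ => rfl, fun _ => rfl,
    fun c d hc1 hc2 => H.prod_eq hS₀ hS hc1 hc2⟩

end LieGroupoid

end MultConn

end

theorem proposition3p3 {EM EG M G : Type*}
    [NormedAddCommGroup EM] [NormedSpace ℝ EM] [FiniteDimensional ℝ EM]
    [NormedAddCommGroup EG] [NormedSpace ℝ EG] [FiniteDimensional ℝ EG]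
    [TopologicalSpace M] [T2Space M] [SecondCountableTopology M]
    [ChartedSpace EM M] [IsManifold 𝓘(ℝ, EM) ∞ M]
    [TopologicalSpace G] [T2Space G] [SecondCountableTopology G]
    [ChartedSpace EG G] [IsManifold 𝓘(ℝ, EG) ∞ G]
    (K : MultConn.LieGroupoid EM EG M G) (cov : MultConn.Conn 𝓘(ℝ, EG) G)
    (hcov : cov.IsSmooth) :
    List.TFAE [
      -- (1) the connection is multiplicative
      cov.IsMultiplicative 𝓘(ℝ, EM) 𝓘(ℝ, EG) 𝓘(ℝ, MultConn.PairModel EM EG) K.maps,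
      -- (2) its symmetric part and its torsion are multiplicative
      cov.symPart.IsMultiplicative 𝓘(ℝ, EM) 𝓘(ℝ, EG) 𝓘(ℝ, MultConn.PairModel EM EG) K.maps ∧
        cov.torsionTensor.IsMultiplicative 𝓘(ℝ, EM) 𝓘(ℝ, EG)
          𝓘(ℝ, MultConn.PairModel EM EG) K.maps,
      -- (3) its horizontal distribution is a Lie subgroupoid of `TTG ⇉ TTM`
      MultConn.IsLieSubgroupoid 𝓘(ℝ, EM).tangent.tangent 𝓘(ℝ, EG).tangent.tangent
        K.tangentTangentMaps cov.horizontal,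
      -- (4) its vertical projection is a multiplicative tensor on `TG ⇉ TM`
      ∃ θ, cov.IsVerticalProjection θ ∧
        (MultConn.endoToTensor θ).IsMultiplicative 𝓘(ℝ, EM).tangent 𝓘(ℝ, EG).tangent
          𝓘(ℝ, MultConn.PairModel EM EG).tangent K.tangentMaps,
      -- (5) its torsion is multiplicative, its geodesic spray is multiplicative on `TG ⇉ TM`
      cov.torsionTensor.IsMultiplicative 𝓘(ℝ, EM) 𝓘(ℝ, EG)
          𝓘(ℝ, MultConn.PairModel EM EG) K.maps ∧
        ∃ Z, cov.IsGeodesicSpray Z ∧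
          Z.toTensor.IsMultiplicative 𝓘(ℝ, EM).tangent 𝓘(ℝ, EG).tangent
            𝓘(ℝ, MultConn.PairModel EM EG).tangent K.tangentMaps]
 := by
  open MultConn LieGroupoid in
  -- `IsMulChr` is the hub: every other condition is compared with the first through it.
  have h12 : K.IsMulChr cov.Γ ↔
      cov.IsMultiplicative 𝓘(ℝ, EM) 𝓘(ℝ, EG) 𝓘(ℝ, PairModel EM EG) K.maps :=
    ⟨fun h => h.isMultiplicative hcov, isMulChr_of_isMultiplicative⟩
  tfae_have 1 ↔ 2 := by
    rw [← h12]
    refine ⟨fun h => ⟨h.symPart.isMultiplicative hcov.symPart,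
      h.isMultiplicative_torsionTensor hcov⟩, fun h => ?_⟩
    exact isMulChr_of_symPart (isMulChr_of_isMultiplicative h.1)
      (isMulTensor_of_isMultiplicative h.2)
  tfae_have 1 ↔ 3 := by
    rw [← h12]
    exact ⟨fun h => h.isLieSubgroupoid hcov, isMulChr_of_isLieSubgroupoid⟩
  tfae_have 1 ↔ 4 := by
    rw [← h12]
    -- The vertical projection exists and is unique, so the quantifier over θ disappears; the same
    -- happens below for the spray.
    simp only [Conn.isVerticalProjection_iff, exists_eq_left]
    exact ⟨fun h => h.isMultiplicative_vert hcov, isMulChr_of_vert⟩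
  tfae_have 1 ↔ 5 := by
    rw [← h12]
    simp only [Conn.isGeodesicSpray_iff, exists_eq_left]
    refine ⟨fun h => ⟨h.isMultiplicative_torsionTensor hcov, h.isMultiplicative_spray hcov⟩,
      fun h => ?_⟩
    -- The spray sees only Γ(e, e), so polarization yields the law for the symmetric part alone; the
    -- torsion supplies the antisymmetric part.
    have h' := (isMulQuad_of_spray h.2).polarize
    rw [polarize_Γ] at h'
    exact isMulChr_of_symPart h' (isMulTensor_of_isMultiplicative h.1)
  tfae_finish
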